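/- Let $k\ge 3$ be odd and let $V=\mathbb{R}^k$ or $V=\{x\in\mathbb{R}^k:\sum_i x_i=0\}$, with the Euclidean inner product. Let $\Phi^+=\{e_i-e_j:1\le i<j\le k\}$ be the positive roots of type $A_{k-1}$ and $W$ the Weyl group generated by the reflections $s_\alpha$, $\alpha\in\Phi^+$; let $W_a$ be the affine Weyl group of type $\widetilde A_{k-1}$, generated by the reflections in the hyperplanes $\{x:\langle x,\alpha\rangle=n\}$, $\alpha\in\Phi^+$, $n\in\mathbb{Z}$; and let $\mathcal{A}=\{x\in V:0<\langle x,\alpha\rangle<1 \text{ for all }\alpha\in\Phi^+\}$ be the fundamental alcove. Put $I=\{e_1-e_2,e_3-e_4,\ldots,e_{k-2}-e_{k-1}\}$ and $\mathcal{I}=\{wI: w\in W,\ wI\subset\Phi^+\}$, and for $A=wI\in\mathcal{I}$ let $\varepsilon_A=\det w$ (this does not depend on the choice of $w$). For $A\in\mathcal{I}$ and $v\in V$ let $$E_A=\{v\in\mathrm{Span}(A):\langle v,\beta\rangle\in\mathbb{Z}\ \text{ for all }\beta\in A\},\quad \varepsilon^A_v=(-1)^{\#\{\beta\in A:\langle v,\beta\rangle>0\}},\quad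 |v|_A=\max_{\beta\in A}|\langle v,\beta\rangle|.$$ Let $X=(X_t)_{t\ge0}$ be a $V$-valued process, with law $\mathbb{P}_x$ when it is started at $x\in V$, which is reflectable for $W_a$: it has the strong Markov property (with respect to its completed natural filtration), its sample paths are almost surely continuous, and the law of $wX$ under $\mathbb{P}_x$ is the law of $X$ under $\mathbb{P}_{wx}$ for all $w\in W_a$ and $x\in V$. Let $$T_{\beta,v}=\inf\{t\ge 0:\langle X_t,\beta\rangle=\langle v,\beta\rangle\},\qquad T_{A,v}=\min_{\beta\in A}T_{\beta,v},$$ and let $\widetilde T$ be the first exit time of $X$ from $\mathcal{A}$, that is, the first time at which $\langle X_t,e_i-e_{i+1}\rangle=0$ for some $1\le i\le k-1$ or $\langle X_t,e_1-e_k\rangle=1$. Then for all $x\in\mathcal{A}$ and $t\ge 0$, $$\mathbb{P}_x(\widetilde T>t)=\sum_{A\in\mathcal{I}}\ \sum_{n=0}^{\infty}\ \sum_{\substack{v\in E_A\\ |v|_A=n}}\varepsilon_A\,\varepsilon^A_v\,\mathbb{P}_x(T_{A,v}>t)$$ whenever this sum converges, that is, whenever for every $A$ in the finite set $\mathcal{I}$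 the series over $n$ converges (as the limit of its partial sums; for each $n$ the sum over $v$ is finite). -/

import Mathlib

open MeasureTheory Filter Topology
open scoped NNReal ENNReal

namespace AlcoveExit

section General

variable {V : Type*} [NormedAddCommGroup V] [InnerProductSpace ℝ V]

/-- The coroot `2 α / ⟨α, α⟩`. -/
noncomputable def coroot (α : V) : V := (2 / inner ℝ α α) • α

/-- The reflection `s_α` in the hyperplane orthogonal to `α`. -/
noncomputable def rootRefl (α : V) : V ≃ₗᵢ[ℝ] V := (Submodule.span ℝ {α})ᗮ.reflection

theorem rootRefl_apply (α x : V) : rootRefl α x = x - inner ℝ α x • coroot α := by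
  rw [rootRefl, Submodule.reflection_orthogonal_apply, Submodule.reflection_singleton_apply,
    coroot, smul_smul, real_inner_self_eq_norm_sq]
  simp only [RCLike.ofReal_real_eq_id, id_eq, neg_sub, ← Nat.cast_smul_eq_nsmul ℝ, smul_smul]
  congr 2
  push_cast
  ring

/-- An affine root is a pair `(α, n)`; its value at `x` is `⟨α, x⟩ - n`. -/
noncomputable def affEval (l : V × ℤ) (x : V) : ℝ := inner ℝ l.1 x - (l.2 : ℝ)

/-- The affine reflection `s_(α, n)`: the reflection `s_α` followed by the translation by `n α^∨`. -/
noncomputable def affRefl (l : V × ℤ) : V ≃ᵃⁱ[ℝ] V :=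
  (rootRefl l.1).toAffineIsometryEquiv.trans
    (AffineIsometryEquiv.constVAdd ℝ V ((l.2 : ℝ) • coroot l.1))

theorem affRefl_apply (l : V × ℤ) (x : V) :
    affRefl l x = x - affEval l x • coroot l.1 := by
  simp only [affRefl, AffineIsometryEquiv.coe_trans, Function.comp_apply,
    LinearIsometryEquiv.coe_toAffineIsometryEquiv, AffineIsometryEquiv.coe_constVAdd,
    vadd_eq_add, rootRefl_apply, affEval, sub_smul]
  abel

/-- The Weyl group generated by the reflections in the (positive) roots. -/
noncomputable def weylGroup (posRoots : Set V) : Subgroup (V ≃ₗᵢ[ℝ] V) :=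
  Subgroup.closure (rootRefl '' posRoots)

/-- The affine Weyl group, generated by the reflections in the hyperplanes `⟨α, x⟩ = n` with `α` a
positive root and `n` an integer. -/
noncomputable def affineWeylGroup (posRoots : Set V) : Subgroup (V ≃ᵃⁱ[ℝ] V) :=
  Subgroup.closure (affRefl '' (posRoots ×ˢ (Set.univ : Set ℤ)))

/-- The fundamental alcove. -/
def alcove (posRoots : Set V) : Set V :=
  {x | ∀ α ∈ posRoots, 0 < inner ℝ x α ∧ inner ℝ x α < 1}

/-- The family of the sets `w I`, for `w` in the Weyl group with `w I` contained in the positive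
roots. -/
def signedSets (posRoots I : Set V) : Set (Set V) :=
  {A | ∃ w ∈ weylGroup posRoots, w '' I ⊆ posRoots ∧ w '' I = A}

/-- The sign `ε_A = det w`, where `w` is an element of the Weyl group with `w I = A` (which one does
not matter for the `I` of interest); it is `0` by convention if there is none. -/
noncomputable def setSign (posRoots I A : Set V) : ℝ :=
  open scoped Classical in
  if h : ∃ w ∈ weylGroup posRoots, w '' I = A then
    LinearMap.det (h.choose.toLinearEquiv : V →ₗ[ℝ] V)
  else 0

/-- The lattice `E_A`. -/
def latticeE (A : Set V) : Set V :=
  {v | v ∈ Submodule.span ℝ A ∧ ∀ β ∈ A, ∃ n : ℤ, inner ℝ v β = (n : ℝ)}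

/-- The sign `ε_v^A`. -/
noncomputable def latticeSign (A : Set V) (v : V) : ℝ :=
  (-1) ^ {β ∈ A | 0 < inner ℝ v β}.ncard

/-- The norm `|v|_A = max {|⟨v, β⟩| : β ∈ A}` for finite `A` (it is `0` if `A` is empty). -/
noncomputable def latticeNorm (A : Set V) (v : V) : ℝ :=
  ⨆ β : A, |inner ℝ v (β : V)|

/-- The time `T_(β, v)` at which the path `γ` first satisfies `⟨γ, β⟩ = ⟨v, β⟩`
(infinite if this never happens). -/
noncomputable def hitTime (β v : V) (γ : ℝ≥0 → V) : ℝ≥0∞ :=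
  sInf {r | ∃ s : ℝ≥0, inner ℝ (γ s) β = inner ℝ v β ∧ (s : ℝ≥0∞) = r}

/-- `T_(A, v)`, the minimum over `β ∈ A` of the times `T_(β, v)`. -/
noncomputable def setHitTime (A : Set V) (v : V) (γ : ℝ≥0 → V) : ℝ≥0∞ :=
  ⨅ β ∈ A, hitTime β v γ

/-- `T_l` for an affine root `l`: the first time at which `l` vanishes on the path `γ`. -/
noncomputable def affHitTime (l : V × ℤ) (γ : ℝ≥0 → V) : ℝ≥0∞ :=
  sInf {r | ∃ s : ℝ≥0, affEval l (γ s) = 0 ∧ (s : ℝ≥0∞) = r}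

/-- The exit time from the fundamental alcove: the minimum of the times `T_l` over the members `l`
of the affine simple system. -/
noncomputable def exitTime (affSimple : Set (V × ℤ)) (γ : ℝ≥0 → V) : ℝ≥0∞ :=
  ⨅ l ∈ affSimple, affHitTime l γ

end General

section Markov

variable {V Ω : Type*} [MeasurableSpace V] [MeasurableSpace Ω]

/-- `E` belongs, up to a `μ`-null set, to the σ-algebra generated by `X s`, `s ≤ t`. -/
def IsKnownAt (μ : Measure Ω) (X : ℝ≥0 → Ω → V) (t : ℝ≥0) (E : Set Ω) : Prop :=
  ∃ F : Set Ω,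
    MeasurableSet[⨆ s : Set.Iic t, MeasurableSpace.comap (X s) inferInstance] F ∧ E =ᵐ[μ] F

/-- `τ` is a stopping time of the natural filtration of `X`, completed by the `μ`-null sets. -/
def IsStopTime (μ : Measure Ω) (X : ℝ≥0 → Ω → V) (τ : Ω → ℝ≥0∞) : Prop :=
  ∀ t : ℝ≥0, IsKnownAt μ X t {ω | τ ω ≤ t}

/-- `E` belongs to the σ-algebra of the events prior to `τ`. (Only the part of `E` on which `τ` is
finite matters here.) -/
def IsPriorEvent (μ : Measure Ω) (X : ℝ≥0 → Ω → V) (τ : Ω → ℝ≥0∞) (E : Set Ω) : Prop :=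
  ∀ t : ℝ≥0, IsKnownAt μ X t (E ∩ {ω | τ ω ≤ t})

/-- The strong Markov property of the family `P x`, `x : V`, of laws of the process `X`: on
`{τ < ∞}` the conditional law of `(X (τ + s))_s` given the past up to the stopping time `τ` is the
law of `X` started at `X τ`. -/
def HasStrongMarkovProperty (X : ℝ≥0 → Ω → V) (P : V → Measure Ω) : Prop :=
  ∀ (x : V) (τ : Ω → ℝ≥0∞), IsStopTime (P x) X τ →
    ∀ E : Set Ω, IsPriorEvent (P x) X τ E →
      ∀ B : Set (ℝ≥0 → V), MeasurableSet B →
        P x (E ∩ {ω | τ ω < ⊤} ∩ {ω | (fun s => X ((τ ω).toNNReal + s) ω) ∈ B}) =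
          ∫⁻ ω in E ∩ {ω | τ ω < ⊤}, P (X (τ ω).toNNReal ω) {ω' | (fun s => X s ω') ∈ B} ∂(P x)

variable [NormedAddCommGroup V] [InnerProductSpace ℝ V]

/-- `X`, with law `P x` when it is started at `x`, is a reflectable process for the group `G` of
affine isometries. -/
structure IsReflectable (G : Subgroup (V ≃ᵃⁱ[ℝ] V)) (X : ℝ≥0 → Ω → V) (P : V → Measure Ω) :
    Prop where
  isProbabilityMeasure : ∀ x, IsProbabilityMeasure (P x)
  measurable : ∀ t, Measurable (X t)
  start : ∀ x, ∀ᵐ ω ∂(P x), X 0 ω = x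
  measurable_law : ∀ B : Set (ℝ≥0 → V), MeasurableSet B →
    Measurable fun x => P x {ω | (fun s => X s ω) ∈ B}
  strongMarkov : HasStrongMarkovProperty X P
  continuous_paths : ∀ x, ∀ᵐ ω ∂(P x), Continuous fun s => X s ω
  invariant : ∀ w ∈ G, ∀ x,
    (P x).map (fun ω s => w (X s ω)) = (P (w x)).map (fun ω s => X s ω)

end Markov

section TypeA

/-- The hyperplane of vectors in `ℝ^k` with coordinate sum zero. -/
def sumZero (k : ℕ) : Submodule ℝ (EuclideanSpace ℝ (Fin k)) where
  carrier := {x | ∑ i, x i = 0}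
  add_mem' {a b} ha hb := by
    simp only [Set.mem_ofPred_eq, PiLp.add_apply, Finset.sum_add_distrib] at *
    rw [ha, hb, add_zero]
  zero_mem' := by simp
  smul_mem' c a ha := by
    simp only [Set.mem_ofPred_eq, PiLp.smul_apply, smul_eq_mul, ← Finset.mul_sum] at *
    rw [ha, mul_zero]

variable {k : ℕ}

/-- `e_i - e_j` (coordinates are numbered from `0` to `k - 1`). -/
noncomputable def diffVec (i j : Fin k) : EuclideanSpace ℝ (Fin k) :=
  EuclideanSpace.single i 1 - EuclideanSpace.single j 1

variable (V : Submodule ℝ (EuclideanSpace ℝ (Fin k)))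

/-- The positive roots `e_i - e_j`, `i < j`, of type `A_(k-1)`. -/
def posRootsA : Set V := {α | ∃ i j : Fin k, i < j ∧ (α : EuclideanSpace ℝ (Fin k)) = diffVec i j}

/-- The simple roots `e_i - e_(i+1)`. -/
def simpleRootsA : Set V :=
  {α | ∃ i j : Fin k, i.val + 1 = j.val ∧ (α : EuclideanSpace ℝ (Fin k)) = diffVec i j}

/-- The affine simple system: the pairs `(α, 0)` with `α` simple, and `(-θ, -1)`, where `θ` is the
highest root, that is, the difference of the first and the last basis vector. -/
def affSimpleA : Set (V × ℤ) :=
  {l | l.1 ∈ simpleRootsA V ∧ l.2 = 0} ∪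
  {l | ∃ i j : Fin k, i.val = 0 ∧ j.val + 1 = k ∧
    (l.1 : EuclideanSpace ℝ (Fin k)) = - diffVec i j ∧ l.2 = -1}

/-- The set `I` of type `A_(k-1)`: the differences of the first and second, of the third and
fourth, ... basis vectors. -/
def baseSetA : Set V :=
  {α | ∃ (m : ℕ) (i j : Fin k), i.val = 2 * m ∧ j.val = 2 * m + 1 ∧
    (α : EuclideanSpace ℝ (Fin k)) = diffVec i j}

/-- The family of sets obtained from `I`. -/
def familyA : Set (Set V) := signedSets (posRootsA V) (baseSetA V)

theorem familyA_finite : (familyA V).Finite := by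
  have h : (posRootsA V).Finite := by
    refine Set.Finite.of_finite_image (f := Subtype.val) ?_ Subtype.val_injective.injOn
    refine (Set.finite_range fun p : Fin k × Fin k => diffVec p.1 p.2).subset ?_
    rintro _ ⟨α, ⟨i, j, -, h⟩, rfl⟩
    exact ⟨(i, j), h.symm⟩
  refine h.finite_subsets.subset ?_
  rintro _ ⟨w, -, h1, rfl⟩
  exact h1

/-- The sign `ε_A` of a member of the family. -/
noncomputable def signA (A : Set V) : ℝ := setSign (posRootsA V) (baseSetA V) A

end TypeA

end AlcoveExit

open AlcoveExit

/-!
Fix `A = w I` in the family; its members `β` are orthogonal roots. A vector `v` of `E_A` is given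
by its integer inner products `n_β` with these roots, and `T_{A,v} > t` means that for each `β`
the real path `⟨X, β⟩` has not attained the level `n_β` by time `t`. So the partial sum over
`|v|_A < N` is the expectation of a product over `β ∈ A` of signed sums over integer levels
(`levelSum`), and its convergence can be studied for one root at a time. The path `⟨X, β⟩` starts
in `(0, 1)`. If it leaves this interval first at `0` or at `1`, then reflecting `X` from the exit
time on preserves the law of `X` on this event, does not affect the other roots of `A`, and
reverses the signs of the levels, which are antisymmetric about both `0` and `1`. Thus all terms
cancel after an exit at `0`. After an exit at `1` the two lowest levels of the truncated sum have
no counterpart; they have not been attained by time `t` if `N` is large, and contribute `2`. If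
there is no exit, the sum of the signs is `1`. What is left (`residualSum`) is bounded by `2` for
each root, so by dominated convergence the series for `A` converges, for every reflectable
process, to the signed expectation of the product of the exit values `0`, `1` or `2` of the paths
`⟨X, β⟩` (`IsReflectable.tendsto_integral_prod_levelSum`, `IsReflectable.tendsto_sum_lattice`).

The exit values of `X_i - X_j` form an antisymmetric matrix `G` of odd size, and the sum over the
family is, up to a constant factor, the expectation of the alternating sum `altSum` over all
permutations of the products of `(k - 1) / 2` entries of `G`. Up to a constant, this alternating
sum is the Pfaffian of `G` bordered by ones. Suppose
that `X` leaves the alcove by time `t`, and reflect it from then on in the first wall that it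
hits. A wall `x_i = x_{i+1}` exchanges two adjacent rows and columns of `G`, because the entry at
`(i, i + 1)` is `0`. For the wall `x_1 - x_k = 1` the same holds after multiples of the border of
ones have been added to the first and last row and column: the entry at `(1, k)` is `2`, and an
exit at `0` is exchanged with one at `1` elsewhere in these rows and columns. Bordering by ones
makes the alternating sum invariant under such additions (`altSum_add_sub`). So the reflection
changes the sign of the alternating sum (`altSum_exitMatrix_reflectAfter`), and only the paths
that have stayed in the alcove contribute to its expectation
(`IsReflectable.integral_eq_setIntegral_of_walls`). For them all entries of `G` above the diagonal
are `1`, and the alternating sum is the signed number of matchings, which is `1` up to the same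
constant factor (`sum_sign_orderedPerms`).
-/

namespace AlcoveExit

/-! ### Hitting times of closed sets by continuous paths -/

/-- The infimum of a set of times, infinite if the set is empty. -/
noncomputable def firstTime (C : Set ℝ≥0) : ℝ≥0∞ :=
  sInf {r | ∃ s : ℝ≥0, s ∈ C ∧ (s : ℝ≥0∞) = r}

theorem firstTime_le_coe {C : Set ℝ≥0} {s : ℝ≥0} (hs : s ∈ C) : firstTime C ≤ s :=
  sInf_le ⟨s, hs, rfl⟩

theorem exists_firstTime_eq {C : Set ℝ≥0} (hC : IsClosed C) (h : firstTime C < ⊤) :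
    ∃ s ∈ C, firstTime C = s := by
  have hne : C.Nonempty := by
    by_contra hemp
    rw [Set.not_nonempty_iff_eq_empty] at hemp
    simp [firstTime, hemp] at h
  refine ⟨sInf C, hC.csInf_mem hne (OrderBot.bddBelow C), le_antisymm ?_ ?_⟩
  · exact firstTime_le_coe (hC.csInf_mem hne (OrderBot.bddBelow C))
  · refine le_sInf ?_
    rintro _ ⟨s, hs, rfl⟩
    exact_mod_cast csInf_le (OrderBot.bddBelow C) hs

theorem firstTime_le_iff {C : Set ℝ≥0} (hC : IsClosed C) (t : ℝ≥0) :
    firstTime C ≤ t ↔ ∃ s ≤ t, s ∈ C := by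
  constructor
  · intro h
    obtain ⟨s, hs, he⟩ := exists_firstTime_eq hC (h.trans_lt ENNReal.coe_lt_top)
    rw [he] at h
    exact ⟨s, by exact_mod_cast h, hs⟩
  · rintro ⟨s, hst, hs⟩
    exact (firstTime_le_coe hs).trans (by exact_mod_cast hst)

theorem lt_firstTime_iff {C : Set ℝ≥0} (hC : IsClosed C) (t : ℝ≥0) :
    t < firstTime C ↔ ∀ s ≤ t, s ∉ C := by
  rw [← not_le, firstTime_le_iff hC]
  push Not
  rfl

section Hits

variable {V : Type*}

/-- The set of paths that come arbitrarily close to the level `c` of `l`, by time `t`, along a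
countable dense set of times. It lies in the product σ-algebra, and a continuous path belongs to it
if and only if it attains the level by time `t`. -/
def approxHits (l : V → ℝ) (c : ℝ) (t : ℝ≥0) : Set (ℝ≥0 → V) :=
  ⋂ m : ℕ, ⋃ d : ℕ,
    {γ | |l (γ (min (TopologicalSpace.denseSeq ℝ≥0 d) t)) - c| < 1 / ((m : ℝ) + 1)}

theorem mem_approxHits_iff [TopologicalSpace V] {l : V → ℝ} (hl : Continuous l) (c : ℝ) (t : ℝ≥0)
    {γ : ℝ≥0 → V} (hγ : Continuous γ) :
    γ ∈ approxHits l c t ↔ ∃ s ≤ t, l (γ s) = c := by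
  have hf : Continuous fun s => |l (γ s) - c| := by fun_prop
  simp only [approxHits, Set.mem_iInter, Set.mem_iUnion, Set.mem_ofPred_eq]
  constructor
  · intro h
    obtain ⟨s, hs, hmin⟩ := (isCompact_Icc (a := (0 : ℝ≥0)) (b := t)).exists_isMinOn
      ⟨0, by simp⟩ hf.continuousOn
    refine ⟨s, hs.2, ?_⟩
    have h0 : |l (γ s) - c| ≤ 0 := by
      refine le_of_forall_pos_le_add fun ε hε => ?_
      obtain ⟨m, hm⟩ := exists_nat_one_div_lt hε
      obtain ⟨d, hd⟩ := h m
      have := hmin (show min (TopologicalSpace.denseSeq ℝ≥0 d) t ∈ Set.Icc 0 t by simp)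
      simp only [Set.mem_ofPred_eq] at this
      linarith
    have := abs_nonpos_iff.1 h0
    linarith
  · rintro ⟨s, hst, hs⟩ m
    have hg : Continuous fun d => |l (γ (min d t)) - c| := by fun_prop
    have hopen : IsOpen {d : ℝ≥0 | |l (γ (min d t)) - c| < 1 / ((m : ℝ) + 1)} :=
      isOpen_lt hg continuous_const
    obtain ⟨d, hd⟩ := (TopologicalSpace.denseRange_denseSeq ℝ≥0).exists_mem_open hopen
      ⟨s, by simp only [Set.mem_ofPred_eq, min_eq_left hst, hs, sub_self, abs_zero]; positivity⟩
    exact ⟨d, hd⟩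

theorem measurableSet_approxHits [MeasurableSpace V] {l : V → ℝ} (hl : Measurable l) (c : ℝ)
    (t : ℝ≥0) : MeasurableSet (approxHits l c t) := by
  refine MeasurableSet.iInter fun m => MeasurableSet.iUnion fun d => ?_
  refine measurableSet_lt ?_ measurable_const
  exact continuous_abs.measurable.comp ((hl.comp (measurable_pi_apply _)).sub_const c)

end Hits

/-! ### The completed filtration and events prior to a stopping time -/

section StopTimes

variable {V Ω : Type*} [MeasurableSpace V] [mΩ : MeasurableSpace Ω]
  {μ : Measure Ω} {X : ℝ≥0 → Ω → V}

/-- The σ-algebra of the events known at time `t`: it is generated by the values of the process up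
to time `t` and by the null sets. -/
@[reducible]
def knownSpace (μ : Measure Ω) (X : ℝ≥0 → Ω → V) (t : ℝ≥0) : MeasurableSpace Ω :=
  @eventuallyMeasurableSpace Ω (⨆ s : Set.Iic t, MeasurableSpace.comap (X s) inferInstance)
    (ae μ) _

theorem isKnownAt_iff {t : ℝ≥0} {E : Set Ω} :
    IsKnownAt μ X t E ↔ MeasurableSet[knownSpace μ X t] E := Iff.rfl

theorem IsKnownAt.mono {s t : ℝ≥0} (hst : s ≤ t) {E : Set Ω} (h : IsKnownAt μ X s E) :
    IsKnownAt μ X t E := by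
  obtain ⟨F, hF, hEF⟩ := h
  refine ⟨F, ?_, hEF⟩
  refine (iSup_le fun r : Set.Iic s => ?_ : (⨆ r : Set.Iic s,
    MeasurableSpace.comap (X r) inferInstance) ≤ _) F hF
  exact le_iSup (fun r : Set.Iic t => MeasurableSpace.comap (X r) inferInstance)
    (⟨r.1, le_trans r.2 hst⟩ : Set.Iic t)

theorem IsKnownAt.nullMeasurableSet (hX : ∀ t, Measurable (X t)) {t : ℝ≥0} {E : Set Ω}
    (h : IsKnownAt μ X t E) : NullMeasurableSet E μ := by
  obtain ⟨F, hF, hEF⟩ := h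
  refine NullMeasurableSet.congr (MeasurableSet.nullMeasurableSet ?_) hEF.symm
  exact (iSup_le fun r : Set.Iic t => (hX r).comap_le : (⨆ r : Set.Iic t,
    MeasurableSpace.comap (X r) inferInstance) ≤ _) F hF

theorem isKnownAt_preimage {s t : ℝ≥0} (hst : s ≤ t) {C : Set V} (hC : MeasurableSet C) :
    IsKnownAt μ X t (X s ⁻¹' C) := by
  refine ⟨X s ⁻¹' C, ?_, EventuallyEq.rfl⟩
  exact le_iSup (fun r : Set.Iic t => MeasurableSpace.comap (X r) inferInstance)
    (⟨s, hst⟩ : Set.Iic t) _ ⟨C, hC, rfl⟩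

theorem isKnownAt_approxHits {l : V → ℝ} (hl : Measurable l) (c : ℝ) (t : ℝ≥0) :
    IsKnownAt μ X t {ω | (fun s => X s ω) ∈ approxHits l c t} := by
  rw [isKnownAt_iff]
  have : {ω | (fun s => X s ω) ∈ approxHits l c t} = ⋂ m : ℕ, ⋃ d : ℕ,
      X (min (TopologicalSpace.denseSeq ℝ≥0 d) t) ⁻¹' {v | |l v - c| < 1 / ((m : ℝ) + 1)} := by
    ext ω
    simp [approxHits]
  rw [this]
  refine @MeasurableSet.iInter _ _ (_) _ _ fun m => @MeasurableSet.iUnion _ _ (_) _ _ fun d => ?_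
  exact isKnownAt_preimage (min_le_right _ _)
    (measurableSet_lt (continuous_abs.measurable.comp (hl.sub_const c)) measurable_const)

theorem isStopTime_firstTime [TopologicalSpace V] [OpensMeasurableSpace V]
    (hcont : ∀ᵐ ω ∂μ, Continuous fun s => X s ω) {l : V → ℝ} (hl : Continuous l) (c : ℝ) :
    IsStopTime μ X fun ω => firstTime {s | l (X s ω) = c} := by
  intro t
  obtain ⟨F, hF, hEF⟩ := isKnownAt_approxHits (μ := μ) (X := X) hl.measurable c t
  refine ⟨F, hF, EventuallyEq.trans ?_ hEF⟩
  filter_upwards [hcont] with ω hω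
  apply propext
  change firstTime {s | l (X s ω) = c} ≤ t ↔ (fun s => X s ω) ∈ approxHits l c t
  rw [mem_approxHits_iff hl c t hω,
    firstTime_le_iff (show IsClosed {s | l (X s ω) = c} from
      isClosed_eq (hl.comp hω) continuous_const)]
  rfl

/-- The σ-algebra of the events prior to a stopping time. -/
@[reducible]
def priorSpace {τ : Ω → ℝ≥0∞} (hτ : IsStopTime μ X τ) : MeasurableSpace Ω where
  MeasurableSet' E := IsPriorEvent μ X τ E
  measurableSet_empty t := by
    rw [Set.empty_inter, isKnownAt_iff]
    exact @MeasurableSet.empty _ (_)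
  measurableSet_compl E hE t := by
    have : Eᶜ ∩ {ω | τ ω ≤ t} = {ω | τ ω ≤ t} \ (E ∩ {ω | τ ω ≤ t}) := by
      ext ω; simp; tauto
    rw [this, isKnownAt_iff]
    exact @MeasurableSet.diff _ (_) _ _ (hτ t) (hE t)
  measurableSet_iUnion E hE t := by
    rw [Set.iUnion_inter, isKnownAt_iff]
    exact @MeasurableSet.iUnion _ _ (_) _ _ fun i => hE i t

variable {τ τ' : Ω → ℝ≥0∞}

theorem isPriorEvent_iff (hτ : IsStopTime μ X τ) {E : Set Ω} :
    IsPriorEvent μ X τ E ↔ MeasurableSet[priorSpace hτ] E := Iff.rfl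

theorem measurable_stopTime (hτ : IsStopTime μ X τ) : Measurable[priorSpace hτ] τ := by
  refine measurable_of_Iic (mδ := priorSpace hτ) fun a t => ?_
  induction a with
  | top => simpa using hτ t
  | coe a =>
    have : τ ⁻¹' Set.Iic (a : ℝ≥0∞) ∩ {ω | τ ω ≤ t} = {ω | τ ω ≤ ((min a t : ℝ≥0) : ℝ≥0∞)} := by
      ext ω; simp
    rw [this]
    exact (hτ _).mono (min_le_right _ _)

theorem isPriorEvent_le_const (hτ : IsStopTime μ X τ) (a : ℝ≥0∞) :
    IsPriorEvent μ X τ {ω | τ ω ≤ a} :=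
  measurable_stopTime hτ (measurableSet_Iic (a := a))

theorem isPriorEvent_lt (hτ : IsStopTime μ X τ) (hτ' : IsStopTime μ X τ') :
    IsPriorEvent μ X τ {ω | τ ω < τ' ω} := by
  intro t
  have : {ω | τ ω < τ' ω} ∩ {ω | τ ω ≤ t} = ⋃ d : ℕ,
      {ω | τ ω ≤ ((min (TopologicalSpace.denseSeq ℝ≥0 d) t : ℝ≥0) : ℝ≥0∞)} \
        {ω | τ' ω ≤ ((min (TopologicalSpace.denseSeq ℝ≥0 d) t : ℝ≥0) : ℝ≥0∞)} := by
    ext ω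
    simp only [Set.mem_inter_iff, Set.mem_ofPred_eq, Set.mem_iUnion, Set.mem_sdiff, not_le]
    constructor
    · rintro ⟨h1, h2⟩
      have hfin : τ ω ≠ ⊤ := (h2.trans_lt ENNReal.coe_lt_top).ne
      lift τ ω to ℝ≥0 using hfin with u hu
      have hut : u ≤ t := by exact_mod_cast h2
      rcases lt_or_ge (t : ℝ≥0∞) (τ' ω) with h3 | h3
      · obtain ⟨d, hd⟩ := (TopologicalSpace.denseRange_denseSeq ℝ≥0).exists_mem_open
          (isOpen_Ioi (a := t)) ⟨t + 1, by simp⟩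
        rw [Set.mem_Ioi] at hd
        exact ⟨d, by rw [min_eq_right hd.le]; exact h2, by rwa [min_eq_right hd.le]⟩
      · have hfin' : τ' ω ≠ ⊤ := (h3.trans_lt ENNReal.coe_lt_top).ne
        lift τ' ω to ℝ≥0 using hfin' with u' hu'
        obtain ⟨d, hd⟩ := (TopologicalSpace.denseRange_denseSeq ℝ≥0).exists_mem_open
          (isOpen_Ioo (a := u) (b := u')) (Set.nonempty_Ioo.2 (by exact_mod_cast h1))
        have h4 : TopologicalSpace.denseSeq ℝ≥0 d ≤ t :=
          hd.2.le.trans (by exact_mod_cast h3)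
        refine ⟨d, ?_, ?_⟩
        · rw [min_eq_left h4]; exact_mod_cast hd.1.le
        · rw [min_eq_left h4]; exact_mod_cast hd.2
    · rintro ⟨d, h1, h2⟩
      exact ⟨h1.trans_lt h2, h1.trans (by exact_mod_cast min_le_right _ _)⟩
  rw [this, isKnownAt_iff]
  refine @MeasurableSet.iUnion _ _ (_) _ _ fun d => @MeasurableSet.diff _ (_) _ _ ?_ ?_
  · exact (hτ _).mono (min_le_right _ _)
  · exact (hτ' _).mono (min_le_right _ _)

theorem isPriorEvent_gt (hτ : IsStopTime μ X τ) (hτ' : IsStopTime μ X τ') :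
    IsPriorEvent μ X τ {ω | τ' ω < τ ω} := by
  intro t
  have : {ω | τ' ω < τ ω} ∩ {ω | τ ω ≤ t} = ⋃ d : ℕ,
      ({ω | τ' ω ≤ ((min (TopologicalSpace.denseSeq ℝ≥0 d) t : ℝ≥0) : ℝ≥0∞)} \
        {ω | τ ω ≤ ((min (TopologicalSpace.denseSeq ℝ≥0 d) t : ℝ≥0) : ℝ≥0∞)}) ∩
        {ω | τ ω ≤ t} := by
    ext ω
    simp only [Set.mem_inter_iff, Set.mem_ofPred_eq, Set.mem_iUnion, Set.mem_sdiff, not_le]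
    constructor
    · rintro ⟨h1, h2⟩
      have hfin : τ ω ≠ ⊤ := (h2.trans_lt ENNReal.coe_lt_top).ne
      lift τ ω to ℝ≥0 using hfin with u hu
      have hfin' : τ' ω ≠ ⊤ := (h1.trans_le le_top).ne
      lift τ' ω to ℝ≥0 using hfin' with u' hu'
      obtain ⟨d, hd⟩ := (TopologicalSpace.denseRange_denseSeq ℝ≥0).exists_mem_open
        (isOpen_Ioo (a := u') (b := u)) (Set.nonempty_Ioo.2 (by exact_mod_cast h1))
      have h4 : TopologicalSpace.denseSeq ℝ≥0 d ≤ t :=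
        hd.2.le.trans (by exact_mod_cast h2)
      refine ⟨d, ⟨?_, ?_⟩, h2⟩
      · rw [min_eq_left h4]; exact_mod_cast hd.1.le
      · rw [min_eq_left h4]; exact_mod_cast hd.2
    · rintro ⟨d, ⟨h1, h2⟩, h3⟩
      exact ⟨h1.trans_lt h2, h3⟩
  rw [this, isKnownAt_iff]
  refine @MeasurableSet.iUnion _ _ (_) _ _ fun d => @MeasurableSet.inter _ (_) _ _
    (@MeasurableSet.diff _ (_) _ _ ?_ ?_) (hτ t)
  · exact (hτ' _).mono (min_le_right _ _)
  · exact (hτ _).mono (min_le_right _ _)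

theorem IsPriorEvent.inter (hτ : IsStopTime μ X τ) {E F : Set Ω} (hE : IsPriorEvent μ X τ E)
    (hF : IsPriorEvent μ X τ F) : IsPriorEvent μ X τ (E ∩ F) :=
  @MeasurableSet.inter _ (priorSpace hτ) _ _ hE hF

theorem isPriorEvent_le (hτ : IsStopTime μ X τ) (hτ' : IsStopTime μ X τ') :
    IsPriorEvent μ X τ {ω | τ ω ≤ τ' ω} := by
  have := @MeasurableSet.compl _ _ (priorSpace hτ) (isPriorEvent_gt hτ hτ')
  rw [isPriorEvent_iff hτ]
  convert this using 1
  ext ω; simp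

/-- The value of the process at time `s`, recorded only if `s` is not after `τ`, is prior to
`τ`. -/
theorem measurable_prior_value (hτ : IsStopTime μ X τ) (s : ℝ≥0) (v : V)
    [∀ ω, Decidable ((s : ℝ≥0∞) ≤ τ ω)] :
    Measurable[priorSpace hτ] fun ω => if (s : ℝ≥0∞) ≤ τ ω then X s ω else v := by
  intro C hC
  have hs : MeasurableSet[priorSpace hτ] {ω | (s : ℝ≥0∞) ≤ τ ω} :=
    measurable_stopTime hτ (measurableSet_Ici (a := (s : ℝ≥0∞)))
  have h1 : MeasurableSet[priorSpace hτ] ({ω | (s : ℝ≥0∞) ≤ τ ω} ∩ X s ⁻¹' C) := by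
    intro t
    rcases le_or_gt s t with hst | hst
    · rw [Set.inter_right_comm]
      exact @MeasurableSet.inter _ (knownSpace μ X t) _ _ (hs t) (isKnownAt_preimage hst hC)
    · have : {ω | (s : ℝ≥0∞) ≤ τ ω} ∩ X s ⁻¹' C ∩ {ω | τ ω ≤ t} = ∅ := by
        ext ω
        simp only [Set.mem_inter_iff, Set.mem_ofPred_eq, Set.mem_empty_iff_false, iff_false]
        rintro ⟨⟨h, -⟩, h'⟩
        exact absurd (by exact_mod_cast h.trans h' : s ≤ t) (not_le.2 hst)
      rw [this]
      exact @MeasurableSet.empty _ (knownSpace μ X t)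
  have : (fun ω => if (s : ℝ≥0∞) ≤ τ ω then X s ω else v) ⁻¹' C =
      ({ω | (s : ℝ≥0∞) ≤ τ ω} ∩ X s ⁻¹' C) ∪ ({ω | (s : ℝ≥0∞) ≤ τ ω}ᶜ ∩ {_ω | v ∈ C}) := by
    ext ω
    by_cases h : (s : ℝ≥0∞) ≤ τ ω <;> simp [h]
  rw [this]
  exact @MeasurableSet.union _ (priorSpace hτ) _ _ h1 (@MeasurableSet.inter _ (priorSpace hτ) _ _
    (@MeasurableSet.compl _ _ (priorSpace hτ) hs) (@MeasurableSet.const _ (priorSpace hτ) _))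

theorem IsPriorEvent.nullMeasurableSet (hX : ∀ t, Measurable (X t))
    {E : Set Ω} (hE : IsPriorEvent μ X τ E) : NullMeasurableSet (E ∩ {ω | τ ω < ⊤}) μ := by
  have : E ∩ {ω | τ ω < ⊤} = ⋃ n : ℕ, E ∩ {ω | τ ω ≤ (n : ℝ≥0)} := by
    ext ω
    simp only [Set.mem_inter_iff, Set.mem_ofPred_eq, Set.mem_iUnion, exists_and_left,
      and_congr_right_iff]
    intro _
    constructor
    · intro h
      obtain ⟨n, hn⟩ := ENNReal.exists_nat_gt h.ne
      exact ⟨n, by exact_mod_cast hn.le⟩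
    · rintro ⟨n, hn⟩
      exact hn.trans_lt ENNReal.coe_lt_top
  rw [this]
  exact NullMeasurableSet.iUnion fun n => (hE n).nullMeasurableSet hX

end StopTimes

/-! ### The reflection principle -/

/-- The path that follows `γ` before time `τ` and the image of `γ` under `w` from time `τ` on. -/
noncomputable def reflectAfter {V : Type*} (w : V → V) (τ : ℝ≥0∞) (γ : ℝ≥0 → V) : ℝ≥0 → V :=
  fun s => if τ ≤ s then w (γ s) else γ s

section Measurability

variable {V Ω : Type*} [MeasurableSpace V] [MeasurableSpace Ω] {μ ν : Measure Ω}
  {X : ℝ≥0 → Ω → V}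

theorem exists_continuous_modification [TopologicalSpace V] [Nonempty V]
    (hX : ∀ t, Measurable (X t)) (hcont : ∀ᵐ ω ∂μ, Continuous fun s => X s ω) :
    ∃ Y : ℝ≥0 → Ω → V, (∀ t, Measurable (Y t)) ∧ (∀ ω, Continuous fun t => Y t ω) ∧
      ∀ᵐ ω ∂μ, ∀ t, Y t ω = X t ω := by
  classical
  obtain ⟨N, hN, hNm, hN0⟩ := exists_measurable_superset_of_null (ae_iff.1 hcont)
  obtain ⟨v⟩ := ‹Nonempty V›
  refine ⟨fun t ω => if ω ∈ N then v else X t ω, fun t => ?_, fun ω => ?_, ?_⟩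
  · exact Measurable.ite hNm measurable_const (hX t)
  · by_cases hω : ω ∈ N
    · simp only [hω, if_true]; exact continuous_const
    · simp only [hω, if_false]
      by_contra h
      exact hω (hN h)
  · have : ∀ᵐ ω ∂μ, ω ∉ N := by rw [ae_iff]; simpa using hN0
    filter_upwards [this] with ω hω t
    simp [hω]

theorem aemeasurable_shift [TopologicalSpace V] [TopologicalSpace.PseudoMetrizableSpace V]
    [BorelSpace V] [Nonempty V] (hX : ∀ t, Measurable (X t))
    (hcont : ∀ᵐ ω ∂μ, Continuous fun s => X s ω) (hν : ν ≪ μ) {σ : Ω → ℝ≥0}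
    (hσ : AEMeasurable σ ν) :
    AEMeasurable (fun ω (s : ℝ≥0) => X (σ ω + s) ω) ν := by
  obtain ⟨Y, hYm, hYc, hYX⟩ := exists_continuous_modification hX hcont
  obtain ⟨σ', hσ', hσσ'⟩ := hσ
  refine ⟨fun ω s => Y (σ' ω + s) ω, ?_, ?_⟩
  · refine measurable_pi_lambda _ fun s => ?_
    exact (measurable_uncurry_of_continuous_of_measurable hYc hYm).comp
      ((hσ'.add_const s).prodMk measurable_id)
  · filter_upwards [hν.ae_le hYX, hσσ'] with ω h1 h2
    ext s
    rw [h1, h2]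

theorem aemeasurable_reflectAfter (hX : ∀ t, Measurable (X t)) {w : V → V} (hw : Measurable w)
    {τ : Ω → ℝ≥0∞} (hτ : AEMeasurable τ ν) :
    AEMeasurable (fun ω => reflectAfter w (τ ω) fun s => X s ω) ν := by
  obtain ⟨τ', hτ', hττ'⟩ := hτ
  refine ⟨fun ω => reflectAfter w (τ' ω) fun s => X s ω, ?_, ?_⟩
  · refine measurable_pi_lambda _ fun s => ?_
    exact Measurable.ite (hτ' measurableSet_Iic) (hw.comp (hX s)) (hX s)
  · filter_upwards [hττ'] with ω h
    rw [h]

end Measurability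

/-- The restriction of a path to finitely many times, read off from its values up to time `r` and
from the path shifted by `r`. The shift is rounded down to a multiple of `1 / (n + 1)`, so that this
is measurable in `r` although the evaluation of arbitrary paths is not jointly measurable. -/
noncomputable def glueAt {V : Type*} (I : Finset ℝ≥0) (n : ℕ)
    (p : ((I → V) × ℝ≥0) × (ℝ≥0 → V)) : I → V :=
  fun i => if (i : ℝ≥0) ≤ p.1.2 then p.1.1 i else
    p.2 (i - (⌊p.1.2 * (n + 1)⌋₊ : ℝ≥0) / (n + 1))

theorem measurable_glueAt {V : Type*} [MeasurableSpace V] (I : Finset ℝ≥0) (n : ℕ) :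
    Measurable (glueAt (V := V) I n) := by
  refine measurable_pi_lambda _ fun i => ?_
  refine Measurable.ite ?_ ?_ ?_
  · exact measurableSet_le measurable_const measurable_fst.snd
  · exact (measurable_pi_apply i).comp measurable_fst.fst
  · have h : Measurable fun q : ℕ × (ℝ≥0 → V) => q.2 (i - (q.1 : ℝ≥0) / (n + 1)) :=
      measurable_from_prod_countable_right fun m =>
        measurable_pi_apply (X := fun _ : ℝ≥0 => V) (i - (m : ℝ≥0) / (n + 1))
    exact h.comp
      ((Nat.measurable_floor.comp (measurable_fst.snd.mul_const _)).prodMk measurable_snd)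

theorem tendsto_floor_mul_div (r : ℝ≥0) :
    Tendsto (fun n : ℕ => (⌊r * (n + 1)⌋₊ : ℝ≥0) / (n + 1)) atTop (𝓝 r) := by
  have h := (tendsto_nat_floor_mul_div_atTop (R := ℝ) r.2).comp
    (tendsto_natCast_atTop_atTop.comp (tendsto_add_atTop_nat 1))
  rw [← NNReal.tendsto_coe]
  refine h.congr fun n => ?_
  simp only [Function.comp_apply, NNReal.coe_div, NNReal.coe_natCast, NNReal.coe_add,
    NNReal.coe_one, Nat.cast_add, Nat.cast_one]
  congr 2

section Reflection

variable {V Ω : Type*} [NormedAddCommGroup V] [InnerProductSpace ℝ V] [MeasurableSpace V]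
  [BorelSpace V] [MeasurableSpace Ω]
  {G : Subgroup (V ≃ᵃⁱ[ℝ] V)} {X : ℝ≥0 → Ω → V} {P : V → Measure Ω}

/-- The strong Markov property and the invariance of the laws combined: given the past up to `τ`,
the shifted path has the same law as its image under an element of the group which fixes `X τ`. -/
theorem IsReflectable.map_shift (hX : IsReflectable G X P) (x : V) {τ : Ω → ℝ≥0∞}
    (hτ : IsStopTime (P x) X τ) {E : Set Ω} (hE : IsPriorEvent (P x) X τ E)
    (hfin : ∀ ω ∈ E, τ ω < ⊤) {w : V ≃ᵃⁱ[ℝ] V} (hw : w ∈ G)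
    (hfix : ∀ᵐ ω ∂(P x), ω ∈ E → w (X (τ ω).toNNReal ω) = X (τ ω).toNNReal ω)
    {α : Type*} [MeasurableSpace α] {Z : Ω → α} (hZ : Measurable[priorSpace hτ] Z)
    (hZ' : AEMeasurable Z ((P x).restrict E))
    (hshift : AEMeasurable (fun ω (s : ℝ≥0) => X ((τ ω).toNNReal + s) ω) ((P x).restrict E)) :
    ((P x).restrict E).map (fun ω => (Z ω, fun s => w (X ((τ ω).toNNReal + s) ω))) =
      ((P x).restrict E).map (fun ω => (Z ω, fun s => X ((τ ω).toNNReal + s) ω)) := by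
  have := hX.isProbabilityMeasure x
  have hwm : Measurable fun γ : ℝ≥0 → V => fun s => w (γ s) :=
    measurable_pi_lambda _ fun s => w.continuous.measurable.comp (measurable_pi_apply s)
  have hE0 : NullMeasurableSet E (P x) := by
    have := IsPriorEvent.nullMeasurableSet hX.measurable hE
    rwa [Set.inter_eq_left.2 (show E ⊆ {ω | τ ω < ⊤} from hfin)] at this
  have key : ∀ E' : Set Ω, IsPriorEvent (P x) X τ E' → E' ⊆ E →
      ∀ B : Set (ℝ≥0 → V), MeasurableSet B →
      P x (E' ∩ {ω | (fun s => w (X ((τ ω).toNNReal + s) ω)) ∈ B}) =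
        P x (E' ∩ {ω | (fun s => X ((τ ω).toNNReal + s) ω) ∈ B}) := by
    intro E' hE' hsub B hB
    have hfin' : E' ∩ {ω | τ ω < ⊤} = E' := Set.inter_eq_left.2 fun ω hω => hfin ω (hsub hω)
    have hE0' : NullMeasurableSet E' (P x) := by
      have := IsPriorEvent.nullMeasurableSet hX.measurable hE'
      rwa [hfin'] at this
    have h1 := hX.strongMarkov x τ hτ E' hE' B hB
    have h2 := hX.strongMarkov x τ hτ E' hE' _ (hwm hB)
    rw [hfin'] at h1 h2
    simp only [Set.mem_preimage] at h2
    rw [h1, h2]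
    refine lintegral_congr_ae ?_
    rw [EventuallyEq, ae_restrict_iff'₀ hE0']
    filter_upwards [hfix] with ω hω hωE
    have h3 := congrArg (fun m => m B) (hX.invariant w hw (X (τ ω).toNNReal ω))
    rw [hω (hsub hωE)] at h3
    have hwX : Measurable fun ω (s : ℝ≥0) => w (X s ω) := hwm.comp
      (measurable_pi_lambda _ hX.measurable)
    rw [Measure.map_apply hwX hB,
      Measure.map_apply (measurable_pi_lambda _ fun s => hX.measurable s) hB] at h3
    exact h3
  refine Measure.ext_prod fun {C B} hC hB => ?_
  have hE' : IsPriorEvent (P x) X τ (Z ⁻¹' C ∩ E) := IsPriorEvent.inter hτ (hZ hC) hE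
  have hwshift : AEMeasurable (fun ω (s : ℝ≥0) => w (X ((τ ω).toNNReal + s) ω))
    ((P x).restrict E) := hwm.comp_aemeasurable hshift
  rw [Measure.map_apply_of_aemeasurable (hZ'.prodMk hwshift) (hC.prod hB),
    Measure.map_apply_of_aemeasurable (hZ'.prodMk hshift) (hC.prod hB),
    Measure.restrict_apply₀' hE0, Measure.restrict_apply₀' hE0]
  convert key _ hE' Set.inter_subset_right B hB using 2 <;>
  · ext ω
    simp only [Set.mem_inter_iff, Set.mem_preimage, Set.mem_prod, Set.mem_ofPred_eq]
    tauto

/-- The reflection principle: on an event prior to `τ` on which `X τ` is fixed by `w`, the process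
has the same law as the process which is transformed by `w` from time `τ` on. -/
theorem IsReflectable.reflection_principle [SecondCountableTopology V]
    (hX : IsReflectable G X P) (x : V) {τ : Ω → ℝ≥0∞}
    (hτ : IsStopTime (P x) X τ) {E : Set Ω} (hE : IsPriorEvent (P x) X τ E)
    (hfin : ∀ ω ∈ E, τ ω < ⊤) {w : V ≃ᵃⁱ[ℝ] V} (hw : w ∈ G)
    (hfix : ∀ᵐ ω ∂(P x), ω ∈ E → w (X (τ ω).toNNReal ω) = X (τ ω).toNNReal ω) :
    ((P x).restrict E).map (fun ω => reflectAfter w (τ ω) fun s => X s ω) =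
      ((P x).restrict E).map (fun ω s => X s ω) := by
  have := hX.isProbabilityMeasure x
  have hE0 : NullMeasurableSet E (P x) := by
    have := IsPriorEvent.nullMeasurableSet hX.measurable hE
    rwa [Set.inter_eq_left.2 (show E ⊆ {ω | τ ω < ⊤} from hfin)] at this
  have hnull : ∀ F, MeasurableSet[priorSpace hτ] F → NullMeasurableSet F ((P x).restrict E) := by
    intro F hF
    have h1 : NullMeasurableSet (F ∩ E) (P x) := by
      have := IsPriorEvent.nullMeasurableSet hX.measurable (IsPriorEvent.inter hτ hF hE)
      rwa [Set.inter_eq_left.2 (show F ∩ E ⊆ {ω | τ ω < ⊤} from fun ω hω => hfin ω hω.2)] at this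
    refine NullMeasurableSet.congr (s := F ∩ E)
      (h1.mono_ac Measure.restrict_le_self.absolutelyContinuous) ?_
    filter_upwards [ae_restrict_mem₀ hE0] with ω hω
    apply propext
    exact ⟨fun h => h.1, fun h => ⟨h, hω⟩⟩
  have hac : (P x).restrict E ≪ P x := Measure.restrict_le_self.absolutelyContinuous
  have hτae : AEMeasurable τ ((P x).restrict E) :=
    NullMeasurable.aemeasurable fun D hD => hnull _ (measurable_stopTime hτ hD)
  have hshift := aemeasurable_shift hX.measurable (hX.continuous_paths x) hac hτae.ennreal_toNNReal
  have hXm : Measurable fun ω (s : ℝ≥0) => X s ω := measurable_pi_lambda _ hX.measurable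
  have hX'm : AEMeasurable (fun ω => reflectAfter w (τ ω) fun s => X s ω) ((P x).restrict E) :=
    aemeasurable_reflectAfter hX.measurable w.continuous.measurable hτae
  have hwm : Measurable fun γ : ℝ≥0 → V => fun s => w (γ s) :=
    measurable_pi_lambda _ fun s => w.continuous.measurable.comp (measurable_pi_apply s)
  -- It suffices to compare the finite-dimensional distributions.
  refine IsProjectiveLimit.unique (P := fun I : Finset ℝ≥0 =>
    (((P x).restrict E).map (fun ω s => X s ω)).map I.restrict) (fun I => ?_) fun I => rfl
  beta_reduce
  rw [AEMeasurable.map_map_of_aemeasurable (Finset.measurable_restrict I).aemeasurable hX'm,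
    AEMeasurable.map_map_of_aemeasurable (Finset.measurable_restrict I).aemeasurable
      hXm.aemeasurable]
  have hRX' := (Finset.measurable_restrict (X := fun _ : ℝ≥0 => V) I).comp_aemeasurable hX'm
  have hRX := (Finset.measurable_restrict (X := fun _ : ℝ≥0 => V) I).comp hXm
  refine ext_of_forall_integral_eq_of_IsFiniteMeasure fun f => ?_
  rw [integral_map hRX' f.continuous.measurable.aestronglyMeasurable,
    integral_map hRX.aemeasurable f.continuous.measurable.aestronglyMeasurable]
  let Z : Ω → (I → V) × ℝ≥0 := fun ω =>
    (fun i => if ((i : ℝ≥0) : ℝ≥0∞) ≤ τ ω then X i ω else 0, (τ ω).toNNReal)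
  have hZ : Measurable[priorSpace hτ] Z := by
    refine Measurable.prodMk (m := priorSpace hτ) ?_ ?_
    · exact @measurable_pi_lambda _ _ _ (priorSpace hτ) _ _ fun i => measurable_prior_value hτ i 0
    · exact ENNReal.measurable_toNNReal.comp (measurable_stopTime hτ)
  have hZ' : AEMeasurable Z ((P x).restrict E) := by
    refine AEMeasurable.prodMk ?_ hτae.ennreal_toNNReal
    refine aemeasurable_pi_lambda _ fun i => ?_
    exact NullMeasurable.aemeasurable fun D hD => hnull _ (measurable_prior_value hτ i 0 hD)
  have hjoint := hX.map_shift x hτ hE hfin hw hfix hZ hZ' hshift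
  have hn : ∀ n : ℕ,
      ∫ ω, f (glueAt I n (Z ω, fun s => w (X ((τ ω).toNNReal + s) ω))) ∂((P x).restrict E) =
      ∫ ω, f (glueAt I n (Z ω, fun s => X ((τ ω).toNNReal + s) ω)) ∂((P x).restrict E) := by
    intro n
    have hf : Measurable fun p => f (glueAt (V := V) I n p) :=
      f.continuous.measurable.comp (measurable_glueAt I n)
    have hwshift : AEMeasurable (fun ω (s : ℝ≥0) => w (X ((τ ω).toNNReal + s) ω))
      ((P x).restrict E) := hwm.comp_aemeasurable hshift
    rw [← integral_map (hZ'.prodMk hshift) hf.aestronglyMeasurable,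
      ← integral_map (hZ'.prodMk hwshift) hf.aestronglyMeasurable]
    exact congrArg (fun m => ∫ p, f (glueAt (V := V) I n p) ∂m) hjoint
  -- For continuous paths the rounding in `glueAt` disappears in the limit. This is used for `u = w`
  -- and for `u = id`.
  have hglue : ∀ (u : V → V), Continuous u → Measurable (fun γ : ℝ≥0 → V => fun s => u (γ s)) →
      (∀ᵐ ω ∂(P x), ω ∈ E → u (X (τ ω).toNNReal ω) = X (τ ω).toNNReal ω) →
      Tendsto (fun n : ℕ =>
        ∫ ω, f (glueAt I n (Z ω, fun s => u (X ((τ ω).toNNReal + s) ω))) ∂((P x).restrict E)) atTop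
        (𝓝 (∫ ω, f (I.restrict (reflectAfter u (τ ω) fun s => X s ω)) ∂((P x).restrict E))) := by
    intro u hu hum hufix
    refine tendsto_integral_of_dominated_convergence (fun _ => ‖f‖) (fun n => ?_)
      (integrable_const _) (fun n => ae_of_all _ fun ω => f.norm_coe_le_norm _) ?_
    · exact ((f.continuous.measurable.comp (measurable_glueAt I n)).comp_aemeasurable
        (hZ'.prodMk (hum.comp_aemeasurable hshift))).aestronglyMeasurable
    filter_upwards [ae_restrict_mem₀ hE0, hac.ae_le hufix, hac.ae_le (hX.continuous_paths x)]
      with ω hωE hωfix hωc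
    refine (f.continuous.tendsto _).comp (tendsto_pi_nhds.2 fun i => ?_)
    have hfinω := hfin ω hωE
    have hωfix' := hωfix hωE
    obtain ⟨r, hr⟩ : ∃ r : ℝ≥0, τ ω = r := ⟨_, (ENNReal.coe_toNNReal hfinω.ne).symm⟩
    simp only [hr, ENNReal.toNNReal_coe] at hωfix'
    simp only [glueAt, reflectAfter, Z, hr, ENNReal.toNNReal_coe, Finset.restrict,
      ENNReal.coe_le_coe]
    by_cases hir : (i : ℝ≥0) ≤ r
    · simp only [hir, if_true]
      refine tendsto_const_nhds.congr' (Eventually.of_forall fun n => ?_)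
      split_ifs with h
      · rw [le_antisymm hir h, hωfix']
      · rfl
    · have hri : r ≤ i := (not_le.1 hir).le
      simp only [hir, if_false, hri, if_true]
      refine ((hu.comp hωc).tendsto' (r + (i - r)) _ ?_).comp
        ((tendsto_const_nhds (x := r)).add
          ((tendsto_const_nhds (x := (i : ℝ≥0))).sub (tendsto_floor_mul_div r)))
      simp [add_tsub_cancel_of_le hri]
  have h1 := hglue w w.continuous hwm hfix
  have h2 := hglue id continuous_id measurable_id (ae_of_all _ fun _ _ => rfl)
  simp only [hn] at h1
  have h3 := tendsto_nhds_unique h1 h2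
  have hid : ∀ ω, reflectAfter id (τ ω) (fun s => X s ω) = fun s => X s ω := fun ω => by
    ext s; simp [reflectAfter]
  simp only [hid] at h3
  exact h3

end Reflection

/-! ### Measurable functionals of continuous paths -/

theorem continuous_reflectAfter {V : Type*} [TopologicalSpace V] {w : V → V} (hw : Continuous w)
    {τ : ℝ≥0∞} (hτ : τ < ⊤) {γ : ℝ≥0 → V} (hγ : Continuous γ)
    (hfix : w (γ τ.toNNReal) = γ τ.toNNReal) :
    Continuous (reflectAfter w τ γ) := by
  lift τ to ℝ≥0 using hτ.ne
  simp only [ENNReal.toNNReal_coe] at hfix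
  unfold reflectAfter
  simp only [ENNReal.coe_le_coe]
  refine Continuous.if_le (hw.comp hγ) hγ continuous_const continuous_id ?_
  rintro s rfl
  exact hfix

section PathFunctionals

variable {V Ω : Type*} [TopologicalSpace V] [MeasurableSpace V] [MeasurableSpace Ω]

/-- A real functional of paths is path measurable if its restriction to the continuous paths is
measurable for the σ-algebra generated by the evaluations. -/
def PathMeasurable (Φ : (ℝ≥0 → V) → ℝ) : Prop :=
  Measurable fun γ : {γ : ℝ≥0 → V // Continuous γ} => Φ γ

theorem PathMeasurable.exists_measurable {Φ : (ℝ≥0 → V) → ℝ} (hΦ : PathMeasurable Φ) :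
    ∃ Ψ : (ℝ≥0 → V) → ℝ, Measurable Ψ ∧ ∀ γ, Continuous γ → Φ γ = Ψ γ := by
  obtain ⟨Ψ, hΨ, h⟩ := Measurable.exists_eq_measurable_comp
    (f := (Subtype.val : {γ : ℝ≥0 → V // Continuous γ} → _)) hΦ
  exact ⟨Ψ, hΨ, fun γ hγ => congrFun h ⟨γ, hγ⟩⟩

variable {μ : Measure Ω} {X : ℝ≥0 → Ω → V}

theorem PathMeasurable.aestronglyMeasurable {Φ : (ℝ≥0 → V) → ℝ} (hΦ : PathMeasurable Φ)
    (hX : ∀ t, Measurable (X t)) (hcont : ∀ᵐ ω ∂μ, Continuous fun s => X s ω) :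
    AEStronglyMeasurable (fun ω => Φ fun s => X s ω) μ := by
  obtain ⟨Ψ, hΨ, h⟩ := hΦ.exists_measurable
  refine AEMeasurable.aestronglyMeasurable ⟨fun ω => Ψ fun s => X s ω,
    hΨ.comp (measurable_pi_lambda _ hX), ?_⟩
  filter_upwards [hcont] with ω hω
  exact h _ hω

theorem PathMeasurable.integrable [IsFiniteMeasure μ] {Φ : (ℝ≥0 → V) → ℝ} (hΦ : PathMeasurable Φ)
    (hX : ∀ t, Measurable (X t)) (hcont : ∀ᵐ ω ∂μ, Continuous fun s => X s ω)
    {C : ℝ} (hC : ∀ γ, |Φ γ| ≤ C) :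
    Integrable (fun ω => Φ fun s => X s ω) μ :=
  Integrable.of_bound (hΦ.aestronglyMeasurable hX hcont) C (ae_of_all _ fun _ => hC _)

theorem measurable_firstTime {l : V → ℝ} (hl : Continuous l) (hl' : Measurable l) (c : ℝ) :
    Measurable fun γ : {γ : ℝ≥0 → V // Continuous γ} => firstTime {s | l (γ.1 s) = c} := by
  refine measurable_of_Iic fun a => ?_
  induction a with
  | top => simp
  | coe a =>
    have : (fun γ : {γ : ℝ≥0 → V // Continuous γ} => firstTime {s | l (γ.1 s) = c}) ⁻¹'
        Set.Iic (a : ℝ≥0∞) = Subtype.val ⁻¹' approxHits l c a := by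
      ext γ
      simp only [Set.mem_preimage, Set.mem_Iic, mem_approxHits_iff hl c a γ.2]
      exact firstTime_le_iff (C := {s | l (γ.1 s) = c})
        (isClosed_eq (hl.comp γ.2) continuous_const) a
    rw [this]
    exact measurable_subtype_coe (measurableSet_approxHits hl' c a)

end PathFunctionals

/-! ### Levels attained by a real path -/

section RealPaths

/-- The path `f` attains the level `c` by time `t`. -/
def Hits (t : ℝ≥0) (f : ℝ≥0 → ℝ) (c : ℝ) : Prop := ∃ s ≤ t, f s = c

/-- The path `f` attains the level `c` by time `t`, and before the level `d`. -/
def HitsBefore (t : ℝ≥0) (f : ℝ≥0 → ℝ) (c d : ℝ) : Prop := ∃ s ≤ t, f s = c ∧ ∀ r ≤ s, f r ≠ d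

open scoped Classical in
/-- The indicator of the event that the level `c` is not attained by time `t`. -/
noncomputable def miss (t : ℝ≥0) (f : ℝ≥0 → ℝ) (c : ℝ) : ℝ := if Hits t f c then 0 else 1

open scoped Classical in
/-- The functional which is `1` if the path has not left `(0, 1)` by time `t`, and otherwise `0` or
`2` according as the path leaves the interval at `0` or at `1`. -/
noncomputable def exitValue (t : ℝ≥0) (f : ℝ≥0 → ℝ) : ℝ :=
  if HitsBefore t f 1 0 then 2 else if HitsBefore t f 0 1 then 0 else 1

/-- The sign of a level: `-1` for positive levels and `1` for the others. -/
noncomputable def levelSign (n : ℤ) : ℝ := if 0 < n then -1 else 1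

/-- The signed number of the integer levels of absolute value less than `N` that are not attained
by time `t`. -/
noncomputable def levelSum (N : ℕ) (t : ℝ≥0) (f : ℝ≥0 → ℝ) : ℝ :=
  ∑ n ∈ Finset.Ioo (-(N : ℤ)) N, levelSign n * miss t f n

open scoped Classical in
/-- What the reflection principle leaves of `levelSum`: after an exit at `0` all terms cancel, after
an exit at `1` all but the two lowest levels do. -/
noncomputable def residualSum (N : ℕ) (t : ℝ≥0) (f : ℝ≥0 → ℝ) : ℝ :=
  if HitsBefore t f 1 0 then miss t f (1 - N) + miss t f (2 - N)
  else if HitsBefore t f 0 1 then 0 else 1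

theorem miss_eq_zero {t : ℝ≥0} {f : ℝ≥0 → ℝ} {c : ℝ} (h : Hits t f c) : miss t f c = 0 := if_pos h

theorem miss_eq_one {t : ℝ≥0} {f : ℝ≥0 → ℝ} {c : ℝ} (h : ¬ Hits t f c) : miss t f c = 1 := if_neg h

theorem abs_miss_le (t : ℝ≥0) (f : ℝ≥0 → ℝ) (c : ℝ) : |miss t f c| ≤ 1 := by
  unfold miss; split_ifs <;> simp

theorem abs_levelSum_le (N : ℕ) (t : ℝ≥0) (f : ℝ≥0 → ℝ) : |levelSum N t f| ≤ 2 * N := by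
  refine (Finset.abs_sum_le_sum_abs _ _).trans ?_
  refine (Finset.sum_le_card_nsmul _ _ 1 fun n _ => ?_).trans ?_
  · rw [abs_mul]
    have : |levelSign n| = 1 := by unfold levelSign; split_ifs <;> simp
    rw [this, one_mul]
    exact abs_miss_le _ _ _
  · have h : (Finset.Ioo (-(N : ℤ)) N).card ≤ 2 * N := by rw [Int.card_Ioo]; omega
    simp only [nsmul_eq_mul, mul_one]
    exact_mod_cast h

theorem abs_residualSum_le (N : ℕ) (t : ℝ≥0) (f : ℝ≥0 → ℝ) : |residualSum N t f| ≤ 2 := by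
  unfold residualSum
  split_ifs
  · refine (abs_add_le _ _).trans ?_
    linarith [abs_miss_le t f (1 - N), abs_miss_le t f (2 - N)]
  · simp
  · simp

theorem exitValue_nonneg (t : ℝ≥0) (f : ℝ≥0 → ℝ) : 0 ≤ exitValue t f := by
  unfold exitValue; split_ifs <;> norm_num

theorem exitValue_le (t : ℝ≥0) (f : ℝ≥0 → ℝ) : exitValue t f ≤ 2 := by
  unfold exitValue; split_ifs <;> norm_num

theorem not_hitsBefore_of_hitsBefore {t : ℝ≥0} {f : ℝ≥0 → ℝ} {c d : ℝ} (h : HitsBefore t f c d) :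
    ¬ HitsBefore t f d c := by
  rintro ⟨s', -, hd, hs'⟩
  obtain ⟨s, -, hc, hs⟩ := h
  rcases le_total s s' with h | h
  · exact hs' s h hc
  · exact hs s' h hd

/-- The exit value depends only on the times at which the path is at `0` and at `1`. -/
theorem exitValue_congr {t : ℝ≥0} {f g : ℝ≥0 → ℝ} (h0 : ∀ s ≤ t, (f s = 0 ↔ g s = 0))
    (h1 : ∀ s ≤ t, (f s = 1 ↔ g s = 1)) : exitValue t f = exitValue t g := by
  have e1 : HitsBefore t f 1 0 ↔ HitsBefore t g 1 0 :=
    exists_congr fun s => and_congr_right fun hs => and_congr (h1 s hs)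
      (forall₂_congr fun r hr => not_congr (h0 r (hr.trans hs)))
  have e2 : HitsBefore t f 0 1 ↔ HitsBefore t g 0 1 :=
    exists_congr fun s => and_congr_right fun hs => and_congr (h0 s hs)
      (forall₂_congr fun r hr => not_congr (h1 r (hr.trans hs)))
  rw [exitValue, exitValue, propext e1, propext e2]

/-- The effect of an exchange of the two ends of the interval. -/
theorem exitValue_swap {t : ℝ≥0} {f g : ℝ≥0 → ℝ} (h0 : ∀ s ≤ t, (f s = 0 ↔ g s = 1))
    (h1 : ∀ s ≤ t, (f s = 1 ↔ g s = 0)) : exitValue t f = 2 - exitValue t g := by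
  have e1 : HitsBefore t f 1 0 ↔ HitsBefore t g 0 1 :=
    exists_congr fun s => and_congr_right fun hs => and_congr (h1 s hs)
      (forall₂_congr fun r hr => not_congr (h0 r (hr.trans hs)))
  have e2 : HitsBefore t f 0 1 ↔ HitsBefore t g 1 0 :=
    exists_congr fun s => and_congr_right fun hs => and_congr (h0 s hs)
      (forall₂_congr fun r hr => not_congr (h1 r (hr.trans hs)))
  rw [exitValue, exitValue, propext e1, propext e2]
  by_cases h : HitsBefore t g 1 0
  · simp [h, not_hitsBefore_of_hitsBefore h]
  · by_cases h' : HitsBefore t g 0 1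
    · simp [h, h']
    · simp [h, h']; norm_num

theorem exitValue_eq_one {t : ℝ≥0} {f : ℝ≥0 → ℝ} (h0 : ¬ Hits t f 0) (h1 : ¬ Hits t f 1) :
    exitValue t f = 1 := by
  have e1 : ¬ HitsBefore t f 1 0 := fun ⟨s, hs, h, _⟩ => h1 ⟨s, hs, h⟩
  have e2 : ¬ HitsBefore t f 0 1 := fun ⟨s, hs, h, _⟩ => h0 ⟨s, hs, h⟩
  simp [exitValue, e1, e2]

theorem hitsBefore_iff {t : ℝ≥0} {f : ℝ≥0 → ℝ} (hf : Continuous f) (c d : ℝ) :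
    HitsBefore t f c d ↔
      firstTime {s | f s = c} ≤ t ∧ firstTime {s | f s = c} < firstTime {s | f s = d} := by
  have hC : ∀ c, IsClosed {s | f s = c} := fun c => isClosed_eq hf continuous_const
  constructor
  · rintro ⟨s, hst, hs, hd⟩
    have h1 : firstTime {s | f s = c} ≤ s := firstTime_le_coe hs
    exact ⟨h1.trans (by exact_mod_cast hst), h1.trans_lt ((lt_firstTime_iff (hC d) s).2 hd)⟩
  · rintro ⟨h1, h2⟩
    obtain ⟨s, hs, he⟩ := exists_firstTime_eq (hC c) (h1.trans_lt ENNReal.coe_lt_top)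
    rw [he] at h1 h2
    exact ⟨s, by exact_mod_cast h1, hs, (lt_firstTime_iff (hC d) s).1 h2⟩

theorem hits_iff {t : ℝ≥0} {f : ℝ≥0 → ℝ} (hf : Continuous f) (c : ℝ) :
    Hits t f c ↔ firstTime {s | f s = c} ≤ t :=
  (firstTime_le_iff (show IsClosed {s | f s = c} from isClosed_eq hf continuous_const) t).symm

/-- A continuous path started in `(0, 1)` stays there as long as it does not attain `0` or `1`. -/
theorem mem_Ioo_of_not_hits {f : ℝ≥0 → ℝ} (hf : Continuous f) (hf0 : f 0 ∈ Set.Ioo (0 : ℝ) 1)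
    {s : ℝ≥0} (h0 : ¬ Hits s f 0) (h1 : ¬ Hits s f 1) : f s ∈ Set.Ioo (0 : ℝ) 1 := by
  constructor
  · by_contra h
    obtain ⟨r, hr, hr'⟩ := intermediate_value_Icc' (zero_le : (0 : ℝ≥0) ≤ s) hf.continuousOn
      ⟨not_lt.1 h, hf0.1.le⟩
    exact h0 ⟨r, hr.2, hr'⟩
  · by_contra h
    obtain ⟨r, hr, hr'⟩ := intermediate_value_Icc (zero_le : (0 : ℝ≥0) ≤ s) hf.continuousOn
      ⟨hf0.2.le, not_lt.1 h⟩
    exact h1 ⟨r, hr.2, hr'⟩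

theorem ne_intCast_of_mem_Ioo {a : ℝ} (ha : a ∈ Set.Ioo (0 : ℝ) 1) (n : ℤ) : a ≠ n := by
  rintro rfl
  have h1 : 0 < n := by exact_mod_cast ha.1
  have h2 : n < 1 := by exact_mod_cast ha.2
  omega

/-- A path which does not leave `(0, 1)` first at `0` or first at `1` does not leave it at all. -/
theorem not_hits_of_not_hitsBefore {t : ℝ≥0} {f : ℝ≥0 → ℝ} (hf : Continuous f)
    (h01 : ¬ HitsBefore t f 0 1) (h10 : ¬ HitsBefore t f 1 0) : ¬ Hits t f 0 ∧ ¬ Hits t f 1 := by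
  rw [hitsBefore_iff hf] at h01 h10
  rw [hits_iff hf, hits_iff hf]
  have hC : ∀ c, IsClosed {s | f s = c} := fun c => isClosed_eq hf continuous_const
  have hne : ∀ s : ℝ≥0, firstTime {s | f s = 0} = s → firstTime {s | f s = 1} = s → False := by
    intro s e0 e1
    obtain ⟨s0, hs0, e0'⟩ := exists_firstTime_eq (hC 0) (by rw [e0]; exact ENNReal.coe_lt_top)
    obtain ⟨s1, hs1, e1'⟩ := exists_firstTime_eq (hC 1) (by rw [e1]; exact ENNReal.coe_lt_top)
    have h0 : s0 = s := by exact_mod_cast e0'.symm.trans e0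
    have h1 : s1 = s := by exact_mod_cast e1'.symm.trans e1
    rw [h0] at hs0
    rw [h1] at hs1
    have h0' : f s = 0 := hs0
    have h1' : f s = 1 := hs1
    linarith
  have key : firstTime {s | f s = 0} ≤ t → firstTime {s | f s = 1} ≤ t → False := by
    intro h0 h1
    have he := le_antisymm (not_lt.1 fun h => h10 ⟨h1, h⟩) (not_lt.1 fun h => h01 ⟨h0, h⟩)
    have hlt := h0.trans_lt ENNReal.coe_lt_top
    exact hne _ (ENNReal.coe_toNNReal hlt.ne).symm
      (he ▸ (ENNReal.coe_toNNReal hlt.ne).symm)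
  constructor
  · intro h0
    exact key h0 ((not_lt.1 fun h => h01 ⟨h0, h⟩).trans h0)
  · intro h1
    exact key ((not_lt.1 fun h => h10 ⟨h1, h⟩).trans h1) h1

/-- The cancellation in signed sums over levels: a sum over a set of levels which is symmetric about
`c` changes sign if the levels are reflected, provided that the term of the level `c` vanishes. -/
theorem sum_levelSign_reflect {c : ℤ} (hc : c = 0 ∨ c = 1) {S : Finset ℤ}
    (hS : ∀ n ∈ S, 2 * c - n ∈ S) {a b : ℤ → ℝ} (hab : ∀ n, b n = a (2 * c - n)) (ha : a c = 0) :
    ∑ n ∈ S, levelSign n * b n = -∑ n ∈ S, levelSign n * a n := by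
  rw [← Finset.sum_neg_distrib]
  refine Finset.sum_nbij' (fun n => 2 * c - n) (fun n => 2 * c - n) hS hS (by simp) (by simp) ?_
  intro n _
  rw [hab]
  rcases eq_or_ne n c with rfl | hn
  · have : 2 * n - n = n := by ring
    simp [this, ha]
  · have : levelSign (2 * c - n) = -levelSign n := by
      unfold levelSign
      rcases hc with rfl | rfl <;> split_ifs <;> first | omega | norm_num
    rw [this]; ring

theorem sum_levelSign {N : ℕ} (hN : 0 < N) : ∑ n ∈ Finset.Ioo (-(N : ℤ)) N, levelSign n = 1 := by
  have h0 : (0 : ℤ) ∈ Finset.Ioo (-(N : ℤ)) N := by simp; omega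
  have := sum_levelSign_reflect (c := 0) (Or.inl rfl) (S := (Finset.Ioo (-(N : ℤ)) N).erase 0)
    (by intro n hn; simp at hn ⊢; omega) (a := fun n => if n = 0 then 0 else 1)
    (b := fun n => if n = 0 then 0 else 1) (by intro n; simp) (by simp)
  have h2 : ∑ n ∈ (Finset.Ioo (-(N : ℤ)) N).erase 0, levelSign n * (if n = 0 then 0 else 1) =
      ∑ n ∈ (Finset.Ioo (-(N : ℤ)) N).erase 0, levelSign n := by
    refine Finset.sum_congr rfl fun n hn => ?_
    rw [if_neg (Finset.ne_of_mem_erase hn), mul_one]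
  rw [← Finset.add_sum_erase _ _ h0, ← h2]
  have h1 : levelSign 0 = 1 := by simp [levelSign]
  rw [h1]
  linarith

theorem levelSum_eq_one {N : ℕ} (hN : 0 < N) {t : ℝ≥0} {f : ℝ≥0 → ℝ}
    (h : ∀ s ≤ t, f s ∈ Set.Ioo (0 : ℝ) 1) : levelSum N t f = 1 := by
  rw [← sum_levelSign hN]
  refine Finset.sum_congr rfl fun n _ => ?_
  rw [miss_eq_one, mul_one]
  rintro ⟨s, hs, he⟩
  exact ne_intCast_of_mem_Ioo (h s hs) n he

/-- If `g` is obtained from `f` by reflection about the exit point `c` of `(0, 1)`, then the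
difference of the level sum and its residual part changes sign. -/
theorem levelSum_sub_residualSum_reflect {N : ℕ} (hN : 2 ≤ N) {t : ℝ≥0} {f g : ℝ≥0 → ℝ} {c : ℤ}
    (hc : c = 0 ∨ c = 1) (hf : HitsBefore t f c (1 - c)) (hg : HitsBefore t g c (1 - c))
    (hfg : ∀ n : ℤ, Hits t g n ↔ Hits t f ((2 * c - n : ℤ) : ℝ)) :
    levelSum N t g - residualSum N t g = -(levelSum N t f - residualSum N t f) := by
  have hm : ∀ n : ℤ, miss t g n = miss t f ((2 * c - n : ℤ) : ℝ) := fun n => by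
    rw [miss, miss, propext (hfg n)]
  have hmc : miss t f c = 0 := miss_eq_zero (let ⟨s, hs, h, _⟩ := hf; ⟨s, hs, h⟩)
  rcases hc with rfl | rfl
  · have h1 : ∀ f, HitsBefore t f ((0 : ℤ) : ℝ) (1 - ((0 : ℤ) : ℝ)) → residualSum N t f = 0 := by
      intro f hf
      simp only [Int.cast_zero, sub_zero] at hf
      simp [residualSum, hf, not_hitsBefore_of_hitsBefore hf]
    rw [h1 f hf, h1 g hg, sub_zero, sub_zero]
    exact sum_levelSign_reflect (Or.inl rfl) (a := fun n => miss t f n) (b := fun n => miss t g n)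
      (by intro n hn; simp at hn ⊢; omega) hm hmc
  · have h1 : ∀ f, HitsBefore t f ((1 : ℤ) : ℝ) (1 - ((1 : ℤ) : ℝ)) →
        levelSum N t f - residualSum N t f =
          ∑ n ∈ Finset.Ioo (2 - (N : ℤ)) N, levelSign n * miss t f n := by
      intro f hf
      simp only [Int.cast_one, sub_self] at hf
      have hS : Finset.Ioo (-(N : ℤ)) N =
          insert (1 - (N : ℤ)) (insert (2 - (N : ℤ)) (Finset.Ioo (2 - (N : ℤ)) N)) := by
        ext n; simp only [Finset.mem_Ioo, Finset.mem_insert]; omega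
      rw [levelSum, hS, Finset.sum_insert (by simp), Finset.sum_insert (by simp), residualSum,
        if_pos hf]
      have h2 : levelSign (1 - (N : ℤ)) = 1 := if_neg (by omega)
      have h3 : levelSign (2 - (N : ℤ)) = 1 := if_neg (by omega)
      rw [h2, h3]
      push_cast
      ring
    rw [h1 f hf, h1 g hg]
    exact sum_levelSign_reflect (Or.inr rfl) (a := fun n => miss t f n) (b := fun n => miss t g n)
      (by intro n hn; simp at hn ⊢; omega) hm hmc

/-- For large `N` the path has not attained the two lowest levels by time `t`. -/
theorem tendsto_residualSum {t : ℝ≥0} {f : ℝ≥0 → ℝ} (hf : Continuous f) :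
    Tendsto (fun N => residualSum N t f) atTop (𝓝 (exitValue t f)) := by
  unfold residualSum exitValue
  split_ifs with h1 h2
  · obtain ⟨C, hC⟩ := (isCompact_Icc (a := (0 : ℝ≥0)) (b := t)).bddBelow_image hf.continuousOn
    obtain ⟨M, hM⟩ := exists_nat_gt (2 - C)
    refine tendsto_const_nhds.congr' ?_
    filter_upwards [eventually_ge_atTop M] with N hN
    have hN' : (M : ℝ) ≤ N := by exact_mod_cast hN
    have hnot : ∀ c : ℝ, c ≤ 2 - N → ¬ Hits t f c := by
      rintro c hc ⟨s, hs, he⟩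
      have : C ≤ f s := hC ⟨s, ⟨zero_le, hs⟩, rfl⟩
      linarith
    rw [miss_eq_one (hnot _ (by linarith)), miss_eq_one (hnot _ le_rfl)]
    norm_num
  · exact tendsto_const_nhds
  · exact tendsto_const_nhds

end RealPaths

/-! ### The residual form of the expected signed sums over levels -/

section Measurable

variable {V : Type*} [TopologicalSpace V] [MeasurableSpace V] {l : V → ℝ}

theorem measurableSet_hits (hl : Continuous l) (hl' : Measurable l) (t : ℝ≥0) (c : ℝ) :
    MeasurableSet {γ : {γ : ℝ≥0 → V // Continuous γ} | Hits t (fun s => l (γ.1 s)) c} := by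
  have : {γ : {γ : ℝ≥0 → V // Continuous γ} | Hits t (fun s => l (γ.1 s)) c} =
      {γ | firstTime {s | l (γ.1 s) = c} ≤ t} := by
    ext γ
    exact hits_iff (hl.comp γ.2) c
  rw [this]
  exact measurableSet_le (measurable_firstTime hl hl' c) measurable_const

theorem measurableSet_hitsBefore (hl : Continuous l) (hl' : Measurable l) (t : ℝ≥0) (c d : ℝ) :
    MeasurableSet {γ : {γ : ℝ≥0 → V // Continuous γ} | HitsBefore t (fun s => l (γ.1 s)) c d} := by
  have : {γ : {γ : ℝ≥0 → V // Continuous γ} | HitsBefore t (fun s => l (γ.1 s)) c d} =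
      {γ | firstTime {s | l (γ.1 s) = c} ≤ t} ∩
        {γ | firstTime {s | l (γ.1 s) = c} < firstTime {s | l (γ.1 s) = d}} := by
    ext γ
    exact hitsBefore_iff (hl.comp γ.2) c d
  rw [this]
  exact (measurableSet_le (measurable_firstTime hl hl' c) measurable_const).inter
    (measurableSet_lt (measurable_firstTime hl hl' c) (measurable_firstTime hl hl' d))

theorem pathMeasurable_miss (hl : Continuous l) (hl' : Measurable l) (t : ℝ≥0) (c : ℝ) :
    PathMeasurable fun γ => miss t (fun s => l (γ s)) c :=
  Measurable.ite (measurableSet_hits hl hl' t c) measurable_const measurable_const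

theorem pathMeasurable_exitValue (hl : Continuous l) (hl' : Measurable l) (t : ℝ≥0) :
    PathMeasurable fun γ => exitValue t fun s => l (γ s) :=
  Measurable.ite (measurableSet_hitsBefore hl hl' t 1 0) measurable_const
    (Measurable.ite (measurableSet_hitsBefore hl hl' t 0 1) measurable_const measurable_const)

theorem pathMeasurable_levelSum (hl : Continuous l) (hl' : Measurable l) (N : ℕ) (t : ℝ≥0) :
    PathMeasurable fun γ => levelSum N t fun s => l (γ s) :=
  Finset.measurable_fun_sum _ fun n _ => (pathMeasurable_miss hl hl' t n).const_mul _

theorem pathMeasurable_residualSum (hl : Continuous l) (hl' : Measurable l) (N : ℕ) (t : ℝ≥0) :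
    PathMeasurable fun γ => residualSum N t fun s => l (γ s) :=
  Measurable.ite (measurableSet_hitsBefore hl hl' t 1 0)
    ((pathMeasurable_miss hl hl' t _).add (pathMeasurable_miss hl hl' t _))
    (Measurable.ite (measurableSet_hitsBefore hl hl' t 0 1) measurable_const measurable_const)

end Measurable

theorem affRefl_apply_of_inner_self {V : Type*} [NormedAddCommGroup V]
    [InnerProductSpace ℝ V] {β : V} (hβ : inner ℝ β β = (2 : ℝ)) (n : ℤ) (y : V) :
    affRefl (β, n) y = y - (inner ℝ y β - n) • β := by
  rw [affRefl_apply, affEval, coroot, hβ, real_inner_comm]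
  norm_num

section Residual

variable {V Ω : Type*} [NormedAddCommGroup V] [InnerProductSpace ℝ V] [MeasurableSpace V]
  [BorelSpace V] [SecondCountableTopology V] [MeasurableSpace Ω]
  {G : Subgroup (V ≃ᵃⁱ[ℝ] V)} {X : ℝ≥0 → Ω → V} {P : V → Measure Ω}

/-- A functional which changes sign when the path is reflected from the first time `l = c` on has
integral zero over events prior to this time. -/
theorem IsReflectable.setIntegral_eq_zero (hX : IsReflectable G X P) (x : V) {l : V → ℝ}
    (hl : Continuous l) (c : ℝ) {E : Set Ω}
    (hE : IsPriorEvent (P x) X (fun ω => firstTime {s | l (X s ω) = c}) E)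
    (hfin : ∀ ω ∈ E, firstTime {s | l (X s ω) = c} < ⊤) {w : V ≃ᵃⁱ[ℝ] V} (hw : w ∈ G)
    (hfix : ∀ y, l y = c → w y = y) {Φ : (ℝ≥0 → V) → ℝ} (hΦ : PathMeasurable Φ)
    (hanti : ∀ᵐ ω ∂(P x), ω ∈ E →
      Φ (reflectAfter w (firstTime {s | l (X s ω) = c}) fun s => X s ω) = -Φ fun s => X s ω) :
    ∫ ω in E, Φ (fun s => X s ω) ∂(P x) = 0 := by
  have hE0 : NullMeasurableSet E (P x) := by
    have := IsPriorEvent.nullMeasurableSet hX.measurable hE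
    rwa [Set.inter_eq_left.2 (show E ⊆ {ω | firstTime {s | l (X s ω) = c} < ⊤} from hfin)] at this
  have hac : (P x).restrict E ≪ P x := Measure.restrict_le_self.absolutelyContinuous
  have hτ := isStopTime_firstTime (hX.continuous_paths x) hl c
  have hfix' : ∀ᵐ ω ∂(P x), ω ∈ E →
      w (X (firstTime {s | l (X s ω) = c}).toNNReal ω) =
        X (firstTime {s | l (X s ω) = c}).toNNReal ω := by
    filter_upwards [hX.continuous_paths x] with ω hω hωE
    obtain ⟨s, hs, he⟩ := exists_firstTime_eq (C := {s | l (X s ω) = c})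
      (isClosed_eq (hl.comp hω) continuous_const) (hfin ω hωE)
    rw [he, ENNReal.toNNReal_coe]
    exact hfix _ hs
  have hlaw := hX.reflection_principle x hτ hE hfin hw hfix'
  obtain ⟨Ψ, hΨ, hΦΨ⟩ := hΦ.exists_measurable
  have hXm : Measurable fun ω (s : ℝ≥0) => X s ω := measurable_pi_lambda _ hX.measurable
  have hτae : AEMeasurable (fun ω => firstTime {s | l (X s ω) = c}) ((P x).restrict E) := by
    obtain ⟨Y, hYm, hYc, hYX⟩ := exists_continuous_modification hX.measurable
      (hX.continuous_paths x)
    refine ⟨fun ω => firstTime {s | l (Y s ω) = c}, ?_, ?_⟩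
    · exact (measurable_firstTime hl hl.measurable c).comp
        (f := fun ω => (⟨fun s => Y s ω, hYc ω⟩ : {γ : ℝ≥0 → V // Continuous γ}))
        (Measurable.subtype_mk (measurable_pi_lambda _ hYm))
    · filter_upwards [hac.ae_le hYX] with ω hω
      simp only [hω]
  have hX'm := aemeasurable_reflectAfter hX.measurable w.continuous.measurable hτae
  have h1 : ∫ ω in E, Ψ (reflectAfter w (firstTime {s | l (X s ω) = c}) fun s => X s ω) ∂(P x) =
      ∫ ω in E, Ψ (fun s => X s ω) ∂(P x) := by
    rw [← integral_map hX'm hΨ.aestronglyMeasurable, hlaw,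
      integral_map hXm.aemeasurable hΨ.aestronglyMeasurable]
  have h2 : ∫ ω in E, Ψ (reflectAfter w (firstTime {s | l (X s ω) = c}) fun s => X s ω) ∂(P x) =
      -∫ ω in E, Φ (fun s => X s ω) ∂(P x) := by
    rw [← integral_neg]
    refine integral_congr_ae ?_
    filter_upwards [ae_restrict_mem₀ hE0, hac.ae_le hanti, hac.ae_le hfix',
      hac.ae_le (hX.continuous_paths x)] with ω hωE h3 h4 h5
    rw [← hΦΨ _ (continuous_reflectAfter w.continuous (hfin ω hωE) h5 (h4 hωE)), h3 hωE]
  have h3 : ∫ ω in E, Ψ (fun s => X s ω) ∂(P x) = ∫ ω in E, Φ (fun s => X s ω) ∂(P x) := by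
    refine integral_congr_ae ?_
    filter_upwards [hac.ae_le (hX.continuous_paths x)] with ω hω
    exact (hΦΨ _ hω).symm
  linarith

/-- The effect of a reflection at the exit point of `(0, 1)` on the levels attained. -/
theorem hits_reflect_iff {t : ℝ≥0} {f g : ℝ≥0 → ℝ} {c : ℤ} {τ : ℝ≥0}
    (hbefore : ∀ s < τ, f s ∈ Set.Ioo (0 : ℝ) 1)
    (hg : ∀ s, g s = if τ ≤ s then 2 * c - f s else f s)
    (n : ℤ) : Hits t g n ↔ Hits t f ((2 * c - n : ℤ) : ℝ) := by
  refine exists_congr fun s => and_congr_right fun _ => ?_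
  rw [hg]
  push_cast
  split_ifs with h
  · constructor <;> intro h <;> linarith
  · have hf := hbefore s (not_le.1 h)
    constructor
    · exact fun h => absurd h (ne_intCast_of_mem_Ioo hf n)
    · exact fun h => absurd (by push_cast; exact h) (ne_intCast_of_mem_Ioo hf (2 * c - n))

/-- In an expectation, the level sum in the direction of a root can be replaced by its residual
part, if the other factor does not notice the reflections in this direction. -/
theorem IsReflectable.integral_levelSum_mul (hX : IsReflectable G X P) (x : V) {β : V}
    (hβ : inner ℝ β β = (2 : ℝ)) (hG : ∀ n : ℤ, affRefl (β, n) ∈ G)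
    (hx : inner ℝ x β ∈ Set.Ioo (0 : ℝ) 1) {N : ℕ} (hN : 2 ≤ N) (t : ℝ≥0) {H : (ℝ≥0 → V) → ℝ}
    (hH : PathMeasurable H) {C : ℝ} (hC : ∀ γ, |H γ| ≤ C)
    (hinv : ∀ (n : ℤ) (τ : ℝ≥0∞) (γ : ℝ≥0 → V), H (reflectAfter (affRefl (β, n)) τ γ) = H γ) :
    ∫ ω, levelSum N t (fun s => inner ℝ (X s ω) β) * H (fun s => X s ω) ∂(P x) =
      ∫ ω, residualSum N t (fun s => inner ℝ (X s ω) β) * H (fun s => X s ω) ∂(P x) := by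
  have := hX.isProbabilityMeasure x
  have hC0 : 0 ≤ C := (abs_nonneg _).trans (hC fun _ => 0)
  have hl : Continuous fun y : V => (inner ℝ y β : ℝ) := by fun_prop
  have hm1 : PathMeasurable fun γ : ℝ≥0 → V => levelSum N t (fun s => inner ℝ (γ s) β) * H γ :=
    Measurable.mul (pathMeasurable_levelSum hl hl.measurable N t) hH
  have hm2 : PathMeasurable fun γ : ℝ≥0 → V => residualSum N t (fun s => inner ℝ (γ s) β) * H γ :=
    Measurable.mul (pathMeasurable_residualSum hl hl.measurable N t) hH
  have hi1 : Integrable (fun ω => levelSum N t (fun s => inner ℝ (X s ω) β) * H fun s => X s ω)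
      (P x) := by
    refine hm1.integrable (C := 2 * N * C) hX.measurable (hX.continuous_paths x)
      fun γ => ?_
    rw [abs_mul]
    exact mul_le_mul (abs_levelSum_le _ _ _) (hC γ) (abs_nonneg _) (by positivity)
  have hi2 : Integrable (fun ω => residualSum N t (fun s => inner ℝ (X s ω) β) * H fun s => X s ω)
      (P x) := by
    refine hm2.integrable (C := 2 * C) hX.measurable (hX.continuous_paths x)
      fun γ => ?_
    rw [abs_mul]
    exact mul_le_mul (abs_residualSum_le _ _ _) (hC γ) (abs_nonneg _) (by positivity)
  rw [← sub_eq_zero, ← integral_sub hi1 hi2]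
  -- The events that the interval `(0, 1)` is left at `c`, for `c = 0` and `c = 1`.
  let T : ℤ → Ω → ℝ≥0∞ := fun c ω => firstTime {s | (inner ℝ (X s ω) β : ℝ) = c}
  let E : ℤ → Set Ω := fun c => {ω | T c ω ≤ t} ∩ {ω | T c ω < T (1 - c) ω}
  have hT : ∀ c : ℤ, IsStopTime (P x) X (T c) := fun c =>
    isStopTime_firstTime (hX.continuous_paths x) hl c
  have hE : ∀ c : ℤ, IsPriorEvent (P x) X (T c) (E c) := fun c =>
    IsPriorEvent.inter (hT c) (isPriorEvent_le_const (hT c) t) (isPriorEvent_lt (hT c) (hT (1 - c)))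
  have hfin : ∀ c : ℤ, ∀ ω ∈ E c, T c ω < ⊤ := fun c ω hω => hω.1.trans_lt ENNReal.coe_lt_top
  have hE0 : ∀ c : ℤ, NullMeasurableSet (E c) (P x) := fun c => by
    have := IsPriorEvent.nullMeasurableSet hX.measurable (hE c)
    rwa [Set.inter_eq_left.2 (show E c ⊆ {ω | T c ω < ⊤} from hfin c)] at this
  have hdisj : Disjoint (E 0) (E 1) := by
    rw [Set.disjoint_left]
    rintro ω ⟨-, h1⟩ ⟨-, h2⟩
    have h1' : T 0 ω < T 1 ω := h1
    have h2' : T 1 ω < T 0 ω := h2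
    exact lt_asymm h1' h2'
  let D : (ℝ≥0 → V) → ℝ := fun γ => levelSum N t (fun s => inner ℝ (γ s) β) * H γ -
    residualSum N t (fun s => inner ℝ (γ s) β) * H γ
  have hDm : PathMeasurable D := Measurable.sub hm1 hm2
  have hzero : ∀ c : ℤ, c = 0 ∨ c = 1 → ∫ ω in E c, D (fun s => X s ω) ∂(P x) = 0 := by
    intro c hc
    have hfix : ∀ y : V, (inner ℝ y β : ℝ) = c → affRefl (β, c) y = y := by
      intro y hy
      rw [affRefl_apply_of_inner_self hβ, hy, sub_self, zero_smul, sub_zero]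
    refine hX.setIntegral_eq_zero x hl c (hE c) (hfin c) (hG c) hfix hDm ?_
    filter_upwards [hX.continuous_paths x, hX.start x] with ω hω hω0 hωE
    have hωE' : HitsBefore t (fun s => (inner ℝ (X s ω) β : ℝ)) c (1 - c) := by
      have := (hitsBefore_iff (t := t) (hl.comp hω) (c : ℝ) ((1 - c : ℤ) : ℝ)).2 hωE
      push_cast at this
      exact this
    obtain ⟨τ, hτ, hTτ⟩ := exists_firstTime_eq (C := {s | (inner ℝ (X s ω) β : ℝ) = c})
      (isClosed_eq (hl.comp hω) continuous_const) (hfin c ω hωE)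
    rw [hTτ]
    have hlt1 : ∀ s < τ, ¬ Hits s (fun s => (inner ℝ (X s ω) β : ℝ)) c := by
      intro s hs h
      have := (hits_iff (hl.comp hω) (c : ℝ)).1 h
      rw [show firstTime {s | ((fun y : V => (inner ℝ y β : ℝ)) ∘ fun s => X s ω) s = c} = τ
        from hTτ] at this
      exact absurd (by exact_mod_cast this : τ ≤ s) (not_le.2 hs)
    have hlt2 : ∀ s ≤ τ, ¬ Hits s (fun s => (inner ℝ (X s ω) β : ℝ)) ((1 - c : ℤ) : ℝ) := by
      intro s hs h
      have h1 := (hits_iff (hl.comp hω) ((1 - c : ℤ) : ℝ)).1 h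
      have h2 : T c ω < T (1 - c) ω := hωE.2
      rw [show T c ω = τ from hTτ] at h2
      have h3 := h2.trans_le h1
      exact absurd (by exact_mod_cast h3 : τ < s) (not_lt.2 hs)
    have hbefore : ∀ s < τ, (inner ℝ (X s ω) β : ℝ) ∈ Set.Ioo (0 : ℝ) 1 := by
      intro s hs
      have h1 := hlt1 s hs
      have h2 := hlt2 s hs.le
      refine mem_Ioo_of_not_hits (f := fun s => (inner ℝ (X s ω) β : ℝ)) (hl.comp hω)
        (by simpa only [hω0] using hx) ?_ ?_
      · rcases hc with rfl | rfl
        · simpa using h1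
        · simpa using h2
      · rcases hc with rfl | rfl
        · simpa using h2
        · simpa using h1
    have hg : ∀ s, (inner ℝ (reflectAfter (affRefl (β, c)) τ (fun s => X s ω) s) β : ℝ) =
        if τ ≤ s then 2 * c - (inner ℝ (X s ω) β : ℝ) else inner ℝ (X s ω) β := by
      intro s
      simp only [reflectAfter, ENNReal.coe_le_coe]
      split_ifs
      · rw [affRefl_apply_of_inner_self hβ, inner_sub_left, inner_smul_left, hβ]
        simp only [conj_trivial]
        ring
      · rfl
    have hgE : HitsBefore t (fun s => (inner ℝ (reflectAfter (affRefl (β, c)) τ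
        (fun s => X s ω) s) β : ℝ)) c (1 - c) := by
      have hτt : τ ≤ t := by
        have : T c ω ≤ t := hωE.1
        rw [show T c ω = τ from hTτ] at this
        exact_mod_cast this
      have hτ' : (inner ℝ (X τ ω) β : ℝ) = c := hτ
      refine ⟨τ, hτt, ?_, fun r hr => ?_⟩
      · beta_reduce
        rw [hg, if_pos le_rfl, hτ']; ring
      · beta_reduce
        rw [hg]
        rcases hr.lt_or_eq with hr | rfl
        · rw [if_neg (not_le.2 hr)]
          have := ne_intCast_of_mem_Ioo (hbefore r hr) (1 - c)
          push_cast at this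
          exact this
        · rw [if_pos le_rfl, hτ']
          rcases hc with rfl | rfl <;> norm_num
    have hmain := levelSum_sub_residualSum_reflect hN hc hωE' hgE
      (hits_reflect_iff hbefore hg)
    simp only [D, hinv]
    linear_combination H (fun s => X s ω) * hmain
  have hunion : ∫ ω in E 0 ∪ E 1, D (fun s => X s ω) ∂(P x) = 0 := by
    have hD : Integrable (fun ω => D fun s => X s ω) (P x) := hi1.sub hi2
    rw [setIntegral_union₀ hdisj.aedisjoint (hE0 1) hD.integrableOn hD.integrableOn,
      hzero 0 (Or.inl rfl), hzero 1 (Or.inr rfl), add_zero]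
  rw [← hunion]
  symm
  -- Outside these events the path stays in `(0, 1)`, and both sums are equal to `1`.
  refine setIntegral_eq_integral_of_ae_compl_eq_zero ?_
  filter_upwards [hX.continuous_paths x, hX.start x] with ω hω hω0 hωE
  have hlω := hl.comp hω
  have h01 : ¬ HitsBefore t (fun s => (inner ℝ (X s ω) β : ℝ)) 0 1 := fun h => hωE <| Or.inl <| by
    have := (hitsBefore_iff hlω 0 1).1 h
    simpa [E, T] using this
  have h10 : ¬ HitsBefore t (fun s => (inner ℝ (X s ω) β : ℝ)) 1 0 := fun h => hωE <| Or.inr <| by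
    have := (hitsBefore_iff hlω 1 0).1 h
    simpa [E, T] using this
  obtain ⟨h0, h1⟩ := not_hits_of_not_hitsBefore hlω h01 h10
  have hL : levelSum N t (fun s => (inner ℝ (X s ω) β : ℝ)) = 1 :=
    levelSum_eq_one (by omega) fun s hs => mem_Ioo_of_not_hits
      (f := fun s => (inner ℝ (X s ω) β : ℝ)) hlω (by simpa only [hω0] using hx)
      (fun ⟨r, hr, h⟩ => h0 ⟨r, hr.trans hs, h⟩)
      (fun ⟨r, hr, h⟩ => h1 ⟨r, hr.trans hs, h⟩)
  have hR : residualSum N t (fun s => (inner ℝ (X s ω) β : ℝ)) = 1 := by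
    simp [residualSum, h01, h10]
  simp only [D, hL, hR, sub_self]

end Residual

section OrthogonalRoots

variable {V Ω : Type*} [NormedAddCommGroup V] [InnerProductSpace ℝ V] [MeasurableSpace V]
  [BorelSpace V] [SecondCountableTopology V] [MeasurableSpace Ω]
  {G : Subgroup (V ≃ᵃⁱ[ℝ] V)} {X : ℝ≥0 → Ω → V} {P : V → Measure Ω}

/-- For orthogonal roots the level sums can be replaced by their residual parts one after another,
since the reflections in the direction of one of the roots do not affect the other ones. -/
theorem IsReflectable.integral_prod_levelSum (hX : IsReflectable G X P) (x : V) {ι : Type*}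
    [Fintype ι] {β : ι → V} (hβ : ∀ i, inner ℝ (β i) (β i) = (2 : ℝ))
    (hort : ∀ i j, i ≠ j → inner ℝ (β i) (β j) = (0 : ℝ))
    (hG : ∀ i, ∀ n : ℤ, affRefl (β i, n) ∈ G) (hx : ∀ i, inner ℝ x (β i) ∈ Set.Ioo (0 : ℝ) 1)
    {N : ℕ} (hN : 2 ≤ N) (t : ℝ≥0) :
    ∫ ω, ∏ i, levelSum N t (fun s => inner ℝ (X s ω) (β i)) ∂(P x) =
      ∫ ω, ∏ i, residualSum N t (fun s => inner ℝ (X s ω) (β i)) ∂(P x) := by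
  classical
  -- The residual part in the directions of `S`, and the level sum in the others.
  let F : Finset ι → ι → (ℝ≥0 → ℝ) → ℝ := fun S i f =>
    if i ∈ S then residualSum N t f else levelSum N t f
  have hF : ∀ S i f, |F S i f| ≤ 2 * N := by
    intro S i f
    simp only [F]
    split_ifs
    · have h2 : (2 : ℝ) ≤ N := by exact_mod_cast hN
      linarith [abs_residualSum_le N t f]
    · exact abs_levelSum_le N t f
  have hl : ∀ i, Continuous fun y : V => (inner ℝ y (β i) : ℝ) := fun i => by fun_prop
  have hFm : ∀ S i, PathMeasurable fun γ : ℝ≥0 → V => F S i fun s => inner ℝ (γ s) (β i) := by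
    intro S i
    simp only [F]
    split_ifs
    · exact pathMeasurable_residualSum (hl i) (hl i).measurable N t
    · exact pathMeasurable_levelSum (hl i) (hl i).measurable N t
  have key : ∀ S : Finset ι,
      ∫ ω, ∏ i, levelSum N t (fun s => inner ℝ (X s ω) (β i)) ∂(P x) =
        ∫ ω, ∏ i, F S i (fun s => inner ℝ (X s ω) (β i)) ∂(P x) := by
    intro S
    induction S using Finset.induction_on with
    | empty => simp [F]
    | insert a S ha ih =>
      let H : (ℝ≥0 → V) → ℝ := fun γ =>
        ∏ i ∈ Finset.univ.erase a, F S i fun s => inner ℝ (γ s) (β i)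
      have hH : PathMeasurable H := Finset.measurable_fun_prod _ fun i _ => hFm S i
      have hC : ∀ γ, |H γ| ≤ (2 * N : ℝ) ^ (Finset.univ.erase a).card := by
        intro γ
        simp only [H, Finset.abs_prod]
        exact (Finset.prod_le_prod (fun i _ => abs_nonneg _) fun i _ => hF S i _).trans_eq
          (Finset.prod_const _)
      have hinv : ∀ (n : ℤ) (τ : ℝ≥0∞) (γ : ℝ≥0 → V),
          H (reflectAfter (affRefl (β a, n)) τ γ) = H γ := by
        intro n τ γ
        refine Finset.prod_congr rfl fun i hi => ?_
        have : ∀ s, (inner ℝ (reflectAfter (affRefl (β a, n)) τ γ s) (β i) : ℝ) =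
            inner ℝ (γ s) (β i) := by
          intro s
          simp only [reflectAfter]
          split_ifs
          · rw [affRefl_apply_of_inner_self (hβ a), inner_sub_left, inner_smul_left,
              hort a i (Finset.ne_of_mem_erase hi).symm, mul_zero, sub_zero]
          · rfl
        simp only [this]
      have hstep := hX.integral_levelSum_mul x (hβ a) (hG a) (hx a) hN t hH hC hinv
      have h1 : ∀ γ : ℝ≥0 → V, ∏ i, F S i (fun s => inner ℝ (γ s) (β i)) =
          levelSum N t (fun s => inner ℝ (γ s) (β a)) * H γ := by
        intro γ
        rw [← Finset.mul_prod_erase _ _ (Finset.mem_univ a)]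
        simp [F, H, ha]
      have h2 : ∀ γ : ℝ≥0 → V, ∏ i, F (insert a S) i (fun s => inner ℝ (γ s) (β i)) =
          residualSum N t (fun s => inner ℝ (γ s) (β a)) * H γ := by
        intro γ
        rw [← Finset.mul_prod_erase _ _ (Finset.mem_univ a)]
        congr 1
        · simp [F]
        · refine Finset.prod_congr rfl fun i hi => ?_
          simp [F, Finset.ne_of_mem_erase hi]
      rw [ih]
      simp only [h1, h2]
      exact hstep
  rw [key Finset.univ]
  simp [F]

/-- The expectations of the products of level sums converge for every reflectable process, because
the residual parts are bounded. -/
theorem IsReflectable.tendsto_integral_prod_levelSum (hX : IsReflectable G X P) (x : V) {ι : Type*}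
    [Fintype ι] {β : ι → V} (hβ : ∀ i, inner ℝ (β i) (β i) = (2 : ℝ))
    (hort : ∀ i j, i ≠ j → inner ℝ (β i) (β j) = (0 : ℝ))
    (hG : ∀ i, ∀ n : ℤ, affRefl (β i, n) ∈ G) (hx : ∀ i, inner ℝ x (β i) ∈ Set.Ioo (0 : ℝ) 1)
    (t : ℝ≥0) :
    Tendsto (fun N : ℕ => ∫ ω, ∏ i, levelSum N t (fun s => inner ℝ (X s ω) (β i)) ∂(P x)) atTop
      (𝓝 (∫ ω, ∏ i, exitValue t (fun s => inner ℝ (X s ω) (β i)) ∂(P x))) := by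
  have := hX.isProbabilityMeasure x
  have hl : ∀ i, Continuous fun y : V => (inner ℝ y (β i) : ℝ) := fun i => by fun_prop
  have h : Tendsto (fun N : ℕ => ∫ ω, ∏ i, residualSum N t (fun s => inner ℝ (X s ω) (β i)) ∂(P x))
      atTop (𝓝 (∫ ω, ∏ i, exitValue t (fun s => inner ℝ (X s ω) (β i)) ∂(P x))) := by
    refine tendsto_integral_of_dominated_convergence (fun _ => ∏ _i : ι, (2 : ℝ)) (fun N => ?_)
      (integrable_const _) (fun N => ae_of_all _ fun ω => ?_) ?_
    · have hm : PathMeasurable fun γ : ℝ≥0 → V =>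
          ∏ i, residualSum N t (fun s => inner ℝ (γ s) (β i)) :=
        Finset.measurable_fun_prod _ fun i _ =>
          pathMeasurable_residualSum (hl i) (hl i).measurable N t
      exact hm.aestronglyMeasurable hX.measurable (hX.continuous_paths x)
    · rw [Real.norm_eq_abs, Finset.abs_prod]
      exact Finset.prod_le_prod (fun i _ => abs_nonneg _) fun i _ => abs_residualSum_le _ _ _
    · filter_upwards [hX.continuous_paths x] with ω hω
      exact tendsto_finsetProd _ fun i _ => tendsto_residualSum ((hl i).comp hω)
  refine h.congr' ?_
  filter_upwards [eventually_ge_atTop 2] with N hN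
  exact (hX.integral_prod_levelSum x hβ hort hG hx hN t).symm

end OrthogonalRoots

/-! ### Alternating sums over permutations -/

section AltSum

open Equiv Equiv.Perm

variable {r : ℕ}

/-- The element `2 m` of `Fin (2 r + 1)`. -/
def evenIdx (m : Fin r) : Fin (2 * r + 1) := ⟨2 * m, by omega⟩

/-- The element `2 m + 1` of `Fin (2 r + 1)`. -/
def oddIdx (m : Fin r) : Fin (2 * r + 1) := ⟨2 * m + 1, by omega⟩

theorem evenIdx_ne_oddIdx (m n : Fin r) : evenIdx m ≠ oddIdx n := by
  simp [evenIdx, oddIdx, Fin.ext_iff]; omega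

theorem evenIdx_injective : Function.Injective (evenIdx (r := r)) := fun m n h => by
  simp [evenIdx, Fin.ext_iff] at h; omega

theorem oddIdx_injective : Function.Injective (oddIdx (r := r)) := fun m n h => by
  simp [oddIdx, Fin.ext_iff] at h; omega

theorem evenIdx_ne_last (m : Fin r) : evenIdx m ≠ Fin.last (2 * r) := by
  simp [evenIdx, Fin.ext_iff]; omega

theorem oddIdx_ne_last (m : Fin r) : oddIdx m ≠ Fin.last (2 * r) := by
  simp [oddIdx, Fin.ext_iff]; omega

/-- The alternating sum `∑ σ, sign σ ∏ m, H m (σ (2 m)) (σ (2 m + 1))`. If all `H m` are equal to an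
antisymmetric matrix `G`, this is up to a constant the Pfaffian of `G` bordered by a row of ones. -/
noncomputable def altSum (H : Fin r → Fin (2 * r + 1) → Fin (2 * r + 1) → ℝ) : ℝ :=
  ∑ σ : Perm (Fin (2 * r + 1)),
    ((sign σ : ℤ) : ℝ) * ∏ m, H m (σ (evenIdx m)) (σ (oddIdx m))

theorem altSum_update (H : Fin r → Fin (2 * r + 1) → Fin (2 * r + 1) → ℝ) (m : Fin r)
    (a : Fin (2 * r + 1) → Fin (2 * r + 1) → ℝ) :
    altSum (Function.update H m a) = ∑ σ : Perm (Fin (2 * r + 1)),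
      ((sign σ : ℤ) : ℝ) * (a (σ (evenIdx m)) (σ (oddIdx m)) *
        ∏ n ∈ Finset.univ.erase m, H n (σ (evenIdx n)) (σ (oddIdx n))) := by
  refine Finset.sum_congr rfl fun σ _ => ?_
  rw [← Finset.mul_prod_erase _ _ (Finset.mem_univ m), Function.update_self]
  congr 2
  refine Finset.prod_congr rfl fun n hn => ?_
  rw [Function.update_of_ne (Finset.ne_of_mem_erase hn)]

/-- To change the matrix in all factors it is enough to change it in one factor at a time. -/
theorem altSum_const_congr {a b : Fin (2 * r + 1) → Fin (2 * r + 1) → ℝ}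
    (h : ∀ H m, altSum (r := r) (Function.update H m a) = altSum (Function.update H m b)) :
    altSum (fun _ : Fin r => a) = altSum fun _ => b := by
  classical
  have key : ∀ S : Finset (Fin r), altSum (fun _ : Fin r => a) =
      altSum fun m => if m ∈ S then b else a := by
    intro S
    induction S using Finset.induction_on with
    | empty => simp
    | insert m S hm ih =>
      rw [ih]
      have := h (fun m => if m ∈ S then b else a) m
      convert this using 2
      · ext n : 1
        rcases eq_or_ne n m with rfl | hn
        · simp [hm]
        · simp [hn]
      · ext n : 1
        rcases eq_or_ne n m with rfl | hn
        · simp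
        · simp [hn]
  rw [key Finset.univ]
  simp

theorem sum_sign_mul_comp_swap {α : Type*} [Fintype α] [DecidableEq α] {p q : α} (hpq : p ≠ q)
    (F : Perm α → ℝ) :
    ∑ σ : Perm α, ((sign σ : ℤ) : ℝ) * F (σ * swap p q) =
      -∑ σ : Perm α, ((sign σ : ℤ) : ℝ) * F σ := by
  rw [← Finset.sum_neg_distrib]
  refine Fintype.sum_equiv (Equiv.mulRight (swap p q)) _ _ fun σ => ?_
  simp [sign_swap hpq]

/-- A factor that depends on `σ (2 m)` only contributes nothing, because `σ (2 m + 1)` and the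
value of `σ` at the last index, which no factor sees, may be exchanged. -/
theorem altSum_update_left (H : Fin r → Fin (2 * r + 1) → Fin (2 * r + 1) → ℝ) (m : Fin r)
    (u : Fin (2 * r + 1) → ℝ) : altSum (Function.update H m fun i _ => u i) = 0 := by
  rw [altSum_update]
  have h := sum_sign_mul_comp_swap (oddIdx_ne_last m) fun σ => u (σ (evenIdx m)) *
        ∏ n ∈ Finset.univ.erase m, H n (σ (evenIdx n)) (σ (oddIdx n))
  have h2 : ∀ σ : Perm (Fin (2 * r + 1)),
      u ((σ * swap (oddIdx m) (Fin.last _)) (evenIdx m)) *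
        ∏ n ∈ Finset.univ.erase m, H n ((σ * swap (oddIdx m) (Fin.last _)) (evenIdx n))
          ((σ * swap (oddIdx m) (Fin.last _)) (oddIdx n)) =
      u (σ (evenIdx m)) * ∏ n ∈ Finset.univ.erase m, H n (σ (evenIdx n)) (σ (oddIdx n)) := by
    intro σ
    congr 1
    · rw [mul_apply, swap_apply_of_ne_of_ne (evenIdx_ne_oddIdx _ _) (evenIdx_ne_last _)]
    · refine Finset.prod_congr rfl fun n hn => ?_
      rw [mul_apply, mul_apply, swap_apply_of_ne_of_ne (evenIdx_ne_oddIdx _ _) (evenIdx_ne_last _),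
        swap_apply_of_ne_of_ne (oddIdx_injective.ne (Finset.ne_of_mem_erase hn)) (oddIdx_ne_last _)]
  simp only [h2] at h
  linarith

theorem altSum_update_right (H : Fin r → Fin (2 * r + 1) → Fin (2 * r + 1) → ℝ) (m : Fin r)
    (u : Fin (2 * r + 1) → ℝ) : altSum (Function.update H m fun _ j => u j) = 0 := by
  rw [altSum_update]
  have h := sum_sign_mul_comp_swap (evenIdx_ne_last m) fun σ => u (σ (oddIdx m)) *
        ∏ n ∈ Finset.univ.erase m, H n (σ (evenIdx n)) (σ (oddIdx n))
  have h2 : ∀ σ : Perm (Fin (2 * r + 1)),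
      u ((σ * swap (evenIdx m) (Fin.last _)) (oddIdx m)) *
        ∏ n ∈ Finset.univ.erase m, H n ((σ * swap (evenIdx m) (Fin.last _)) (evenIdx n))
          ((σ * swap (evenIdx m) (Fin.last _)) (oddIdx n)) =
      u (σ (oddIdx m)) * ∏ n ∈ Finset.univ.erase m, H n (σ (evenIdx n)) (σ (oddIdx n)) := by
    intro σ
    congr 1
    · rw [mul_apply, swap_apply_of_ne_of_ne (evenIdx_ne_oddIdx _ _).symm (oddIdx_ne_last _)]
    · refine Finset.prod_congr rfl fun n hn => ?_
      rw [mul_apply, mul_apply,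
        swap_apply_of_ne_of_ne (evenIdx_injective.ne (Finset.ne_of_mem_erase hn))
          (evenIdx_ne_last _),
        swap_apply_of_ne_of_ne (evenIdx_ne_oddIdx _ _).symm (oddIdx_ne_last _)]
  simp only [h2] at h
  linarith

theorem altSum_update_add (H : Fin r → Fin (2 * r + 1) → Fin (2 * r + 1) → ℝ) (m : Fin r)
    (a b : Fin (2 * r + 1) → Fin (2 * r + 1) → ℝ) :
    altSum (Function.update H m fun i j => a i j + b i j) =
      altSum (Function.update H m a) + altSum (Function.update H m b) := by
  simp only [altSum_update, ← Finset.sum_add_distrib]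
  exact Finset.sum_congr rfl fun σ _ => by ring

/-- Adding multiples of the border of ones to the rows and columns does not change the sum. -/
theorem altSum_add_sub (G : Fin (2 * r + 1) → Fin (2 * r + 1) → ℝ) (u : Fin (2 * r + 1) → ℝ) :
    altSum (fun _ : Fin r => fun i j => G i j + (u i - u j)) = altSum fun _ => G := by
  refine altSum_const_congr fun H m => ?_
  have h := altSum_update_add H m (fun i _ => u i) (fun _ j => -u j)
  rw [altSum_update_left, altSum_update_right H m fun j => -u j] at h
  rw [altSum_update_add H m G fun i j => u i - u j]
  simp only [sub_eq_add_neg]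
  rw [h, add_zero, add_zero]

theorem altSum_comp_perm (G : Fin (2 * r + 1) → Fin (2 * r + 1) → ℝ)
    (π : Perm (Fin (2 * r + 1))) :
    altSum (fun _ : Fin r => fun i j => G (π i) (π j)) =
      ((sign π : ℤ) : ℝ) * altSum fun _ => G := by
  rw [altSum, altSum, Finset.mul_sum]
  refine Fintype.sum_equiv (Equiv.mulLeft π) _ _ fun σ => ?_
  have hπ : ((sign π : ℤ) : ℝ) * ((sign π : ℤ) : ℝ) = 1 := by
    rcases Int.units_eq_one_or (sign π) with h | h <;> simp [h]
  simp only [Equiv.coe_mulLeft, Perm.sign_mul, mul_apply, Units.val_mul, Int.cast_mul]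
  rw [← mul_assoc, ← mul_assoc, hπ, one_mul]

theorem altSum_comp_swap (G : Fin (2 * r + 1) → Fin (2 * r + 1) → ℝ) {p q : Fin (2 * r + 1)}
    (hpq : p ≠ q) :
    altSum (fun _ : Fin r => fun i j => G (swap p q i) (swap p q j)) = -altSum fun _ => G := by
  rw [altSum_comp_perm, sign_swap hpq]
  simp

open scoped Classical in
/-- The permutations `σ` with `σ (2 m) < σ (2 m + 1)` for all `m`. -/
noncomputable def orderedPerms (r : ℕ) : Finset (Perm (Fin (2 * r + 1))) :=
  {σ | ∀ m : Fin r, σ (evenIdx m) < σ (oddIdx m)}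

theorem mem_orderedPerms {σ : Perm (Fin (2 * r + 1))} :
    σ ∈ orderedPerms r ↔ ∀ m : Fin r, σ (evenIdx m) < σ (oddIdx m) := by
  simp [orderedPerms]

/-- For an antisymmetric matrix only the permutations that respect the order within the pairs
`{2 m, 2 m + 1}` are needed. -/
theorem altSum_antisymm {G : Fin (2 * r + 1) → Fin (2 * r + 1) → ℝ} (hG : ∀ i j, G j i = -G i j) :
    altSum (fun _ : Fin r => G) = 2 ^ r * ∑ σ ∈ orderedPerms r,
      ((sign σ : ℤ) : ℝ) * ∏ m : Fin r, G (σ (evenIdx m)) (σ (oddIdx m)) := by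
  classical
  have h1 : altSum (fun _ : Fin r => G) =
      altSum fun _ : Fin r => fun i j => (if i < j then G i j else 0) +
        (if i < j then G i j else 0) := by
    refine altSum_const_congr fun H m => ?_
    have hsplit : G = fun i j => (if i < j then G i j else 0) + (if j < i then G i j else 0) := by
      ext i j
      rcases lt_trichotomy i j with h | rfl | h
      · simp [h, h.not_gt]
      · have := hG i i
        simp; linarith
      · simp [h, h.not_gt]
    conv_lhs => rw [hsplit]
    rw [altSum_update_add, altSum_update_add]
    congr 1
    rw [altSum_update, altSum_update]
    have h := sum_sign_mul_comp_swap (evenIdx_ne_oddIdx m m) fun σ =>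
      (if σ (oddIdx m) < σ (evenIdx m) then G (σ (evenIdx m)) (σ (oddIdx m)) else 0) *
        ∏ n ∈ Finset.univ.erase m, H n (σ (evenIdx n)) (σ (oddIdx n))
    rw [← neg_eq_iff_eq_neg] at h
    rw [← h, ← Finset.sum_neg_distrib]
    refine Finset.sum_congr rfl fun σ _ => ?_
    have h3 : ∏ n ∈ Finset.univ.erase m,
        H n ((σ * swap (evenIdx m) (oddIdx m)) (evenIdx n))
          ((σ * swap (evenIdx m) (oddIdx m)) (oddIdx n)) =
        ∏ n ∈ Finset.univ.erase m, H n (σ (evenIdx n)) (σ (oddIdx n)) := by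
      refine Finset.prod_congr rfl fun n hn => ?_
      have hn' := Finset.ne_of_mem_erase hn
      rw [mul_apply, mul_apply,
        swap_apply_of_ne_of_ne (evenIdx_injective.ne hn') (evenIdx_ne_oddIdx _ _),
        swap_apply_of_ne_of_ne (evenIdx_ne_oddIdx _ _).symm (oddIdx_injective.ne hn')]
    rw [h3, mul_apply, mul_apply, swap_apply_left, swap_apply_right]
    split_ifs
    · rw [hG (σ (evenIdx m)) (σ (oddIdx m))]; ring
    · ring
  rw [h1, altSum, Finset.mul_sum, orderedPerms, Finset.sum_filter]
  refine Finset.sum_congr rfl fun σ _ => ?_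
  split_ifs with h
  · have : ∀ m : Fin r, ((if σ (evenIdx m) < σ (oddIdx m) then G (σ (evenIdx m)) (σ (oddIdx m))
        else 0) + if σ (evenIdx m) < σ (oddIdx m) then G (σ (evenIdx m)) (σ (oddIdx m)) else 0) =
        2 * G (σ (evenIdx m)) (σ (oddIdx m)) := fun m => by rw [if_pos (h m)]; ring
    simp only [this, Finset.prod_mul_distrib, Finset.prod_const, Finset.card_univ, Fintype.card_fin]
    ring
  · push Not at h
    obtain ⟨m, hm⟩ := h
    rw [Finset.prod_eq_zero (Finset.mem_univ m), mul_zero]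
    rw [if_neg (not_lt.2 hm), add_zero]

end AltSum

/-! ### Signed enumeration of matchings -/

section Matchings

open Equiv Equiv.Perm

variable {r : ℕ}

/-- The set of the pairs `(σ (2 m), σ (2 m + 1))`. -/
def pairSet (σ : Perm (Fin (2 * r + 1))) : Finset (Fin (2 * r + 1) × Fin (2 * r + 1)) :=
  Finset.univ.image fun m : Fin r => (σ (evenIdx m), σ (oddIdx m))

theorem mem_pairSet {σ : Perm (Fin (2 * r + 1))} {p : Fin (2 * r + 1) × Fin (2 * r + 1)} :
    p ∈ pairSet σ ↔ ∃ m : Fin r, (σ (evenIdx m), σ (oddIdx m)) = p := by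
  simp [pairSet]

theorem card_pairSet (σ : Perm (Fin (2 * r + 1))) : (pairSet σ).card = r := by
  rw [pairSet, Finset.card_image_of_injective _ ?_, Finset.card_univ, Fintype.card_fin]
  intro m n h
  exact evenIdx_injective (σ.injective (congrArg Prod.fst h))

theorem pairSet_mul (σ τ : Perm (Fin (2 * r + 1))) :
    pairSet (σ * τ) = (pairSet τ).image (Prod.map σ σ) := by
  simp [pairSet, Finset.image_image, Function.comp_def]

theorem pairSet_mul_eq_iff (σ τ : Perm (Fin (2 * r + 1))) :
    pairSet (σ * τ) = pairSet σ ↔ pairSet τ = pairSet 1 := by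
  have h := pairSet_mul σ 1
  rw [mul_one] at h
  rw [pairSet_mul, h]
  exact (Finset.image_injective (σ.injective.prodMap σ.injective)).eq_iff

/-- A permutation which permutes the pairs `(2 m, 2 m + 1)` is even, since it induces the same
permutation on the first as on the second entries. -/
theorem sign_eq_one_of_pairSet_eq {σ : Perm (Fin (2 * r + 1))} (hσ : pairSet σ = pairSet 1) :
    sign σ = 1 := by
  have h1 : ∀ m : Fin r, ∃ n : Fin r, σ (evenIdx m) = evenIdx n ∧ σ (oddIdx m) = oddIdx n := by
    intro m
    have : (σ (evenIdx m), σ (oddIdx m)) ∈ pairSet σ := mem_pairSet.2 ⟨m, rfl⟩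
    rw [hσ, mem_pairSet] at this
    obtain ⟨n, hn⟩ := this
    exact ⟨n, (congrArg Prod.fst hn).symm, (congrArg Prod.snd hn).symm⟩
  choose π hπ1 hπ2 using h1
  have hπ : Function.Bijective π := Finite.injective_iff_bijective.1 fun m n h =>
    evenIdx_injective (σ.injective (by rw [hπ1, hπ1, h]))
  have hlast : σ (Fin.last (2 * r)) = Fin.last (2 * r) := by
    by_contra hne
    have hlt : (σ (Fin.last (2 * r)) : ℕ) < 2 * r := by
      have := (σ (Fin.last (2 * r))).2
      have h' : (σ (Fin.last (2 * r)) : ℕ) ≠ 2 * r := fun h => hne (Fin.ext (by simpa using h))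
      omega
    obtain ⟨m, hm⟩ := hπ.2 ⟨(σ (Fin.last (2 * r)) : ℕ) / 2, by omega⟩
    have hm' : (π m : ℕ) = (σ (Fin.last (2 * r)) : ℕ) / 2 := congrArg Fin.val hm
    rcases Nat.mod_two_eq_zero_or_one (σ (Fin.last (2 * r)) : ℕ) with h | h
    · exact evenIdx_ne_last m (σ.injective (by rw [hπ1]; ext; simp [evenIdx]; omega))
    · exact oddIdx_ne_last m (σ.injective (by rw [hπ2]; ext; simp [oddIdx]; omega))
  let ψ : (Bool × Fin r) ⊕ Unit → Fin (2 * r + 1) :=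
    Sum.elim (fun p => if p.1 then oddIdx p.2 else evenIdx p.2) fun _ => Fin.last (2 * r)
  have hψinj : Function.Injective ψ := by
    rintro (⟨_ | _, m⟩ | _) (⟨_ | _, n⟩ | _) h <;>
      simp only [ψ, Sum.elim_inl, Sum.elim_inr, if_true, Bool.false_eq_true, if_false] at h
    · rw [evenIdx_injective h]
    · exact absurd h (evenIdx_ne_oddIdx _ _)
    · exact absurd h (evenIdx_ne_last _)
    · exact absurd h.symm (evenIdx_ne_oddIdx _ _)
    · rw [oddIdx_injective h]
    · exact absurd h (oddIdx_ne_last _)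
    · exact absurd h.symm (evenIdx_ne_last _)
    · exact absurd h.symm (oddIdx_ne_last _)
    · rfl
  have hψ : Function.Bijective ψ := (Fintype.bijective_iff_injective_and_card ψ).2
    ⟨hψinj, by simp⟩
  have hsign := sign_eq_sign_of_equiv
    (Perm.sumCongr (prodCongrRight fun _ : Bool => Equiv.ofBijective π hπ) (1 : Perm Unit)) σ
    (Equiv.ofBijective ψ hψ) (by
      rintro (⟨_ | _, m⟩ | _)
      · simp [ψ, hπ1]
      · simp [ψ, hπ2]
      · simp [ψ, hlast])
  rw [← hsign, sign_sumCongr, sign_prodCongrRight]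
  simp

theorem swap_lt_swap {p q a b : Fin (2 * r + 1)} (hpq : (q : ℕ) = p + 1) (hab : a < b)
    (h : ¬ (a = p ∧ b = q)) : swap p q a < swap p q b := by
  rw [swap_apply_def, swap_apply_def]
  simp only [Fin.ext_iff, Fin.lt_def] at *
  split_ifs <;> omega

/-- The sum of the signs of the ordered permutations is the number of those which permute the pairs
`(2 m, 2 m + 1)`: the others cancel, by exchanging the two members of the first pair that is
missing. -/
theorem sum_sign_orderedPerms :
    ∑ σ ∈ orderedPerms r, ((sign σ : ℤ) : ℝ) =
      ({σ : Perm (Fin (2 * r + 1)) | pairSet σ = pairSet 1} : Finset _).card := by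
  classical
  rw [← Finset.sum_filter_add_sum_filter_not _ fun σ => pairSet σ = pairSet 1]
  have h1 : (orderedPerms r).filter (fun σ => pairSet σ = pairSet 1) =
      ({σ : Perm (Fin (2 * r + 1)) | pairSet σ = pairSet 1} : Finset _) := by
    ext σ
    simp only [Finset.mem_filter, mem_orderedPerms, Finset.mem_univ, true_and,
      and_iff_right_iff_imp]
    intro h m
    have : (σ (evenIdx m), σ (oddIdx m)) ∈ pairSet σ := mem_pairSet.2 ⟨m, rfl⟩
    rw [h, mem_pairSet] at this
    obtain ⟨n, hn⟩ := this
    obtain ⟨h1, h2⟩ := Prod.mk.inj hn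
    rw [← h1, ← h2]
    simp [evenIdx, oddIdx, Fin.lt_def]
  rw [h1]
  have h2 : ∑ σ ∈ ({σ : Perm (Fin (2 * r + 1)) | pairSet σ = pairSet 1} : Finset _),
      ((sign σ : ℤ) : ℝ) =
      ({σ : Perm (Fin (2 * r + 1)) | pairSet σ = pairSet 1} : Finset _).card := by
    rw [Finset.card_eq_sum_ones]
    push_cast
    refine Finset.sum_congr rfl fun σ hσ => ?_
    rw [sign_eq_one_of_pairSet_eq (by simpa using hσ)]
    simp
  rw [h2, add_eq_left]
  -- The pairs that are missing.
  let M : Perm (Fin (2 * r + 1)) → Finset (Fin r) := fun σ =>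
    {i | (evenIdx i, oddIdx i) ∉ pairSet σ}
  have hM : ∀ σ, pairSet σ ≠ pairSet 1 → (M σ).Nonempty := by
    intro σ hσ
    by_contra hemp
    rw [Finset.not_nonempty_iff_eq_empty, Finset.filter_eq_empty_iff] at hemp
    refine hσ (Finset.eq_of_subset_of_card_le ?_ (by rw [card_pairSet, card_pairSet])).symm
    intro p hp
    obtain ⟨m, rfl⟩ := mem_pairSet.1 hp
    simpa using hemp (Finset.mem_univ m)
  have hord : ∀ σ ∈ orderedPerms r, ∀ i ∈ M σ,
      swap (evenIdx i) (oddIdx i) * σ ∈ orderedPerms r := by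
    intro σ hσ i hi
    rw [mem_orderedPerms] at hσ ⊢
    intro m
    refine swap_lt_swap (by simp [evenIdx, oddIdx]) (hσ m) ?_
    rintro ⟨h1, h2⟩
    have h3 := (Finset.mem_filter.1 hi).2
    exact h3 (mem_pairSet.2 ⟨m, by rw [h1, h2]⟩)
  have hMeq : ∀ σ ∈ orderedPerms r, ∀ i ∈ M σ, M (swap (evenIdx i) (oddIdx i) * σ) = M σ := by
    intro σ hσ i hi
    ext j
    simp only [M, Finset.mem_filter, Finset.mem_univ, true_and, not_iff_not]
    rcases eq_or_ne j i with rfl | hj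
    · have h3 := (Finset.mem_filter.1 hi).2
      refine iff_of_false ?_ h3
      rw [mem_pairSet]
      rintro ⟨m, hm⟩
      have e1 : swap (evenIdx j) (oddIdx j) (σ (evenIdx m)) = evenIdx j := congrArg Prod.fst hm
      have e2 : swap (evenIdx j) (oddIdx j) (σ (oddIdx m)) = oddIdx j := congrArg Prod.snd hm
      rw [swap_apply_eq_iff, swap_apply_left] at e1
      rw [swap_apply_eq_iff, swap_apply_right] at e2
      have h4 := mem_orderedPerms.1 hσ m
      rw [e1, e2] at h4
      simp [evenIdx, oddIdx, Fin.lt_def] at h4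
    · rw [mem_pairSet, mem_pairSet]
      refine exists_congr fun m => ?_
      simp only [Prod.mk.injEq, mul_apply, swap_apply_eq_iff]
      rw [swap_apply_of_ne_of_ne (evenIdx_injective.ne hj) (evenIdx_ne_oddIdx _ _),
        swap_apply_of_ne_of_ne (evenIdx_ne_oddIdx _ _).symm (oddIdx_injective.ne hj)]
  have hne : ∀ σ, ∀ i ∈ M σ, pairSet σ ≠ pairSet 1 := by
    intro σ i hi h
    have h3 := (Finset.mem_filter.1 hi).2
    rw [h] at h3
    exact h3 (mem_pairSet.2 ⟨i, rfl⟩)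
  refine Finset.sum_involution
    (fun σ hσ => swap (evenIdx ((M σ).min' (hM σ (Finset.mem_filter.1 hσ).2)))
      (oddIdx ((M σ).min' (hM σ (Finset.mem_filter.1 hσ).2))) * σ) ?_ ?_ ?_ ?_
  · intro σ hσ
    simp [Perm.sign_mul, sign_swap (evenIdx_ne_oddIdx _ _)]
  · intro σ hσ _ h
    have := congrArg sign h
    rw [Perm.sign_mul, sign_swap (evenIdx_ne_oddIdx _ _)] at this
    rcases Int.units_eq_one_or (sign σ) with h' | h' <;> rw [h'] at this <;> simp at this
  · intro σ hσ
    obtain ⟨h3, h4⟩ := Finset.mem_filter.1 hσ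
    have hmem := Finset.min'_mem _ (hM σ h4)
    refine Finset.mem_filter.2 ⟨hord σ h3 _ hmem, ?_⟩
    refine hne _ ((M σ).min' (hM σ h4)) ?_
    rw [hMeq σ h3 _ hmem]
    exact hmem
  · intro σ hσ
    obtain ⟨h3, h4⟩ := Finset.mem_filter.1 hσ
    have hmem := Finset.min'_mem _ (hM σ h4)
    have h5 := hMeq σ h3 _ hmem
    simp only [h5]
    rw [← mul_assoc, swap_mul_self, one_mul]

/-- A sum over matchings as a sum over ordered permutations: the fibres have constant size. -/
theorem sum_pairSet_orderedPerms {f : Finset (Fin (2 * r + 1) × Fin (2 * r + 1)) → ℝ} :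
    ∑ σ ∈ orderedPerms r, f (pairSet σ) =
      (({σ : Perm (Fin (2 * r + 1)) | pairSet σ = pairSet 1} : Finset _).card : ℝ) *
        ∑ A ∈ (orderedPerms r).image pairSet, f A := by
  classical
  rw [Finset.sum_comp f pairSet, Finset.mul_sum]
  refine Finset.sum_congr rfl fun A hA => ?_
  obtain ⟨σ, hσ, rfl⟩ := Finset.mem_image.1 hA
  rw [nsmul_eq_mul]
  congr 2
  refine Finset.card_nbij' (fun τ => σ⁻¹ * τ) (fun τ => σ * τ) ?_ ?_ (by simp [Set.LeftInvOn])
    (by simp [Set.LeftInvOn])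
  · intro τ hτ
    have h := (Finset.mem_filter.1 hτ).2
    refine Finset.mem_filter.2 ⟨Finset.mem_univ _, (pairSet_mul_eq_iff σ _).1 ?_⟩
    rw [mul_inv_cancel_left]
    exact h
  · intro τ hτ
    have h := (pairSet_mul_eq_iff σ τ).2 (Finset.mem_filter.1 hτ).2
    refine Finset.mem_filter.2 ⟨mem_orderedPerms.2 fun m => ?_, h⟩
    have : ((σ * τ) (evenIdx m), (σ * τ) (oddIdx m)) ∈ pairSet (σ * τ) := mem_pairSet.2 ⟨m, rfl⟩
    rw [h, mem_pairSet] at this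
    obtain ⟨n, hn⟩ := this
    obtain ⟨h1, h2⟩ := Prod.mk.inj hn
    beta_reduce
    rw [← h1, ← h2]
    exact mem_orderedPerms.1 hσ n

end Matchings

/-! ### The Weyl group of type A and permutations of the coordinates -/

section TypeARoots

open Equiv Equiv.Perm

theorem diffVec_apply {k : ℕ} (i j a : Fin k) :
    diffVec i j a = (if a = i then 1 else 0) - (if a = j then (1 : ℝ) else 0) := by
  simp [diffVec]

theorem diffVec_mem {k : ℕ} {V : Submodule ℝ (EuclideanSpace ℝ (Fin k))}
    (hV : V = ⊤ ∨ V = sumZero k) (i j : Fin k) : diffVec i j ∈ V := by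
  rcases hV with rfl | rfl
  · trivial
  · change ∑ a, diffVec i j a = 0
    simp [diffVec_apply]

variable {k : ℕ} {V : Submodule ℝ (EuclideanSpace ℝ (Fin k))} (hV : ∀ i j, diffVec i j ∈ V)

/-- The vector `e_i - e_j` as an element of the subspace `V`. -/
noncomputable def root (i j : Fin k) : V := ⟨diffVec i j, hV i j⟩

theorem inner_root (x : V) (i j : Fin k) :
    inner ℝ x (root hV i j) =
      (x : EuclideanSpace ℝ (Fin k)) i - (x : EuclideanSpace ℝ (Fin k)) j := by
  rw [Submodule.coe_inner]
  simp [root, diffVec, inner_sub_right, EuclideanSpace.inner_single_right]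

theorem root_apply (i j a : Fin k) :
    (root hV i j : EuclideanSpace ℝ (Fin k)) a =
      (if a = i then 1 else 0) - (if a = j then (1 : ℝ) else 0) :=
  diffVec_apply i j a

theorem inner_root_self {i j : Fin k} (hij : i ≠ j) :
    inner ℝ (root hV i j) (root hV i j) = (2 : ℝ) := by
  rw [inner_root, root_apply, root_apply]
  simp [hij, hij.symm]
  norm_num

theorem inner_root_root_eq_zero {i j i' j' : Fin k} (h1 : i' ≠ i) (h2 : i' ≠ j) (h3 : j' ≠ i)
    (h4 : j' ≠ j) : inner ℝ (root hV i j) (root hV i' j') = (0 : ℝ) := by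
  rw [inner_root, root_apply, root_apply]
  simp [h1, h2, h3, h4]

theorem root_injective {i j i' j' : Fin k} (hij : i ≠ j) (h : root hV i j = root hV i' j') :
    i = i' ∧ j = j' := by
  have h1 : ∀ a, (root hV i j : EuclideanSpace ℝ (Fin k)) a =
      (root hV i' j' : EuclideanSpace ℝ (Fin k)) a := fun a => by rw [h]
  simp only [root_apply] at h1
  have hi := h1 i
  have hj := h1 j
  simp only [hij, hij.symm, if_true, if_false] at hi hj
  constructor
  · by_contra hne
    rw [if_neg hne] at hi
    split_ifs at hi <;> norm_num at hi
  · by_contra hne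
    rw [if_neg hne] at hj
    split_ifs at hj <;> norm_num at hj

theorem mem_posRootsA {α : V} : α ∈ posRootsA V ↔ ∃ i j : Fin k, i < j ∧ α = root hV i j := by
  simp only [posRootsA, Set.mem_ofPred_eq, Subtype.ext_iff, root]

theorem affRefl_root_mem {i j : Fin k} (hij : i < j) (n : ℤ) :
    affRefl (root hV i j, n) ∈ affineWeylGroup (posRootsA V) :=
  Subgroup.subset_closure ⟨(root hV i j, n), ⟨(mem_posRootsA hV).2 ⟨i, j, hij, rfl⟩, trivial⟩, rfl⟩

theorem affRefl_root_apply {i j : Fin k} (hij : i ≠ j) (n : ℤ) (y : V) (a : Fin k) :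
    (affRefl (root hV i j, n) y : EuclideanSpace ℝ (Fin k)) a =
      (y : EuclideanSpace ℝ (Fin k)) (swap i j a) +
        n * ((if a = i then 1 else 0) - (if a = j then (1 : ℝ) else 0)) := by
  rw [affRefl_apply_of_inner_self (inner_root_self hV hij), inner_root]
  simp only [Submodule.coe_sub, Submodule.coe_smul, PiLp.sub_apply, PiLp.smul_apply, smul_eq_mul,
    root_apply]
  rcases eq_or_ne a i with rfl | hi
  · rw [swap_apply_left, if_pos rfl, if_neg hij]; ring
  · rcases eq_or_ne a j with rfl | hj
    · rw [swap_apply_right, if_neg hi, if_pos rfl]; ring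
    · rw [swap_apply_of_ne_of_ne hi hj, if_neg hi, if_neg hj]; ring

theorem rootRefl_root_apply {i j : Fin k} (hij : i ≠ j) (y : V) (a : Fin k) :
    (rootRefl (root hV i j) y : EuclideanSpace ℝ (Fin k)) a =
      (y : EuclideanSpace ℝ (Fin k)) (swap i j a) := by
  have h1 : rootRefl (root hV i j) y = affRefl (root hV i j, 0) y := by
    rw [rootRefl_apply, affRefl_apply, affEval]
    simp
  rw [h1, affRefl_root_apply hV hij]
  simp

/-- A linear isometry of `V` acts by the permutation `σ` of the coordinates. -/
def ActsBy (w : V ≃ₗᵢ[ℝ] V) (σ : Perm (Fin k)) : Prop :=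
  ∀ (x : V) (a : Fin k), (w x : EuclideanSpace ℝ (Fin k)) (σ a) = (x : EuclideanSpace ℝ (Fin k)) a

theorem ActsBy.mul {w w' : V ≃ₗᵢ[ℝ] V} {σ σ' : Perm (Fin k)} (h : ActsBy w σ) (h' : ActsBy w' σ') :
    ActsBy (w * w') (σ * σ') := fun x a => by
  rw [mul_apply]
  exact (h (w' x) (σ' a)).trans (h' x a)

theorem ActsBy.inv {w : V ≃ₗᵢ[ℝ] V} {σ : Perm (Fin k)} (h : ActsBy w σ) : ActsBy w⁻¹ σ⁻¹ :=
  fun x a => by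
  have := h (w⁻¹ x) (σ⁻¹ a)
  rw [← mul_apply, mul_inv_cancel, one_apply] at this
  rw [← this, show w (w⁻¹ x) = x from w.apply_symm_apply x]

theorem actsBy_rootRefl {i j : Fin k} (hij : i ≠ j) :
    ActsBy (rootRefl (root hV i j)) (swap i j) := fun x a => by
  rw [rootRefl_root_apply hV hij, swap_apply_self]

theorem det_rootRefl {E : Type*} [NormedAddCommGroup E] [InnerProductSpace ℝ E]
    [FiniteDimensional ℝ E] {α : E} (hα : α ≠ 0) :
    LinearMap.det ((rootRefl α).toLinearEquiv : E →ₗ[ℝ] E) = -1 := by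
  have := (Submodule.span ℝ {α})ᗮ.det_reflection
  rw [Submodule.orthogonal_orthogonal, finrank_span_singleton hα, pow_one] at this
  exact this

theorem root_ne_zero {i j : Fin k} (hij : i ≠ j) : root hV i j ≠ 0 := fun h => by
  have := inner_root_self hV hij
  rw [h, inner_zero_left] at this
  norm_num at this

theorem exists_actsBy (hV : ∀ i j, diffVec i j ∈ V) {w : V ≃ₗᵢ[ℝ] V}
    (hw : w ∈ weylGroup (posRootsA V)) :
    ∃ σ : Perm (Fin k), ActsBy w σ ∧
      LinearMap.det (w.toLinearEquiv : V →ₗ[ℝ] V) = ((sign σ : ℤ) : ℝ) := by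
  induction hw using Subgroup.closure_induction with
  | mem w hw =>
    obtain ⟨α, hα, rfl⟩ := hw
    obtain ⟨i, j, hij, rfl⟩ := (mem_posRootsA hV).1 hα
    refine ⟨swap i j, actsBy_rootRefl hV hij.ne, ?_⟩
    rw [det_rootRefl (root_ne_zero hV hij.ne), sign_swap hij.ne]
    simp
  | one =>
    refine ⟨1, fun x a => rfl, ?_⟩
    have : ((1 : V ≃ₗᵢ[ℝ] V).toLinearEquiv : V →ₗ[ℝ] V) = LinearMap.id := rfl
    rw [this]
    simp
  | mul w w' _ _ h h' =>
    obtain ⟨σ, hσ, hd⟩ := h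
    obtain ⟨σ', hσ', hd'⟩ := h'
    refine ⟨σ * σ', hσ.mul hσ', ?_⟩
    have : ((w * w').toLinearEquiv : V →ₗ[ℝ] V) =
        (w.toLinearEquiv : V →ₗ[ℝ] V) * (w'.toLinearEquiv : V →ₗ[ℝ] V) := rfl
    rw [this, map_mul, hd, hd', Perm.sign_mul]
    simp
  | inv w _ h =>
    obtain ⟨σ, hσ, hd⟩ := h
    refine ⟨σ⁻¹, hσ.inv, ?_⟩
    have h1 : ((w⁻¹).toLinearEquiv : V →ₗ[ℝ] V) * (w.toLinearEquiv : V →ₗ[ℝ] V) = 1 := by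
      ext x : 1
      exact w.symm_apply_apply x
    have h2 := congrArg LinearMap.det h1
    rw [map_mul, hd, map_one] at h2
    rw [sign_inv]
    rcases Int.units_eq_one_or (sign σ) with h | h <;> simp only [h] at h2 ⊢ <;>
      push_cast at h2 ⊢ <;> linarith

theorem exists_mem_weylGroup (hV : ∀ i j, diffVec i j ∈ V) (σ : Perm (Fin k)) :
    ∃ w ∈ weylGroup (posRootsA V), ActsBy w σ := by
  induction σ using swap_induction_on with
  | one => exact ⟨1, Subgroup.one_mem _, fun x a => rfl⟩
  | swap_mul σ i j hij ih =>
    obtain ⟨w, hw, h⟩ := ih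
    have hgen : ∀ i j : Fin k, i < j → rootRefl (root hV i j) ∈ weylGroup (posRootsA V) :=
      fun i j hij => Subgroup.subset_closure ⟨_, (mem_posRootsA hV).2 ⟨i, j, hij, rfl⟩, rfl⟩
    rcases hij.lt_or_gt with hlt | hlt
    · exact ⟨_, Subgroup.mul_mem _ (hgen i j hlt) hw, (actsBy_rootRefl hV hij).mul h⟩
    · refine ⟨_, Subgroup.mul_mem _ (hgen j i hlt) hw, ?_⟩
      rw [swap_comm]
      exact (actsBy_rootRefl hV hij.symm).mul h

theorem ActsBy.apply_root {w : V ≃ₗᵢ[ℝ] V} {σ : Perm (Fin k)} (h : ActsBy w σ) (i j : Fin k) :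
    w (root hV i j) = root hV (σ i) (σ j) := by
  apply Subtype.ext
  ext b
  have h1 := h (root hV i j) (σ⁻¹ b)
  rw [← mul_apply, mul_inv_cancel, one_apply] at h1
  rw [h1, root_apply, root_apply]
  simp only [inv_eq_iff_eq]

end TypeARoots

section Family

open Equiv Equiv.Perm

variable {r : ℕ} {V : Submodule ℝ (EuclideanSpace ℝ (Fin (2 * r + 1)))}
  (hV : ∀ i j, diffVec i j ∈ V)

/-- The set of the vectors `e_i - e_j` for the pairs `(i, j)` in a finite set. -/
noncomputable def rootSet (A : Finset (Fin (2 * r + 1) × Fin (2 * r + 1))) : Set V :=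
  (fun p => root hV p.1 p.2) '' (A : Set (Fin (2 * r + 1) × Fin (2 * r + 1)))

theorem rootSet_pairSet (σ : Perm (Fin (2 * r + 1))) :
    rootSet hV (pairSet σ) = Set.range fun m : Fin r => root hV (σ (evenIdx m)) (σ (oddIdx m)) := by
  ext α
  simp [rootSet, pairSet]

theorem rootSet_pairSet_injective {σ τ : Perm (Fin (2 * r + 1))}
    (h : rootSet hV (pairSet σ) = rootSet hV (pairSet τ)) : pairSet σ = pairSet τ := by
  refine Finset.eq_of_subset_of_card_le (fun p hp => ?_) (by rw [card_pairSet, card_pairSet])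
  obtain ⟨m, rfl⟩ := mem_pairSet.1 hp
  have h1 : root hV (σ (evenIdx m)) (σ (oddIdx m)) ∈ rootSet hV (pairSet σ) := by
    rw [rootSet_pairSet]; exact ⟨m, rfl⟩
  rw [h, rootSet_pairSet] at h1
  obtain ⟨n, hn⟩ := h1
  obtain ⟨h2, h3⟩ := root_injective hV (σ.injective.ne (evenIdx_ne_oddIdx m m)) hn.symm
  exact mem_pairSet.2 ⟨n, by rw [h2, h3]⟩

theorem baseSetA_eq : baseSetA V = rootSet hV (pairSet 1) := by
  rw [rootSet_pairSet]
  ext α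
  simp only [baseSetA, Set.mem_ofPred_eq, Set.mem_range, coe_one, id_eq]
  constructor
  · rintro ⟨m, i, j, hi, hj, hα⟩
    have hm : m < r := by have := j.2; omega
    refine ⟨⟨m, hm⟩, Subtype.ext ?_⟩
    rw [hα]
    have hi' : i = evenIdx ⟨m, hm⟩ := Fin.ext hi
    have hj' : j = oddIdx ⟨m, hm⟩ := Fin.ext hj
    rw [hi', hj']
    rfl
  · rintro ⟨m, rfl⟩
    exact ⟨m, evenIdx m, oddIdx m, rfl, rfl, rfl⟩

theorem ActsBy.image_baseSetA {w : V ≃ₗᵢ[ℝ] V} {σ : Perm (Fin (2 * r + 1))} (h : ActsBy w σ) :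
    w '' baseSetA V = rootSet hV (pairSet σ) := by
  rw [baseSetA_eq hV, rootSet_pairSet, rootSet_pairSet, ← Set.range_comp]
  congr 1
  ext m : 1
  exact h.apply_root hV _ _

theorem rootSet_subset_posRootsA_iff (σ : Perm (Fin (2 * r + 1))) :
    rootSet hV (pairSet σ) ⊆ posRootsA V ↔ σ ∈ orderedPerms r := by
  rw [rootSet_pairSet, mem_orderedPerms, Set.range_subset_iff]
  refine forall_congr' fun m => ?_
  rw [mem_posRootsA hV]
  constructor
  · rintro ⟨i, j, hij, h⟩
    obtain ⟨h1, h2⟩ := root_injective hV (σ.injective.ne (evenIdx_ne_oddIdx m m)) h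
    rwa [h1, h2]
  · exact fun h => ⟨_, _, h, rfl⟩

theorem familyA_eq : familyA V = rootSet hV '' ((orderedPerms r).image pairSet : Finset _) := by
  ext A
  simp only [familyA, signedSets, Set.mem_ofPred_eq, Finset.coe_image, Set.mem_image,
    Finset.mem_coe, exists_exists_and_eq_and]
  constructor
  · rintro ⟨w, hw, hpos, rfl⟩
    obtain ⟨σ, hσ, -⟩ := exists_actsBy hV hw
    rw [hσ.image_baseSetA hV] at hpos ⊢
    exact ⟨σ, (rootSet_subset_posRootsA_iff hV σ).1 hpos, rfl⟩
  · rintro ⟨σ, hσ, rfl⟩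
    obtain ⟨w, hw, h⟩ := exists_mem_weylGroup hV σ
    refine ⟨w, hw, ?_, h.image_baseSetA hV⟩
    rw [h.image_baseSetA hV]
    exact (rootSet_subset_posRootsA_iff hV σ).2 hσ

/-- The sign of a set of the family does not depend on the element of the Weyl group used. -/
theorem signA_rootSet (σ : Perm (Fin (2 * r + 1))) :
    signA V (rootSet hV (pairSet σ)) = ((sign σ : ℤ) : ℝ) := by
  have hex : ∃ w ∈ weylGroup (posRootsA V), w '' baseSetA V = rootSet hV (pairSet σ) := by
    obtain ⟨w, hw, h⟩ := exists_mem_weylGroup hV σ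
    exact ⟨w, hw, h.image_baseSetA hV⟩
  rw [signA, setSign, dif_pos hex]
  obtain ⟨hw, hwI⟩ := hex.choose_spec
  obtain ⟨τ, hτ, hd⟩ := exists_actsBy hV hw
  rw [hd]
  rw [hτ.image_baseSetA hV] at hwI
  have h1 := rootSet_pairSet_injective hV hwI
  have h2 : pairSet (σ * (σ⁻¹ * τ)) = pairSet σ := by rw [mul_inv_cancel_left, h1]
  have h3 := sign_eq_one_of_pairSet_eq ((pairSet_mul_eq_iff σ _).1 h2)
  rw [Perm.sign_mul, sign_inv] at h3
  have h4 : sign τ = sign σ := by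
    have := congrArg (sign σ * ·) h3
    simpa [← mul_assoc, Int.units_mul_self] using this
  rw [h4]

/-- The sum over the family as an average over ordered permutations: each set of the family belongs
to as many of them as there are permutations of the pairs `(2 m, 2 m + 1)`. -/
theorem card_mul_finsum_familyA (S : Set V → ℝ) :
    (({σ : Perm (Fin (2 * r + 1)) | pairSet σ = pairSet 1} : Finset _).card : ℝ) *
      ∑ᶠ A ∈ familyA V, S A = ∑ σ ∈ orderedPerms r, S (rootSet hV (pairSet σ)) := by
  rw [sum_pairSet_orderedPerms (f := fun A => S (rootSet hV A)), familyA_eq hV,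
    finsum_mem_image ?_, finsum_mem_coe_finset]
  intro A hA B hB h
  obtain ⟨σ, -, rfl⟩ := Finset.mem_image.1 (Finset.mem_coe.1 hA)
  obtain ⟨τ, -, rfl⟩ := Finset.mem_image.1 (Finset.mem_coe.1 hB)
  exact rootSet_pairSet_injective hV h

end Family

/-! ### The sums over lattice points -/

section Lattice

variable {V : Type*} [NormedAddCommGroup V] [InnerProductSpace ℝ V] {ι : Type*} [Fintype ι]
  {β : ι → V}

/-- For orthogonal roots `β i` of squared norm `2`, the vector of their span with inner products
`n i`. -/
noncomputable def latticePoint (β : ι → V) (n : ι → ℤ) : V := ∑ i, ((n i : ℝ) / 2) • β i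

theorem inner_latticePoint (hβ : ∀ i, inner ℝ (β i) (β i) = (2 : ℝ))
    (hort : ∀ i j, i ≠ j → inner ℝ (β i) (β j) = (0 : ℝ)) (n : ι → ℤ) (j : ι) :
    inner ℝ (latticePoint β n) (β j) = (n j : ℝ) := by
  rw [latticePoint, sum_inner, Finset.sum_eq_single j]
  · rw [inner_smul_left, hβ]; simp
  · intro i _ hij
    rw [inner_smul_left, hort i j hij, mul_zero]
  · simp

theorem latticePoint_injective (hβ : ∀ i, inner ℝ (β i) (β i) = (2 : ℝ))
    (hort : ∀ i j, i ≠ j → inner ℝ (β i) (β j) = (0 : ℝ)) :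
    Function.Injective (latticePoint β) := fun n m h => by
  ext i
  have h1 := inner_latticePoint hβ hort n i
  rw [h, inner_latticePoint hβ hort m i] at h1
  exact_mod_cast h1.symm

theorem mem_latticeE_iff (hβ : ∀ i, inner ℝ (β i) (β i) = (2 : ℝ))
    (hort : ∀ i j, i ≠ j → inner ℝ (β i) (β j) = (0 : ℝ)) (v : V) :
    v ∈ latticeE (Set.range β) ↔ ∃ n : ι → ℤ, latticePoint β n = v := by
  constructor
  · rintro ⟨hv, hn⟩
    choose n hn using fun i => hn (β i) ⟨i, rfl⟩
    refine ⟨n, ?_⟩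
    have hspan : latticePoint β n ∈ Submodule.span ℝ (Set.range β) :=
      Submodule.sum_mem _ fun i _ => Submodule.smul_mem _ _ (Submodule.subset_span ⟨i, rfl⟩)
    have horth : ∀ u ∈ Submodule.span ℝ (Set.range β),
        inner ℝ (latticePoint β n - v) u = (0 : ℝ) := by
      intro u hu
      induction hu using Submodule.span_induction with
      | mem u hu =>
        obtain ⟨i, rfl⟩ := hu
        rw [inner_sub_left, inner_latticePoint hβ hort, hn, sub_self]
      | zero => exact inner_zero_right _
      | add a b _ _ ha hb => rw [inner_add_right, ha, hb, add_zero]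
      | smul c a _ ha => rw [inner_smul_right, ha, mul_zero]
    exact sub_eq_zero.1 (inner_self_eq_zero.1 (horth _ (Submodule.sub_mem _ hspan hv)))
  · rintro ⟨n, rfl⟩
    refine ⟨Submodule.sum_mem _ fun i _ =>
      Submodule.smul_mem _ _ (Submodule.subset_span ⟨i, rfl⟩), ?_⟩
    rintro _ ⟨i, rfl⟩
    exact ⟨n i, inner_latticePoint hβ hort n i⟩

theorem latticeNorm_latticePoint [Nonempty ι] (hβ : ∀ i, inner ℝ (β i) (β i) = (2 : ℝ))
    (hort : ∀ i j, i ≠ j → inner ℝ (β i) (β j) = (0 : ℝ)) (n : ι → ℤ) :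
    latticeNorm (Set.range β) (latticePoint β n) =
      ((Finset.univ.sup fun i => (n i).natAbs : ℕ) : ℝ) := by
  have habs : ∀ i, |(inner ℝ (latticePoint β n) (β i) : ℝ)| = ((n i).natAbs : ℝ) := fun i => by
    rw [inner_latticePoint hβ hort, Nat.cast_natAbs, Int.cast_abs]
  have hne : Nonempty (Set.range β) := (Set.range_nonempty β).to_subtype
  apply le_antisymm
  · refine ciSup_le ?_
    rintro ⟨_, i, rfl⟩
    rw [habs]
    exact_mod_cast Finset.le_sup (f := fun i => (n i).natAbs) (Finset.mem_univ i)
  · obtain ⟨i, -, hi⟩ := Finset.exists_mem_eq_sup Finset.univ Finset.univ_nonempty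
      fun i => (n i).natAbs
    rw [hi, ← habs]
    have hfin : Finite (Set.range β) := Set.finite_range β
    exact le_ciSup (f := fun b : Set.range β => |(inner ℝ (latticePoint β n) (b : V) : ℝ)|)
      (Set.finite_range _).bddAbove ⟨β i, i, rfl⟩

theorem latticeSign_latticePoint (hβ : ∀ i, inner ℝ (β i) (β i) = (2 : ℝ))
    (hort : ∀ i j, i ≠ j → inner ℝ (β i) (β j) = (0 : ℝ)) (n : ι → ℤ) :
    latticeSign (Set.range β) (latticePoint β n) = ∏ i, levelSign (n i) := by
  classical
  have hinj : Function.Injective β := fun i j h => by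
    by_contra hij
    have := hort i j hij
    rw [← h, hβ] at this
    norm_num at this
  have hset : {b ∈ Set.range β | 0 < (inner ℝ (latticePoint β n) b : ℝ)} =
      β '' ({i | 0 < n i} : Finset ι) := by
    ext b
    constructor
    · rintro ⟨⟨i, rfl⟩, hi⟩
      rw [inner_latticePoint hβ hort] at hi
      exact ⟨i, by simpa using hi, rfl⟩
    · rintro ⟨i, hi, rfl⟩
      refine ⟨⟨i, rfl⟩, ?_⟩
      rw [inner_latticePoint hβ hort]
      simpa using hi
  rw [latticeSign, hset, Set.ncard_image_of_injective _ hinj, Set.ncard_coe_finset]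
  simp only [levelSign]
  rw [Finset.prod_ite, Finset.prod_const, Finset.prod_const_one, mul_one]

end Lattice

theorem measureReal_eq_integral {Ω : Type*} [MeasurableSpace Ω] {μ : Measure Ω} {s : Set Ω}
    {F : Ω → ℝ} (hF : AEStronglyMeasurable F μ) (h : ∀ᵐ ω ∂μ, F ω = s.indicator 1 ω) :
    μ.real s = ∫ ω, F ω ∂μ := by
  have hs : NullMeasurableSet s μ := by
    have h1 : NullMeasurableSet (F ⁻¹' {1}) μ :=
      hF.aemeasurable.nullMeasurable (measurableSet_singleton 1)
    refine h1.congr ?_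
    filter_upwards [h] with ω hω
    apply propext
    change F ω = 1 ↔ ω ∈ s
    rw [hω]
    by_cases hs : ω ∈ s <;> simp [hs]
  rw [integral_congr_ae h, integral_indicator₀ hs]
  simp

theorem lt_hitTime_iff {V : Type*} [NormedAddCommGroup V] [InnerProductSpace ℝ V] {γ : ℝ≥0 → V}
    (hγ : Continuous γ) (b v : V) (t : ℝ≥0) :
    t < hitTime b v γ ↔ ¬ Hits t (fun s => inner ℝ (γ s) b) (inner ℝ v b) := by
  have hl : Continuous fun y : V => (inner ℝ y b : ℝ) := by fun_prop
  rw [hits_iff (f := fun s => (inner ℝ (γ s) b : ℝ)) (hl.comp hγ), not_le]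
  rfl

section LatticeSums

variable {V Ω : Type*} [NormedAddCommGroup V] [InnerProductSpace ℝ V] [MeasurableSpace V]
  [BorelSpace V] [MeasurableSpace Ω]
  {G : Subgroup (V ≃ᵃⁱ[ℝ] V)} {X : ℝ≥0 → Ω → V} {P : V → Measure Ω}

theorem IsReflectable.measureReal_setHitTime (hX : IsReflectable G X P) (x : V) {ι : Type*}
    [Fintype ι] (β : ι → V) (v : V) (t : ℝ≥0) :
    (P x).real {ω | (t : ℝ≥0∞) < setHitTime (Set.range β) v fun s => X s ω} =
      ∫ ω, ∏ i, miss t (fun s => inner ℝ (X s ω) (β i)) (inner ℝ v (β i)) ∂(P x) := by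
  have hl : ∀ i, Continuous fun y : V => (inner ℝ y (β i) : ℝ) := fun i => by fun_prop
  have hm : PathMeasurable fun γ : ℝ≥0 → V =>
      ∏ i, miss t (fun s => inner ℝ (γ s) (β i)) (inner ℝ v (β i)) :=
    Finset.measurable_fun_prod _ fun i _ => pathMeasurable_miss (hl i) (hl i).measurable t _
  refine measureReal_eq_integral (hm.aestronglyMeasurable hX.measurable (hX.continuous_paths x)) ?_
  filter_upwards [hX.continuous_paths x] with ω hω
  have hiff : (t : ℝ≥0∞) < setHitTime (Set.range β) v (fun s => X s ω) ↔
      ∀ i, ¬ Hits t (fun s => inner ℝ (X s ω) (β i)) (inner ℝ v (β i)) := by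
    rw [setHitTime, iInf_range, ← Finset.inf_univ_eq_iInf, Finset.lt_inf_iff ENNReal.coe_lt_top]
    simp only [Finset.mem_univ, true_imp_iff, lt_hitTime_iff hω]
  by_cases h : (t : ℝ≥0∞) < setHitTime (Set.range β) v (fun s => X s ω)
  · rw [Set.indicator_of_mem (by exact h)]
    rw [Finset.prod_congr rfl fun i _ => miss_eq_one (hiff.1 h i)]
    simp
  · rw [Set.indicator_of_notMem (by exact h)]
    have h' := mt hiff.2 h
    push Not at h'
    obtain ⟨i, hi⟩ := h'
    exact Finset.prod_eq_zero (Finset.mem_univ i) (miss_eq_zero hi)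

/-- The partial sum over the lattice points of norm less than `N` is the expectation of a product of
level sums. -/
theorem IsReflectable.sum_lattice (hX : IsReflectable G X P) (x : V) {ι : Type*}
    [Fintype ι] [Nonempty ι] {β : ι → V} (hβ : ∀ i, inner ℝ (β i) (β i) = (2 : ℝ))
    (hort : ∀ i j, i ≠ j → inner ℝ (β i) (β j) = (0 : ℝ)) (t : ℝ≥0) (ε : ℝ) (N : ℕ) :
    ∑ n ∈ Finset.range N, ∑ᶠ v ∈ {v : V | v ∈ latticeE (Set.range β) ∧
        latticeNorm (Set.range β) v = n}, ε * latticeSign (Set.range β) v *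
          (P x).real {ω | (t : ℝ≥0∞) < setHitTime (Set.range β) v (fun s => X s ω)} =
      ε * ∫ ω, ∏ i, levelSum N t (fun s => inner ℝ (X s ω) (β i)) ∂(P x) := by
  classical
  have := hX.isProbabilityMeasure x
  have hl : ∀ i, Continuous fun y : V => (inner ℝ y (β i) : ℝ) := fun i => by fun_prop
  let B : Finset (ι → ℤ) := Fintype.piFinset fun _ => Finset.Ioo (-(N : ℤ)) N
  let nrm : (ι → ℤ) → ℕ := fun n => Finset.univ.sup fun i => (n i).natAbs
  have hB : ∀ n : ι → ℤ, n ∈ B ↔ nrm n < N := by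
    intro n
    simp only [B, nrm, Fintype.mem_piFinset, Finset.mem_Ioo]
    constructor
    · intro h
      have hN : 0 < N := by
        obtain ⟨i⟩ := ‹Nonempty ι›
        have := h i
        omega
      refine (Finset.sup_lt_iff hN).2 fun i _ => ?_
      have := h i
      omega
    · intro h i
      have := (Finset.le_sup (f := fun i => (n i).natAbs) (Finset.mem_univ i)).trans_lt h
      omega
  let g : V → ℝ := fun v => ε * latticeSign (Set.range β) v *
    (P x).real {ω | (t : ℝ≥0∞) < setHitTime (Set.range β) v (fun s => X s ω)}
  have h1 : ∀ m ∈ Finset.range N, ∑ᶠ v ∈ {v : V | v ∈ latticeE (Set.range β) ∧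
      latticeNorm (Set.range β) v = m}, g v = ∑ n ∈ B with nrm n = m, g (latticePoint β n) := by
    intro m hm
    have hset : {v : V | v ∈ latticeE (Set.range β) ∧ latticeNorm (Set.range β) v = m} =
        latticePoint β '' (({n ∈ B | nrm n = m} : Finset (ι → ℤ)) : Set (ι → ℤ)) := by
      ext v
      simp only [Set.mem_ofPred_eq, mem_latticeE_iff hβ hort, Set.mem_image, Finset.mem_coe,
        Finset.mem_filter]
      constructor
      · rintro ⟨⟨n, rfl⟩, hn⟩
        rw [latticeNorm_latticePoint hβ hort] at hn
        have hn' : nrm n = m := by exact_mod_cast hn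
        exact ⟨n, ⟨(hB n).2 (hn' ▸ Finset.mem_range.1 hm), hn'⟩, rfl⟩
      · rintro ⟨n, ⟨-, hn⟩, rfl⟩
        refine ⟨⟨n, rfl⟩, ?_⟩
        rw [latticeNorm_latticePoint hβ hort]
        exact_mod_cast hn
    rw [hset, finsum_mem_image (latticePoint_injective hβ hort).injOn, finsum_mem_coe_finset]
  rw [Finset.sum_congr rfl h1, Finset.sum_fiberwise_of_maps_to fun n hn =>
    Finset.mem_range.2 ((hB n).1 hn)]
  have h2 : ∀ n ∈ B, g (latticePoint β n) = ε * ∫ ω, ∏ i, levelSign (n i) *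
      miss t (fun s => inner ℝ (X s ω) (β i)) (n i) ∂(P x) := by
    intro n _
    simp only [g]
    rw [latticeSign_latticePoint hβ hort, hX.measureReal_setHitTime x β, mul_assoc,
      ← integral_const_mul]
    simp only [inner_latticePoint hβ hort, Finset.prod_mul_distrib]
  rw [Finset.sum_congr rfl h2, ← Finset.mul_sum, ← integral_finsetSum]
  · simp only [levelSum, Finset.prod_univ_sum, B]
  · intro n _
    have hm : PathMeasurable fun γ : ℝ≥0 → V =>
        ∏ i, levelSign (n i) * miss t (fun s => inner ℝ (γ s) (β i)) (n i) :=
      Finset.measurable_fun_prod _ fun i _ =>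
        (pathMeasurable_miss (hl i) (hl i).measurable t _).const_mul _
    refine hm.integrable (C := 1) hX.measurable (hX.continuous_paths x) fun γ => ?_
    rw [Finset.abs_prod]
    refine Finset.prod_le_one (fun i _ => abs_nonneg _) fun i _ => ?_
    rw [abs_mul]
    have : |levelSign (n i)| = 1 := by unfold levelSign; split_ifs <;> simp
    rw [this, one_mul]
    exact abs_miss_le _ _ _

end LatticeSums

/-! ### Cancellation at the first wall that is hit -/

/-- If a functional changes sign when the path is reflected in the first of finitely many walls that
it hits by time `t`, then only the paths that hit none of them contribute to its expectation. -/
theorem IsReflectable.integral_eq_setIntegral_of_walls {V Ω : Type*} [NormedAddCommGroup V]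
    [InnerProductSpace ℝ V] [MeasurableSpace V] [BorelSpace V] [SecondCountableTopology V]
    [MeasurableSpace Ω] {G : Subgroup (V ≃ᵃⁱ[ℝ] V)} {X : ℝ≥0 → Ω → V} {P : V → Measure Ω}
    (hX : IsReflectable G X P) (x : V) (t : ℝ≥0) {n : ℕ} {l : Fin n → V → ℝ}
    (hl : ∀ a, Continuous (l a)) (c : Fin n → ℝ) {w : Fin n → V ≃ᵃⁱ[ℝ] V} (hw : ∀ a, w a ∈ G)
    (hfix : ∀ a y, l a y = c a → w a y = y) {Φ : (ℝ≥0 → V) → ℝ} (hΦ : PathMeasurable Φ) {C : ℝ}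
    (hC : ∀ γ, |Φ γ| ≤ C)
    (hanti : ∀ a, ∀ᵐ ω ∂(P x), firstTime {s | l a (X s ω) = c a} ≤ t →
      (∀ b, firstTime {s | l a (X s ω) = c a} ≤ firstTime {s | l b (X s ω) = c b}) →
      Φ (reflectAfter (w a) (firstTime {s | l a (X s ω) = c a}) fun s => X s ω) =
        -Φ fun s => X s ω) :
    ∫ ω, Φ (fun s => X s ω) ∂(P x) =
      ∫ ω in {ω | ∀ a, t < firstTime {s | l a (X s ω) = c a}}, Φ (fun s => X s ω) ∂(P x) := by
  have := hX.isProbabilityMeasure x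
  let T : Fin n → Ω → ℝ≥0∞ := fun a ω => firstTime {s | l a (X s ω) = c a}
  -- The wall `a` is hit first, and it is the first such wall in the enumeration.
  let E : Fin n → Set Ω := fun a =>
    {ω | T a ω ≤ t} ∩ ((⋂ b, {ω | T a ω ≤ T b ω}) ∩ ⋂ b : {b // b < a}, {ω | T a ω < T b ω})
  have hT : ∀ a, IsStopTime (P x) X (T a) := fun a =>
    isStopTime_firstTime (hX.continuous_paths x) (hl a) (c a)
  have hE : ∀ a, IsPriorEvent (P x) X (T a) (E a) := by
    intro a
    refine IsPriorEvent.inter (hT a) (isPriorEvent_le_const (hT a) t) (IsPriorEvent.inter (hT a)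
      ?_ ?_)
    · exact @MeasurableSet.iInter _ _ (priorSpace (hT a)) _ _ fun b =>
        isPriorEvent_le (hT a) (hT b)
    · exact @MeasurableSet.iInter _ _ (priorSpace (hT a)) _ _ fun b =>
        isPriorEvent_lt (hT a) (hT b)
  have hfin : ∀ a, ∀ ω ∈ E a, T a ω < ⊤ := fun a ω hω => hω.1.trans_lt ENNReal.coe_lt_top
  have hE0 : ∀ a, NullMeasurableSet (E a) (P x) := fun a => by
    have := IsPriorEvent.nullMeasurableSet hX.measurable (hE a)
    rwa [Set.inter_eq_left.2 (show E a ⊆ {ω | T a ω < ⊤} from hfin a)] at this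
  have hzero : ∀ a, ∫ ω in E a, Φ (fun s => X s ω) ∂(P x) = 0 := by
    intro a
    refine hX.setIntegral_eq_zero x (hl a) (c a) (hE a) (hfin a) (hw a) (hfix a) hΦ ?_
    filter_upwards [hanti a] with ω hω hωE
    exact hω hωE.1 fun b => Set.mem_iInter.1 hωE.2.1 b
  have hdisj : Pairwise (Function.onFun (AEDisjoint (P x)) E) := by
    have key : ∀ a b, a < b → Disjoint (E a) (E b) := by
      intro a b hab
      rw [Set.disjoint_left]
      intro ω ha hb
      have h1 : T a ω ≤ T b ω := Set.mem_iInter.1 ha.2.1 b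
      have h2 : T b ω < T a ω := Set.mem_iInter.1 hb.2.2 ⟨a, hab⟩
      exact absurd h1 (not_le.2 h2)
    intro a b hab
    rcases hab.lt_or_gt with h | h
    · exact (key a b h).aedisjoint
    · exact (key b a h).symm.aedisjoint
  have hcompl : {ω | ∀ a, t < firstTime {s | l a (X s ω) = c a}}ᶜ = ⋃ a, E a := by
    ext ω
    simp only [Set.mem_compl_iff, Set.mem_ofPred_eq, Set.mem_iUnion]
    push Not
    constructor
    · rintro ⟨a, ha⟩
      have hne : {a | ∀ b, T a ω ≤ T b ω}.Nonempty := by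
        have : Nonempty (Fin n) := ⟨a⟩
        exact Finite.exists_min fun a => T a ω
      obtain ⟨a₀, h₀, hmin⟩ := WellFounded.has_min (wellFounded_lt (α := Fin n)) _ hne
      refine ⟨a₀, (h₀ a).trans ha, Set.mem_iInter.2 h₀, Set.mem_iInter.2 ?_⟩
      rintro ⟨b, hb⟩
      by_contra h
      refine hmin b (fun d => ?_) hb
      exact (not_lt.1 h).trans (h₀ d)
    · rintro ⟨a, ha⟩
      exact ⟨a, ha.1⟩
  have hU : NullMeasurableSet (⋃ a, E a) (P x) := NullMeasurableSet.iUnion hE0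
  have hi : Integrable (fun ω => Φ fun s => X s ω) (P x) :=
    hΦ.integrable hX.measurable (hX.continuous_paths x) hC
  have hsum : ∫ ω in ⋃ a, E a, Φ (fun s => X s ω) ∂(P x) = 0 := by
    rw [integral_iUnion_ae hE0 hdisj hi.integrableOn]
    simp [hzero]
  rw [← compl_compl {ω | ∀ a, t < firstTime {s | l a (X s ω) = c a}}, hcompl,
    ← integral_add_compl₀ hU hi, hsum, zero_add]

/-! ### The matrix of exit values -/

section ExitMatrix

open Equiv

variable {r : ℕ}

/-- The antisymmetric matrix of the exit values of the differences of coordinates of a path. -/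
noncomputable def exitMatrix (t : ℝ≥0) (γ : ℝ≥0 → Fin (2 * r + 1) → ℝ)
    (i j : Fin (2 * r + 1)) : ℝ :=
  if i < j then exitValue t fun s => γ s i - γ s j
  else if j < i then -exitValue t fun s => γ s j - γ s i else 0

theorem exitMatrix_of_lt {t : ℝ≥0} {γ : ℝ≥0 → Fin (2 * r + 1) → ℝ} {i j : Fin (2 * r + 1)}
    (h : i < j) : exitMatrix t γ i j = exitValue t fun s => γ s i - γ s j := if_pos h

theorem exitMatrix_antisymm (t : ℝ≥0) (γ : ℝ≥0 → Fin (2 * r + 1) → ℝ) (i j : Fin (2 * r + 1)) :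
    exitMatrix t γ j i = -exitMatrix t γ i j := by
  unfold exitMatrix
  rcases lt_trichotomy i j with h | rfl | h
  · simp [h, h.not_gt]
  · simp
  · simp [h, h.not_gt]

theorem eq_of_antisymm {k : ℕ} {A B : Fin k → Fin k → ℝ} (hA : ∀ i j, A j i = -A i j)
    (hB : ∀ i j, B j i = -B i j) (h : ∀ i j, i < j → A i j = B i j) : A = B := by
  ext i j
  rcases lt_trichotomy i j with hij | rfl | hij
  · exact h i j hij
  · have h1 := hA i i
    have h2 := hB i i
    linarith
  · rw [hA j i, hB j i, h j i hij]

/-- The differences `y i - y j` with `i < j` all lie in `(0, 1)`. -/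
def InAlcove {k : ℕ} (y : Fin k → ℝ) : Prop := ∀ i j, i < j → y i - y j ∈ Set.Ioo (0 : ℝ) 1

theorem InAlcove.ne_zero {k : ℕ} {y : Fin k → ℝ} (h : InAlcove y) {i j : Fin k} (hij : i < j) :
    y i - y j ≠ 0 := (h i j hij).1.ne'

theorem InAlcove.ne_one {k : ℕ} {y : Fin k → ℝ} (h : InAlcove y) {i j : Fin k} (hij : i < j) :
    y i - y j ≠ 1 := (h i j hij).2.ne

/-- Reflection in a wall `y i = y (i + 1)`: the matrix of exit values is conjugated by a
transposition, since the exit value belonging to the wall itself is `0`. -/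
theorem altSum_exitMatrix_simple {t τ : ℝ≥0} {γ γ' : ℝ≥0 → Fin (2 * r + 1) → ℝ}
    {p q : Fin (2 * r + 1)} (hpq : (q : ℕ) = p + 1) (hbefore : ∀ s < τ, InAlcove (γ s))
    (hbefore' : ∀ s < τ, γ' s = γ s) (hafter : ∀ s, τ ≤ s → ∀ a, γ' s a = γ s (swap p q a))
    (hv : exitValue t (fun s => γ s p - γ s q) = 0)
    (hv' : exitValue t (fun s => γ' s p - γ' s q) = 0) :
    altSum (fun _ : Fin r => exitMatrix t γ') = -altSum fun _ : Fin r => exitMatrix t γ := by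
  have hlt : p < q := by rw [Fin.lt_def]; omega
  rw [← altSum_comp_swap _ hlt.ne]
  congr 1
  ext1
  refine eq_of_antisymm (exitMatrix_antisymm t γ') (fun i j => exitMatrix_antisymm t γ _ _) ?_
  intro a b hab
  by_cases h : a = p ∧ b = q
  · obtain ⟨rfl, rfl⟩ := h
    rw [swap_apply_left, swap_apply_right, exitMatrix_antisymm t γ a b, exitMatrix_of_lt hab,
      exitMatrix_of_lt hab, hv, hv', neg_zero]
  · have hab' := swap_lt_swap hpq hab h
    rw [exitMatrix_of_lt hab, exitMatrix_of_lt hab']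
    refine exitValue_congr (fun s _ => ?_) fun s _ => ?_
    · rcases lt_or_ge s τ with hs | hs
      · rw [hbefore' s hs]
        exact iff_of_false ((hbefore s hs).ne_zero hab) ((hbefore s hs).ne_zero hab')
      · rw [hafter s hs, hafter s hs]
    · rcases lt_or_ge s τ with hs | hs
      · rw [hbefore' s hs]
        exact iff_of_false ((hbefore s hs).ne_one hab) ((hbefore s hs).ne_one hab')
      · rw [hafter s hs, hafter s hs]

/-- Reflection in the wall on which the first and the last coordinate differ by `1`: after a change
of the matrix of exit values that does not affect the alternating sum, it is again conjugated by a
transposition. -/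
theorem altSum_exitMatrix_affine {t τ : ℝ≥0} {γ γ' : ℝ≥0 → Fin (2 * r + 1) → ℝ}
    {p q : Fin (2 * r + 1)} (hp : (p : ℕ) = 0) (hq : (q : ℕ) = 2 * r) (hpq : p < q)
    (hbefore : ∀ s < τ, InAlcove (γ s)) (hbefore' : ∀ s < τ, γ' s = γ s)
    (hafter : ∀ s, τ ≤ s → ∀ a, γ' s a =
      γ s (swap p q a) + ((if a = p then 1 else 0) - (if a = q then (1 : ℝ) else 0)))
    (hv : exitValue t (fun s => γ s p - γ s q) = 2)
    (hv' : exitValue t (fun s => γ' s p - γ' s q) = 2) :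
    altSum (fun _ : Fin r => exitMatrix t γ') = -altSum fun _ : Fin r => exitMatrix t γ := by
  -- Adding `u i - u j` turns the entry `2` at `(p, q)` into `0`, and the other entries `e` of row
  -- `p` and column `q` into `e - 1`, so that the exchange of `e` and `2 - e` becomes a change of sign.
  let u : Fin (2 * r + 1) → ℝ := fun a => (if a = q then 1 else 0) - (if a = p then 1 else 0)
  have hup : u p = -1 := by simp [u, hpq.ne]
  have huq : u q = 1 := by simp [u, hpq.ne']
  have hu : ∀ a, a ≠ p → a ≠ q → u a = 0 := fun a h1 h2 => by simp [u, h1, h2]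
  rw [← altSum_add_sub _ u, ← altSum_add_sub (exitMatrix t γ) u, ← altSum_comp_swap _ hpq.ne]
  congr 1
  ext1
  refine eq_of_antisymm (fun i j => ?_) (fun i j => ?_) ?_
  · rw [exitMatrix_antisymm t γ' i j]; ring
  · rw [exitMatrix_antisymm t γ (swap p q i) (swap p q j)]; ring
  intro a b hab
  have hbp : b ≠ p := by rintro rfl; rw [Fin.lt_def] at hab; omega
  have haq : a ≠ q := by rintro rfl; have := b.2; rw [Fin.lt_def] at hab; omega
  rcases eq_or_ne a p with rfl | hap
  · rcases eq_or_ne b q with rfl | hbq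
    · rw [swap_apply_left, swap_apply_right, exitMatrix_antisymm t γ a b, exitMatrix_of_lt hab,
        exitMatrix_of_lt hab, hv, hv', hup, huq]
      norm_num
    · have hbq' : b < q := by
        have h1 := b.2
        have h2 : (b : ℕ) ≠ q := fun h => hbq (Fin.ext h)
        rw [Fin.lt_def]; omega
      rw [swap_apply_left, swap_apply_of_ne_of_ne hbp hbq, exitMatrix_antisymm t γ b q,
        exitMatrix_of_lt hab, exitMatrix_of_lt hbq', hup, huq, hu b hbp hbq,
        exitValue_swap (g := fun s => γ s b - γ s q)]
      · ring
      · intro s _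
        rcases lt_or_ge s τ with hs | hs
        · rw [hbefore' s hs]
          exact iff_of_false ((hbefore s hs).ne_zero hab) ((hbefore s hs).ne_one hbq')
        · rw [hafter s hs, hafter s hs, swap_apply_left, swap_apply_of_ne_of_ne hbp hbq]
          simp only [if_true, hbp, hbq, haq, if_false]
          constructor <;> intro h <;> linarith
      · intro s _
        rcases lt_or_ge s τ with hs | hs
        · rw [hbefore' s hs]
          exact iff_of_false ((hbefore s hs).ne_one hab) ((hbefore s hs).ne_zero hbq')
        · rw [hafter s hs, hafter s hs, swap_apply_left, swap_apply_of_ne_of_ne hbp hbq]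
          simp only [if_true, hbp, hbq, haq, if_false]
          constructor <;> intro h <;> linarith
  · have hpa : p < a := by
      have h2 : (a : ℕ) ≠ p := fun h => hap (Fin.ext h)
      rw [Fin.lt_def]; omega
    rcases eq_or_ne b q with rfl | hbq
    · rw [swap_apply_right, swap_apply_of_ne_of_ne hap haq, exitMatrix_antisymm t γ p a,
        exitMatrix_of_lt hab, exitMatrix_of_lt hpa, hup, huq, hu a hap haq,
        exitValue_swap (g := fun s => γ s p - γ s a)]
      · ring
      · intro s _
        rcases lt_or_ge s τ with hs | hs
        · rw [hbefore' s hs]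
          exact iff_of_false ((hbefore s hs).ne_zero hab) ((hbefore s hs).ne_one hpa)
        · rw [hafter s hs, hafter s hs, swap_apply_right, swap_apply_of_ne_of_ne hap haq]
          simp only [if_true, hbp, hap, haq, if_false]
          constructor <;> intro h <;> linarith
      · intro s _
        rcases lt_or_ge s τ with hs | hs
        · rw [hbefore' s hs]
          exact iff_of_false ((hbefore s hs).ne_one hab) ((hbefore s hs).ne_zero hpa)
        · rw [hafter s hs, hafter s hs, swap_apply_right, swap_apply_of_ne_of_ne hap haq]
          simp only [if_true, hbp, hap, haq, if_false]
          constructor <;> intro h <;> linarith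
    · rw [swap_apply_of_ne_of_ne hap haq, swap_apply_of_ne_of_ne hbp hbq, hu a hap haq,
        hu b hbp hbq, exitMatrix_of_lt hab, exitMatrix_of_lt hab]
      congr 1
      refine exitValue_congr (fun s _ => ?_) fun s _ => ?_ <;>
      · rcases lt_or_ge s τ with hs | hs
        · rw [hbefore' s hs]
        · rw [hafter s hs, hafter s hs, swap_apply_of_ne_of_ne hap haq,
            swap_apply_of_ne_of_ne hbp hbq]
          simp [hap, haq, hbp, hbq]

/-- The alternating sum of the exit values of a path that stays in the alcove. -/
theorem altSum_exitMatrix_of_inAlcove {t : ℝ≥0} {γ : ℝ≥0 → Fin (2 * r + 1) → ℝ}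
    (h : ∀ s ≤ t, InAlcove (γ s)) :
    altSum (fun _ : Fin r => exitMatrix t γ) =
      2 ^ r * ({σ : Perm (Fin (2 * r + 1)) | pairSet σ = pairSet 1} : Finset _).card := by
  rw [altSum_antisymm (exitMatrix_antisymm t γ), ← sum_sign_orderedPerms]
  congr 1
  refine Finset.sum_congr rfl fun σ hσ => ?_
  rw [Finset.prod_eq_one, mul_one]
  intro m _
  have hm := mem_orderedPerms.1 hσ m
  rw [exitMatrix_of_lt hm]
  exact exitValue_eq_one (fun ⟨s, hs, h0⟩ => (h s hs).ne_zero hm h0)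
    fun ⟨s, hs, h1⟩ => (h s hs).ne_one hm h1

end ExitMatrix

/-! ### The exit from the alcove of type A -/

theorem exitValue_of_exit_zero {t τ : ℝ≥0} {f : ℝ≥0 → ℝ} (hτ : τ ≤ t)
    (hf : ∀ s < τ, f s ∈ Set.Ioo (0 : ℝ) 1) (h : f τ = 0) : exitValue t f = 0 := by
  have h01 : HitsBefore t f 0 1 := by
    refine ⟨τ, hτ, h, fun s hs => ?_⟩
    rcases hs.lt_or_eq with hs | rfl
    · exact (hf s hs).2.ne
    · rw [h]; norm_num
  rw [exitValue, if_neg (not_hitsBefore_of_hitsBefore h01), if_pos h01]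

theorem exitValue_of_exit_one {t τ : ℝ≥0} {f : ℝ≥0 → ℝ} (hτ : τ ≤ t)
    (hf : ∀ s < τ, f s ∈ Set.Ioo (0 : ℝ) 1) (h : f τ = 1) : exitValue t f = 2 := by
  refine if_pos ⟨τ, hτ, h, fun s hs => ?_⟩
  rcases hs.lt_or_eq with hs | rfl
  · exact (hf s hs).1.ne'
  · rw [h]; norm_num

section Walls

variable {r : ℕ}

/-- The pairs `(i, j)` such that the walls of the alcove lie on the hyperplanes on which the
coordinates `i` and `j` differ by an integer: the pairs `(i, i + 1)`, and the pair of the first and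
the last index. -/
def wallPair (a : Fin (2 * r + 1)) : Fin (2 * r + 1) × Fin (2 * r + 1) :=
  Fin.lastCases (0, Fin.last _) (fun m => (m.castSucc, m.succ)) a

/-- The difference of the coordinates on a wall: `0` for the simple roots, and `1` for the highest
root. -/
def wallLevel (a : Fin (2 * r + 1)) : ℤ :=
  Fin.lastCases (motive := fun _ => ℤ) 1 (fun _ => 0) a

@[simp] theorem wallPair_castSucc (m : Fin (2 * r)) :
    wallPair m.castSucc = (m.castSucc, m.succ) := by simp [wallPair]

@[simp] theorem wallPair_last : wallPair (Fin.last (2 * r)) = (0, Fin.last _) := by simp [wallPair]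

@[simp] theorem wallLevel_castSucc (m : Fin (2 * r)) : wallLevel m.castSucc = 0 := by
  simp [wallLevel]

@[simp] theorem wallLevel_last : wallLevel (Fin.last (2 * r)) = 1 := by simp [wallLevel]

theorem wallPair_lt (hr : 0 < r) (a : Fin (2 * r + 1)) : (wallPair a).1 < (wallPair a).2 := by
  induction a using Fin.lastCases with
  | last => simp [Fin.lt_def]; omega
  | cast m => simp [Fin.lt_def]

/-- A path that starts in the alcove stays there as long as it hits no wall. -/
theorem inAlcove_of_not_hits {γ : ℝ≥0 → Fin (2 * r + 1) → ℝ} (hγ : ∀ i, Continuous fun s => γ s i)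
    (h0 : InAlcove (γ 0)) {s : ℝ≥0}
    (h : ∀ a, ¬ Hits s (fun s => γ s (wallPair a).1 - γ s (wallPair a).2) (wallLevel a)) :
    InAlcove (γ s) := by
  have hanti : StrictAnti (γ s) := by
    rw [Fin.strictAnti_iff_succ_lt]
    intro m
    have hm := h m.castSucc
    simp only [wallPair_castSucc, wallLevel_castSucc, Int.cast_zero] at hm
    by_contra hle
    have hc : Continuous fun s => γ s m.castSucc - γ s m.succ := (hγ _).sub (hγ _)
    obtain ⟨u, hu, hu'⟩ := intermediate_value_Icc' (zero_le : (0 : ℝ≥0) ≤ s) hc.continuousOn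
      ⟨sub_nonpos.2 (not_lt.1 hle), (h0 _ _ m.castSucc_lt_succ).1.le⟩
    exact hm ⟨u, hu.2, hu'⟩
  intro i j hij
  have hr : (0 : Fin (2 * r + 1)) < Fin.last (2 * r) :=
    (Fin.zero_le i).trans_lt (hij.trans_le (Fin.le_last j))
  refine ⟨sub_pos.2 (hanti hij), ?_⟩
  have h1 : γ s 0 - γ s (Fin.last (2 * r)) < 1 := by
    have hm := h (Fin.last (2 * r))
    simp only [wallPair_last, wallLevel_last, Int.cast_one] at hm
    by_contra hle
    have hc : Continuous fun s => γ s 0 - γ s (Fin.last (2 * r)) := (hγ _).sub (hγ _)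
    obtain ⟨u, hu, hu'⟩ := intermediate_value_Icc (zero_le : (0 : ℝ≥0) ≤ s) hc.continuousOn
      ⟨(h0 _ _ hr).2.le, not_lt.1 hle⟩
    exact hm ⟨u, hu.2, hu'⟩
  have h2 := hanti.antitone (Fin.zero_le i)
  have h3 := hanti.antitone (Fin.le_last j)
  linarith

variable {V : Submodule ℝ (EuclideanSpace ℝ (Fin (2 * r + 1)))} (hV : ∀ i j, diffVec i j ∈ V)

/-- The root that is constant on a wall. -/
noncomputable def wallRoot (a : Fin (2 * r + 1)) : V := root hV (wallPair a).1 (wallPair a).2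

theorem exitTime_eq (γ : ℝ≥0 → V) : exitTime (affSimpleA V) γ =
    ⨅ a, firstTime {s | (inner ℝ (γ s) (wallRoot hV a) : ℝ) = wallLevel a} := by
  have hsimple : ∀ (m : Fin (2 * r)) (l : V × ℤ),
      (l.1 : EuclideanSpace ℝ (Fin (2 * r + 1))) = diffVec m.castSucc m.succ → l.2 = 0 →
      affHitTime l γ = firstTime {s | (inner ℝ (γ s) (wallRoot hV m.castSucc) : ℝ) =
        wallLevel m.castSucc} := by
    rintro m ⟨α, n⟩ h1 h2
    have hα : α = wallRoot hV m.castSucc := Subtype.ext (by simpa [wallRoot, root] using h1)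
    simp only at h2
    subst hα h2
    simp only [affHitTime, firstTime, affEval, Set.mem_ofPred_eq, wallLevel_castSucc, Int.cast_zero,
      sub_zero, real_inner_comm]
  have haff : ∀ l : V × ℤ,
      (l.1 : EuclideanSpace ℝ (Fin (2 * r + 1))) = -diffVec 0 (Fin.last _) → l.2 = -1 →
      affHitTime l γ = firstTime {s | (inner ℝ (γ s) (wallRoot hV (Fin.last (2 * r))) : ℝ) =
        wallLevel (Fin.last (2 * r))} := by
    rintro ⟨α, n⟩ h1 h2
    have hα : α = -wallRoot hV (Fin.last (2 * r)) :=
      Subtype.ext (by simpa [wallRoot, root] using h1)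
    simp only at h2
    subst hα h2
    have hiff : ∀ s, affEval (-wallRoot hV (Fin.last (2 * r)), -1) (γ s) = 0 ↔
        (inner ℝ (γ s) (wallRoot hV (Fin.last (2 * r))) : ℝ) = 1 := by
      intro s
      rw [affEval, inner_neg_left, real_inner_comm]
      push_cast
      constructor <;> intro h <;> linarith
    simp only [affHitTime, firstTime, hiff, Set.mem_ofPred_eq, wallLevel_last, Int.cast_one]
  apply le_antisymm
  · refine le_iInf fun a => ?_
    induction a using Fin.lastCases with
    | last =>
      have hmem : (-wallRoot hV (Fin.last (2 * r)), (-1 : ℤ)) ∈ affSimpleA V :=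
        Or.inr ⟨0, Fin.last _, rfl, rfl, by simp [wallRoot, root], rfl⟩
      rw [← haff (-wallRoot hV (Fin.last (2 * r)), -1) (by simp [wallRoot, root]) rfl]
      exact iInf₂_le _ hmem
    | cast m =>
      have hmem : (wallRoot hV m.castSucc, (0 : ℤ)) ∈ affSimpleA V :=
        Or.inl ⟨⟨m.castSucc, m.succ, by simp, by simp [wallRoot, root]⟩, rfl⟩
      rw [← hsimple m (wallRoot hV m.castSucc, 0) (by simp [wallRoot, root]) rfl]
      exact iInf₂_le _ hmem
  · refine le_iInf₂ fun l hl => ?_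
    rcases hl with ⟨⟨i, j, hij, hl1⟩, hl2⟩ | ⟨i, j, hi, hj, hl1, hl2⟩
    · have hi : (i : ℕ) < 2 * r := by have := j.2; omega
      have h1 : i = (⟨i, hi⟩ : Fin (2 * r)).castSucc := rfl
      have h2 : j = (⟨i, hi⟩ : Fin (2 * r)).succ := Fin.ext hij.symm
      rw [h1, h2] at hl1
      rw [hsimple ⟨i, hi⟩ l hl1 hl2]
      exact iInf_le _ _
    · have h1 : i = 0 := Fin.ext hi
      have h2 : j = Fin.last (2 * r) := Fin.ext (by simp; omega)
      rw [h1, h2] at hl1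
      rw [haff l hl1 hl2]
      exact iInf_le _ _

/-- The coordinates of a path in `V`. -/
def coords (γ : ℝ≥0 → V) (s : ℝ≥0) (i : Fin (2 * r + 1)) : ℝ :=
  (γ s : EuclideanSpace ℝ (Fin (2 * r + 1))) i

theorem coords_sub (γ : ℝ≥0 → V) (s : ℝ≥0) (i j : Fin (2 * r + 1)) :
    coords γ s i - coords γ s j = inner ℝ (γ s) (root hV i j) := (inner_root hV _ _ _).symm

theorem continuous_coords {γ : ℝ≥0 → V} (hγ : Continuous γ) (i : Fin (2 * r + 1)) :
    Continuous fun s => coords γ s i := by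
  unfold coords
  fun_prop

theorem pathMeasurable_exitMatrix (hV : ∀ i j, diffVec i j ∈ V) (t : ℝ≥0)
    (i j : Fin (2 * r + 1)) : PathMeasurable fun γ : ℝ≥0 → V => exitMatrix t (coords γ) i j := by
  have h : ∀ i j, PathMeasurable fun γ : ℝ≥0 → V =>
      exitValue t fun s => coords γ s i - coords γ s j := by
    intro i j
    have hl : Continuous fun y : V => (inner ℝ y (root hV i j) : ℝ) := by fun_prop
    simp only [coords_sub hV]
    exact pathMeasurable_exitValue hl hl.measurable t
  unfold exitMatrix
  split_ifs
  · exact h i j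
  · exact Measurable.neg (h j i)
  · exact measurable_const

theorem abs_exitMatrix_le (t : ℝ≥0) (γ : ℝ≥0 → Fin (2 * r + 1) → ℝ) (i j : Fin (2 * r + 1)) :
    |exitMatrix t γ i j| ≤ 2 := by
  unfold exitMatrix
  split_ifs
  · rw [abs_of_nonneg (exitValue_nonneg _ _)]; exact exitValue_le _ _
  · rw [abs_neg, abs_of_nonneg (exitValue_nonneg _ _)]; exact exitValue_le _ _
  · simp

theorem abs_sign_mul_prod_exitMatrix_le (t : ℝ≥0) (γ : ℝ≥0 → Fin (2 * r + 1) → ℝ)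
    (σ : Equiv.Perm (Fin (2 * r + 1))) :
    |((Equiv.Perm.sign σ : ℤ) : ℝ) *
      ∏ m : Fin r, exitMatrix t γ (σ (evenIdx m)) (σ (oddIdx m))| ≤ 2 ^ r := by
  have h1 : |((Equiv.Perm.sign σ : ℤ) : ℝ)| = 1 := by
    rcases Int.units_eq_one_or (Equiv.Perm.sign σ) with h | h <;> simp [h]
  rw [abs_mul, h1, one_mul, Finset.abs_prod]
  refine (Finset.prod_le_prod (fun m _ => abs_nonneg _)
    fun m _ => abs_exitMatrix_le t γ _ _).trans_eq ?_
  simp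

theorem pathMeasurable_sign_mul_prod_exitMatrix (hV : ∀ i j, diffVec i j ∈ V) (t : ℝ≥0)
    (σ : Equiv.Perm (Fin (2 * r + 1))) :
    PathMeasurable fun γ : ℝ≥0 → V => ((Equiv.Perm.sign σ : ℤ) : ℝ) *
      ∏ m : Fin r, exitMatrix t (coords γ) (σ (evenIdx m)) (σ (oddIdx m)) :=
  Measurable.const_mul
    (Finset.measurable_fun_prod _ fun _ _ => pathMeasurable_exitMatrix hV t _ _) _

/-- Reflection in the wall of the alcove that is hit first changes the sign of the alternating sum
of the exit values. -/
theorem altSum_exitMatrix_reflectAfter (hr : 0 < r) {t : ℝ≥0} {γ : ℝ≥0 → V} (hγ : Continuous γ)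
    (h0 : InAlcove (coords γ 0)) (a : Fin (2 * r + 1))
    (hat : firstTime {s | (inner ℝ (γ s) (wallRoot hV a) : ℝ) = wallLevel a} ≤ t)
    (hmin : ∀ b, firstTime {s | (inner ℝ (γ s) (wallRoot hV a) : ℝ) = wallLevel a} ≤
      firstTime {s | (inner ℝ (γ s) (wallRoot hV b) : ℝ) = wallLevel b}) :
    altSum (fun _ : Fin r => exitMatrix t (coords (reflectAfter
      (affRefl (wallRoot hV a, wallLevel a))
      (firstTime {s | (inner ℝ (γ s) (wallRoot hV a) : ℝ) = wallLevel a}) γ))) =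
      -altSum fun _ : Fin r => exitMatrix t (coords γ) := by
  have hl : ∀ b, Continuous fun s => (inner ℝ (γ s) (wallRoot hV b) : ℝ) := fun b => by fun_prop
  obtain ⟨τ, hτ, hτ'⟩ := exists_firstTime_eq
    (C := {s | (inner ℝ (γ s) (wallRoot hV a) : ℝ) = wallLevel a})
    (isClosed_eq (hl a) continuous_const) (hat.trans_lt ENNReal.coe_lt_top)
  rw [hτ'] at hat hmin ⊢
  have hτt : τ ≤ t := by exact_mod_cast hat
  have hτa : coords γ τ (wallPair a).1 - coords γ τ (wallPair a).2 = wallLevel a := by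
    rw [coords_sub hV]; exact hτ
  have hlt := wallPair_lt hr a
  have hbefore : ∀ s < τ, InAlcove (coords γ s) := by
    intro s hs
    refine inAlcove_of_not_hits (continuous_coords hγ) h0 fun b hb => ?_
    simp only [coords_sub hV] at hb
    have h1 := (hits_iff (hl b) _).1 hb
    have h2 := (hmin b).trans h1
    exact absurd (by exact_mod_cast h2 : τ ≤ s) (not_le.2 hs)
  generalize hγ' : coords (reflectAfter (affRefl (wallRoot hV a, wallLevel a)) τ γ) = γ'
  have hbefore' : ∀ s < τ, γ' s = coords γ s := by
    intro s hs
    rw [← hγ']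
    have : ¬ ((τ : ℝ≥0∞) ≤ s) := not_le.2 (by exact_mod_cast hs)
    unfold coords
    simp only [reflectAfter, this, if_false]
  have hafter : ∀ s, τ ≤ s → ∀ b, γ' s b =
      coords γ s (Equiv.swap (wallPair a).1 (wallPair a).2 b) + wallLevel a *
        ((if b = (wallPair a).1 then 1 else 0) - (if b = (wallPair a).2 then (1 : ℝ) else 0)) := by
    intro s hs b
    rw [← hγ']
    have : (τ : ℝ≥0∞) ≤ s := by exact_mod_cast hs
    unfold coords
    simp only [reflectAfter, this, if_true]
    exact affRefl_root_apply hV hlt.ne _ _ _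
  have hτa' : γ' τ (wallPair a).1 - γ' τ (wallPair a).2 = wallLevel a := by
    rw [hafter τ le_rfl, hafter τ le_rfl, Equiv.swap_apply_left, Equiv.swap_apply_right]
    simp only [hlt.ne, hlt.ne', if_true, if_false]
    linarith
  have hin : ∀ s < τ, coords γ s (wallPair a).1 - coords γ s (wallPair a).2 ∈ Set.Ioo (0 : ℝ) 1 :=
    fun s hs => hbefore s hs _ _ hlt
  have hin' : ∀ s < τ, γ' s (wallPair a).1 - γ' s (wallPair a).2 ∈ Set.Ioo (0 : ℝ) 1 :=
    fun s hs => by rw [hbefore' s hs]; exact hin s hs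
  clear hγ' hmin hτ hτ'
  induction a using Fin.lastCases with
  | last =>
    simp only [wallPair_last, wallLevel_last, Int.cast_one, one_mul] at *
    exact altSum_exitMatrix_affine rfl rfl hlt hbefore hbefore' hafter
      (exitValue_of_exit_one hτt hin hτa) (exitValue_of_exit_one hτt hin' hτa')
  | cast m =>
    simp only [wallPair_castSucc, wallLevel_castSucc, Int.cast_zero, zero_mul, add_zero] at *
    exact altSum_exitMatrix_simple (by simp) hbefore hbefore' hafter
      (exitValue_of_exit_zero hτt hin hτa) (exitValue_of_exit_zero hτt hin' hτa')

theorem inAlcove_of_mem_alcove (hV : ∀ i j, diffVec i j ∈ V) {x : V}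
    (hx : x ∈ alcove (posRootsA V)) :
    InAlcove fun i => (x : EuclideanSpace ℝ (Fin (2 * r + 1))) i := by
  intro i j hij
  have h := hx (root hV i j) ((mem_posRootsA hV).2 ⟨i, j, hij, rfl⟩)
  rw [inner_root] at h
  exact h

variable {Ω : Type*} [MeasurableSpace Ω] {X : ℝ≥0 → Ω → V} {P : V → Measure Ω}

/-- The expectation of the alternating sum of the exit values is a multiple of the probability that
the process stays in the alcove. -/
theorem IsReflectable.integral_altSum_exitMatrix (hV : ∀ i j, diffVec i j ∈ V) (hr : 0 < r)
    (hX : IsReflectable (affineWeylGroup (posRootsA V)) X P) {x : V}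
    (hx : x ∈ alcove (posRootsA V)) (t : ℝ≥0) :
    ∫ ω, altSum (fun _ : Fin r => exitMatrix t (coords fun s => X s ω)) ∂(P x) =
      2 ^ r * ({σ : Equiv.Perm (Fin (2 * r + 1)) | pairSet σ = pairSet 1} : Finset _).card *
        (P x).real {ω | (t : ℝ≥0∞) < exitTime (affSimpleA V) (fun s => X s ω)} := by
  have := hX.isProbabilityMeasure x
  have hΦ : PathMeasurable fun γ : ℝ≥0 → V =>
      altSum (fun _ : Fin r => exitMatrix t (coords γ)) :=
    Finset.measurable_fun_sum _ fun σ _ => pathMeasurable_sign_mul_prod_exitMatrix hV t σ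
  have hC : ∀ γ : ℝ≥0 → V, |altSum (fun _ : Fin r => exitMatrix t (coords γ))| ≤
      ∑ _σ : Equiv.Perm (Fin (2 * r + 1)), (2 : ℝ) ^ r := fun γ =>
    (Finset.abs_sum_le_sum_abs _ _).trans
      (Finset.sum_le_sum fun σ _ => abs_sign_mul_prod_exitMatrix_le t _ σ)
  have hl : ∀ a, Continuous fun y : V => (inner ℝ y (wallRoot hV a) : ℝ) := fun a => by fun_prop
  have hstart : ∀ᵐ ω ∂(P x), InAlcove (coords (fun s => X s ω) 0) := by
    filter_upwards [hX.start x] with ω hω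
    unfold coords
    simp only [hω]
    exact inAlcove_of_mem_alcove hV hx
  have key := hX.integral_eq_setIntegral_of_walls x t
    (l := fun a y => (inner ℝ y (wallRoot hV a) : ℝ)) hl (fun a => (wallLevel a : ℝ))
    (w := fun a => affRefl (wallRoot hV a, wallLevel a))
    (fun a => affRefl_root_mem hV (wallPair_lt hr a) _)
    (fun a y hy => by
      have hy' : (inner ℝ y (wallRoot hV a) : ℝ) = wallLevel a := hy
      rw [wallRoot] at hy' ⊢
      rw [affRefl_apply_of_inner_self (inner_root_self hV (wallPair_lt hr a).ne), hy',
        sub_self, zero_smul, sub_zero])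
    hΦ hC (fun a => by
      filter_upwards [hX.continuous_paths x, hstart] with ω hω h0 h1 h2
      exact altSum_exitMatrix_reflectAfter hV hr hω h0 a h1 h2)
  rw [key]
  have hset : {ω | ∀ a, (t : ℝ≥0∞) < firstTime {s | (inner ℝ (X s ω) (wallRoot hV a) : ℝ) =
      wallLevel a}} = {ω | (t : ℝ≥0∞) < exitTime (affSimpleA V) (fun s => X s ω)} := by
    ext ω
    simp only [Set.mem_ofPred_eq]
    rw [exitTime_eq hV, ← Finset.inf_univ_eq_iInf, Finset.lt_inf_iff ENNReal.coe_lt_top]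
    simp
  have hnull : NullMeasurableSet {ω | ∀ a, (t : ℝ≥0∞) <
      firstTime {s | (inner ℝ (X s ω) (wallRoot hV a) : ℝ) = wallLevel a}} (P x) := by
    rw [Set.ofPred_forall]
    refine NullMeasurableSet.iInter fun a => ?_
    have h := (isStopTime_firstTime (hX.continuous_paths x) (hl a) (wallLevel a)) t
    convert (h.nullMeasurableSet hX.measurable).compl using 1
    ext ω
    simp
  rw [setIntegral_congr_ae₀ (g := fun _ => (2 : ℝ) ^ r *
    ({σ : Equiv.Perm (Fin (2 * r + 1)) | pairSet σ = pairSet 1} : Finset _).card) hnull]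
  · rw [setIntegral_const, hset, smul_eq_mul, mul_comm]
  · filter_upwards [hX.continuous_paths x, hstart] with ω hω h0 hωE
    refine altSum_exitMatrix_of_inAlcove fun s hs => ?_
    refine inAlcove_of_not_hits (continuous_coords hω) h0 fun b hb => ?_
    simp only [coords_sub hV] at hb
    have h1 := (hits_iff ((hl b).comp hω) _).1 hb
    exact absurd (h1.trans (by exact_mod_cast hs)) (not_le.2 (hωE b))

end Walls

/-! ### The limits of the series and the exit probability -/

section Final

variable {r : ℕ} {V : Submodule ℝ (EuclideanSpace ℝ (Fin (2 * r + 1)))}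
  {Ω : Type*} [MeasurableSpace Ω] {X : ℝ≥0 → Ω → V} {P : V → Measure Ω}

/-- The series of a member of the family always converges; its sum is the signed expectation of a
product of exit values. -/
theorem IsReflectable.tendsto_sum_lattice (hV : ∀ i j, diffVec i j ∈ V) (hr : 0 < r)
    (hX : IsReflectable (affineWeylGroup (posRootsA V)) X P) {x : V}
    (hx : x ∈ alcove (posRootsA V)) (t : ℝ≥0) {σ : Equiv.Perm (Fin (2 * r + 1))}
    (hσ : σ ∈ orderedPerms r) :
    Tendsto (fun N : ℕ => ∑ n ∈ Finset.range N,
        ∑ᶠ v ∈ {v : V | v ∈ latticeE (rootSet hV (pairSet σ)) ∧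
            latticeNorm (rootSet hV (pairSet σ)) v = n},
          signA V (rootSet hV (pairSet σ)) * latticeSign (rootSet hV (pairSet σ)) v *
            (P x).real {ω | (t : ℝ≥0∞) <
              setHitTime (rootSet hV (pairSet σ)) v (fun s => X s ω)})
      atTop (𝓝 (∫ ω, ((Equiv.Perm.sign σ : ℤ) : ℝ) * ∏ m : Fin r,
        exitMatrix t (coords fun s => X s ω) (σ (evenIdx m)) (σ (oddIdx m)) ∂(P x))) := by
  have : Nonempty (Fin r) := ⟨⟨0, hr⟩⟩
  have hlt := mem_orderedPerms.1 hσ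
  have hβ : ∀ m : Fin r, inner ℝ (root hV (σ (evenIdx m)) (σ (oddIdx m)))
      (root hV (σ (evenIdx m)) (σ (oddIdx m))) = (2 : ℝ) :=
    fun m => inner_root_self hV (hlt m).ne
  have hort : ∀ m n : Fin r, m ≠ n → inner ℝ (root hV (σ (evenIdx m)) (σ (oddIdx m)))
      (root hV (σ (evenIdx n)) (σ (oddIdx n))) = (0 : ℝ) := fun m n hmn =>
    inner_root_root_eq_zero hV (σ.injective.ne (evenIdx_injective.ne hmn.symm))
      (σ.injective.ne (evenIdx_ne_oddIdx n m)) (σ.injective.ne (evenIdx_ne_oddIdx m n).symm)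
      (σ.injective.ne (oddIdx_injective.ne hmn.symm))
  have hlim := (hX.tendsto_integral_prod_levelSum x hβ hort
    (fun m n => affRefl_root_mem hV (hlt m) n)
    (fun m => hx _ ((mem_posRootsA hV).2 ⟨_, _, hlt m, rfl⟩)) t).const_mul
      ((Equiv.Perm.sign σ : ℤ) : ℝ)
  rw [signA_rootSet hV σ, rootSet_pairSet hV σ]
  simp only [hX.sum_lattice x hβ hort]
  simp only [exitMatrix_of_lt (hlt _), coords_sub hV, integral_const_mul]
  exact hlim

end Final

end AlcoveExit

open AlcoveExit

theorem theorem8 (k : ℕ) (hk : Odd k) (hk3 : 3 ≤ k)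
    (V : Submodule ℝ (EuclideanSpace ℝ (Fin k))) (hV : V = ⊤ ∨ V = sumZero k)
    {Ω : Type*} [MeasurableSpace Ω] (X : ℝ≥0 → Ω → V) (P : V → Measure Ω)
    (hX : IsReflectable (affineWeylGroup (posRootsA V)) X P)
    (x : V) (hx : x ∈ alcove (posRootsA V)) (t : ℝ≥0)
    (S : Set V → ℝ)
    (hS : ∀ A ∈ familyA V,
      Tendsto
        (fun N : ℕ => ∑ n ∈ Finset.range N, ∑ᶠ v ∈ {v : V | v ∈ latticeE A ∧ latticeNorm A v = n},
          signA V A * latticeSign A v *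
            (P x).real {ω | (t : ℝ≥0∞) < setHitTime A v (fun s => X s ω)})
        atTop (𝓝 (S A))) :
    (P x).real {ω | (t : ℝ≥0∞) < exitTime (affSimpleA V) (fun s => X s ω)} =
      ∑ᶠ A ∈ familyA V, S A := by
  obtain ⟨r, rfl⟩ := hk
  have hr : 0 < r := by omega
  have hV' := diffVec_mem hV
  have := hX.isProbabilityMeasure x
  have hlim : ∀ σ ∈ orderedPerms r, S (rootSet hV' (pairSet σ)) =
      ∫ ω, ((Equiv.Perm.sign σ : ℤ) : ℝ) * ∏ m : Fin r,
        exitMatrix t (coords fun s => X s ω) (σ (evenIdx m)) (σ (oddIdx m)) ∂(P x) := by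
    intro σ hσ
    have hmem : rootSet hV' (pairSet σ) ∈ familyA V := by
      rw [familyA_eq hV']
      exact ⟨_, Finset.mem_coe.2 (Finset.mem_image_of_mem _ hσ), rfl⟩
    exact tendsto_nhds_unique (hS _ hmem) (hX.tendsto_sum_lattice hV' hr hx t hσ)
  have hexit := hX.integral_altSum_exitMatrix hV' hr hx t
  simp only [altSum_antisymm (exitMatrix_antisymm t _)] at hexit
  rw [integral_const_mul, integral_finsetSum _ fun σ _ =>
    (pathMeasurable_sign_mul_prod_exitMatrix hV' t σ).integrable hX.measurable
      (hX.continuous_paths x) fun γ => abs_sign_mul_prod_exitMatrix_le t _ σ,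
    ← Finset.sum_congr rfl hlim, ← card_mul_finsum_familyA hV' S, mul_assoc] at hexit
  have hcard : (({σ : Equiv.Perm (Fin (2 * r + 1)) | pairSet σ = pairSet 1} :
      Finset _).card : ℝ) ≠ 0 :=
    Nat.cast_ne_zero.2 (Finset.card_ne_zero.2 ⟨1, by simp⟩)
  exact (mul_left_cancel₀ hcard (mul_left_cancel₀ (by positivity) hexit)).symm
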